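/- \textbf{Model.} A program is run in the work-span model with binary fork-join. It consists of finitely many, possibly recursive, procedures with a constant number of local variables per stack frame. On inputs of size $n$ a machine word has $\Theta(\log n)$ bits. Each thread supports the usual word-RAM instructions (arithmetic, comparison, assignment, branching, loops, procedure calls, reads and writes of a shared memory), and in addition: drawing a fresh uniformly random element of $\{0,\dots,k-1\}$ for a given word $k\ge 1$; the atomic update $M[i]\leftarrow\max(M[i],v)$; and a fork of two procedure calls, followed by a join. Apart from concurrent reads and concurrent $\max$-updates of the same cell, parallel threads may not access a cell that one of them modifies, so that the effect of an execution does not depend on the scheduling. The \emph{work} of an execution is the total number of its instructions and the \emph{span} is the length of its longest chain of dependent instructions. Stack space is the number of words in the stack frames of a sequential execution. The shared memory consists of the input/output array of $n$ words and an auxiliary heap, and heap space (\emph{auxiliary space}) is the length of the shortest initial segment of that (initially zero) heap that contains all cells accessed; both space bounds below hold in every execution. For a parameter $0<\varepsilon<1$ the program is given $n$, the number $\lceil n^{1-\varepsilon}\rceil$ and the array. A bound $O(f(n))$ holds \emph{with high probability} if there is a constant $C$ such that for all $c\ge 1$ and $n \ge 2$ the quantity is at most $C\,c\,f(n)$ with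 probability at least $1-n^{-c}$. A program is \emph{relaxed PIP} (relaxed parallel in-place) if for all $0<\varepsilon<1$ it uses $O(\log n)$ words of stack space in a sequential execution and $O(n^{1-\varepsilon})$ words of heap space, and has span $O(n^{\varepsilon}\operatorname{polylog} n)$ with high probability. \textbf{Theorem.} There is a relaxed PIP program which, for every $0<\varepsilon<1$, solves the random permutation problem: on every array $(a_1,\dots,a_n)$ of words it terminates with probability one, and it leaves in this array $(a_{\sigma(1)},\dots,a_{\sigma(n)})$ with $\sigma$ a uniformly random permutation of $\{1,\dots,n\}$. For every $0<\varepsilon<1$ it takes $O(n)$ expected work, $O(n^{\varepsilon}\log^2 n)$ span with high probability, and $O(n^{1-\varepsilon})$ words of auxiliary (heap) space, where the constants depend only on $\varepsilon$ and the bounds hold for all inputs of size $n\ge 2$. -/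

import Mathlib

/-!
Randomized binary fork-join programs on a word RAM with shared memory: syntax, semantics, and the
four cost measures work, span, stack space and heap space.
-/

noncomputable section

namespace ForkJoin

/-- Shared memory cells: `arr i` is the cell `i` of the input/output array, `aux i` is the cell `i`
of the auxiliary heap. -/
inductive Loc where
  | arr (i : ℕ)
  | aux (i : ℕ)
  deriving DecidableEq

/-- The two regions of the shared memory: input/output array and auxiliary heap. -/
inductive Region where
  | arr
  | aux

/-- The cell with the given address in a region. -/
def Region.loc : Region → ℕ → Loc
  | .arr, i => .arr i
  | .aux, i => .aux i

/-- The array has exactly `n` cells; the heap is unbounded (its use is measured). -/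
def Loc.Valid (n : ℕ) : Loc → Prop
  | .arr i => i < n
  | .aux _ => True

instance (n : ℕ) : DecidablePred (Loc.Valid n) := fun l =>
  match l with
  | .arr i => inferInstanceAs (Decidable (i < n))
  | .aux _ => inferInstanceAs (Decidable True)

/-- The arithmetic of the RAM. -/
inductive BinOp where
  | add | sub | mul | div | mod | lt | eq

/-- Natural number arithmetic with truncated subtraction; a comparison yields `1` or `0`. -/
def BinOp.apply : BinOp → ℕ → ℕ → ℕ
  | .add, a, b => a + b
  | .sub, a, b => a - b
  | .mul, a, b => a * b
  | .div, a, b => a / b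
  | .mod, a, b => a % b
  | .lt, a, b => if a < b then 1 else 0
  | .eq, a, b => if a = b then 1 else 0

/-- Expressions over the `V` private local variables of a thread. -/
inductive Expr (V : ℕ) where
  | const (k : ℕ)
  | var (x : Fin V)
  | bin (o : BinOp) (a b : Expr V)

/-- Value of an expression on a machine with words of `w` bits. -/
def Expr.eval {V : ℕ} (w : ℕ) (env : Fin V → ℕ) : Expr V → ℕ
  | .const k => k % 2 ^ w
  | .var x => env x
  | .bin o a b => o.apply (a.eval w env) (b.eval w env) % 2 ^ w

/-- Cost of evaluating an expression: the number of its nodes. -/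
def Expr.size {V : ℕ} : Expr V → ℕ
  | .const _ => 1
  | .var _ => 1
  | .bin _ a b => 1 + a.size + b.size

/-- Commands of a program with `V` local variables per stack frame and `K` procedures. -/
inductive Com (V K : ℕ) where
  /-- no operation -/
  | skip
  /-- `x := e` -/
  | set (x : Fin V) (e : Expr V)
  /-- `x :=` a fresh uniformly random element of `{0, …, e - 1}` -/
  | rand (x : Fin V) (e : Expr V)
  /-- `x := M[e]` -/
  | load (x : Fin V) (r : Region) (e : Expr V)
  /-- `M[e] := v` -/
  | store (r : Region) (e v : Expr V)
  /-- the atomic update `M[e] := max (M[e], v)` -/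
  | storeMax (r : Region) (e v : Expr V)
  | seq (c d : Com V K)
  | ite (e : Expr V) (c d : Com V K)
  | loop (e : Expr V) (c : Com V K)
  /-- `x := f(as)`; the locals of the new stack frame are initialised with the arguments -/
  | call (x : Fin V) (f : Fin K) (as : Fin V → Expr V)
  /-- binary fork: `f(as)` and `g(bs)` run in parallel; after both have terminated (join), `x` and
  then `y` receive the values returned -/
  | par (x : Fin V) (f : Fin K) (as : Fin V → Expr V) (y : Fin V) (g : Fin K) (bs : Fin V → Expr V)

/-- A program: finitely many (possibly recursive) procedures, each with a body and an expression
for the value it returns, and a constant that fixes the word length. -/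
structure Program where
  V : ℕ
  K : ℕ
  body : Fin K → Com V K
  ret : Fin K → Expr V
  main : Fin K
  wordFactor : ℕ
  wordFactor_pos : 0 < wordFactor

/-- Words have `Θ(log n)` bits on inputs of size `n`. -/
def Program.wordBits (P : Program) (n : ℕ) : ℕ := P.wordFactor * (Nat.log 2 n + 1)

/-- What is recorded about (a part of) an execution: its work, its span, the number of stack frames
that are needed, beyond the current one, when it is run sequentially, and the shared cells that it
reads, writes by `store`, and updates by `storeMax`. -/
structure Trace where
  work : ℕ
  span : ℕ
  frames : ℕ
  reads : Finset Loc
  writes : Finset Loc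
  maxes : Finset Loc

namespace Trace

/-- `c` instructions without access to the shared memory. -/
def tick (c : ℕ) : Trace := ⟨c, c, 0, ∅, ∅, ∅⟩

/-- First `t`, then `u`. -/
def seq (t u : Trace) : Trace :=
  ⟨t.work + u.work, t.span + u.span, max t.frames u.frames,
    t.reads ∪ u.reads, t.writes ∪ u.writes, t.maxes ∪ u.maxes⟩

/-- `t` and `u` in parallel. -/
def par (t u : Trace) : Trace :=
  ⟨t.work + u.work, max t.span u.span, max t.frames u.frames,
    t.reads ∪ u.reads, t.writes ∪ u.writes, t.maxes ∪ u.maxes⟩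

/-- `t`, run in a new stack frame. -/
def inFrame (t : Trace) : Trace := { t with frames := t.frames + 1 }

/-- Parallel threads may read common cells and may apply `storeMax` to common cells; every other
access to a common cell is a race. If there is no race, then all interleavings of the two threads
have the same effect. -/
def NoRace (t u : Trace) : Prop :=
  Disjoint t.writes (u.reads ∪ u.writes ∪ u.maxes) ∧
  Disjoint u.writes (t.reads ∪ t.writes ∪ t.maxes) ∧
  Disjoint t.reads u.maxes ∧ Disjoint u.reads t.maxes

instance (t u : Trace) : Decidable (NoRace t u) := by unfold NoRace; infer_instance

/-- Number of words of the auxiliary heap that have to be allocated. -/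
def heapWords (t : Trace) : ℕ :=
  (t.reads ∪ t.writes ∪ t.maxes).sup fun l =>
    match l with
    | .arr _ => 0
    | .aux i => i + 1

end Trace

/-- The private locals of the current thread (top stack frame) and the shared memory. -/
structure State (V : ℕ) where
  env : Fin V → ℕ
  mem : Loc → ℕ

/-- Assignment to a local variable. -/
def State.setVar {V : ℕ} (s : State V) (x : Fin V) (v : ℕ) : State V :=
  { s with env := Function.update s.env x v }

/-- Assignment to a shared cell. -/
def State.setMem {V : ℕ} (s : State V) (l : Loc) (v : ℕ) : State V :=
  { s with mem := Function.update s.mem l v }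

/-- A random outcome: final state and trace, or `none` for an execution that has not terminated
within the given fuel or has failed. -/
abbrev Outcome (V : ℕ) := PMF (Option (State V × Trace))

/-- Failure. -/
def Outcome.fail {V : ℕ} : Outcome V := PMF.pure none

/-- Termination in the state `s` with the trace `t`. -/
def Outcome.done {V : ℕ} (s : State V) (t : Trace) : Outcome V := PMF.pure (some (s, t))

/-- Continuation after termination. -/
def Outcome.andThen {V : ℕ} (m : Outcome V) (f : State V → Trace → Outcome V) : Outcome V :=
  PMF.bind m fun o =>
    match o with
    | none => Outcome.fail
    | some (s, t) => f s t

/-- Cost of evaluating the arguments of a call. -/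
def argsSize {V : ℕ} (as : Fin V → Expr V) : ℕ := ∑ i, (as i).size

/-- Semantics of commands, for words of `w` bits and an array of `n` cells. The first explicit
argument is a fuel that bounds the depth of the evaluation. An execution fails if it accesses the
array outside its bounds, draws a random element of the empty set, or has a race. Parallel threads
are evaluated one after the other, which is the effect of every interleaving as there is no race;
their work adds up, and their span is the maximum. -/
def exec (P : Program) (w n : ℕ) : ℕ → Com P.V P.K → State P.V → Outcome P.V
  | 0, _, _ => Outcome.fail
  | _ + 1, .skip, s => Outcome.done s (.tick 1)
  | _ + 1, .set x e, s => Outcome.done (s.setVar x (e.eval w s.env)) (.tick (1 + e.size))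
  | _ + 1, .rand x e, s =>
      if h : e.eval w s.env = 0 then Outcome.fail
      else
        haveI : NeZero (e.eval w s.env) := ⟨h⟩
        PMF.bind (PMF.uniformOfFintype (Fin (e.eval w s.env))) fun v =>
          Outcome.done (s.setVar x v) (.tick (1 + e.size))
  | _ + 1, .load x r e, s =>
      if (r.loc (e.eval w s.env)).Valid n then
        Outcome.done (s.setVar x (s.mem (r.loc (e.eval w s.env))))
          { Trace.tick (1 + e.size) with reads := {r.loc (e.eval w s.env)} }
      else Outcome.fail
  | _ + 1, .store r e v, s =>
      if (r.loc (e.eval w s.env)).Valid n then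
        Outcome.done (s.setMem (r.loc (e.eval w s.env)) (v.eval w s.env))
          { Trace.tick (1 + e.size + v.size) with writes := {r.loc (e.eval w s.env)} }
      else Outcome.fail
  | _ + 1, .storeMax r e v, s =>
      if (r.loc (e.eval w s.env)).Valid n then
        Outcome.done (s.setMem (r.loc (e.eval w s.env))
            (max (s.mem (r.loc (e.eval w s.env))) (v.eval w s.env)))
          { Trace.tick (1 + e.size + v.size) with maxes := {r.loc (e.eval w s.env)} }
      else Outcome.fail
  | k + 1, .seq c d, s =>
      (exec P w n k c s).andThen fun s₁ t₁ =>
        (exec P w n k d s₁).andThen fun s₂ t₂ => Outcome.done s₂ (t₁.seq t₂)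
  | k + 1, .ite e c d, s =>
      (exec P w n k (if e.eval w s.env = 0 then d else c) s).andThen fun s₁ t₁ =>
        Outcome.done s₁ ((Trace.tick (1 + e.size)).seq t₁)
  | k + 1, .loop e c, s =>
      if e.eval w s.env = 0 then Outcome.done s (.tick (1 + e.size))
      else
        (exec P w n k (.seq c (.loop e c)) s).andThen fun s₁ t₁ =>
          Outcome.done s₁ ((Trace.tick (1 + e.size)).seq t₁)
  | k + 1, .call x f as, s =>
      (exec P w n k (P.body f) ⟨fun i => (as i).eval w s.env, s.mem⟩).andThen fun s₁ t₁ =>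
        Outcome.done ⟨Function.update s.env x ((P.ret f).eval w s₁.env), s₁.mem⟩
          ((Trace.tick (1 + argsSize as + (P.ret f).size)).seq t₁.inFrame)
  | k + 1, .par x f as y g bs, s =>
      (exec P w n k (P.body f) ⟨fun i => (as i).eval w s.env, s.mem⟩).andThen fun s₁ t₁ =>
        (exec P w n k (P.body g) ⟨fun i => (bs i).eval w s.env, s₁.mem⟩).andThen fun s₂ t₂ =>
          if t₁.NoRace t₂ then
            Outcome.done
              ⟨Function.update (Function.update s.env x ((P.ret f).eval w s₁.env)) y
                ((P.ret g).eval w s₂.env), s₂.mem⟩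
              ((Trace.tick (1 + argsSize as + argsSize bs + (P.ret f).size + (P.ret g).size)).seq
                (t₁.inFrame.par t₂.inFrame))
          else Outcome.fail

/-- Initial state: the array holds the input `a`, the heap is empty, the first two locals of the
main procedure hold the input size `n` and the space parameter `m`. -/
def Program.init (P : Program) {n : ℕ} (m : ℕ) (a : Fin n → ℕ) : State P.V where
  env := fun x => if x.val = 0 then n else if x.val = 1 then m else 0
  mem := fun l =>
    match l with
    | .arr i => if h : i < n then a ⟨i, h⟩ else 0
    | .aux _ => 0

/-- `P.law m a r` is the probability that the program `P`, started on the array `a` with space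
parameter `m`, terminates with the final state and trace `r`. (The probability to terminate with
`r` within a given fuel is nondecreasing in the fuel.) -/
def Program.law (P : Program) {n : ℕ} (m : ℕ) (a : Fin n → ℕ) (r : State P.V × Trace) : ENNReal :=
  ⨆ k : ℕ, exec P (P.wordBits n) n k (P.body P.main) (P.init m a) (some r)

/-- The probability that `P` terminates with a final state and trace in `S`. -/
def Program.prob (P : Program) {n : ℕ} (m : ℕ) (a : Fin n → ℕ) (S : Set (State P.V × Trace)) :
    ENNReal :=
  ∑' r : S, P.law m a r

/-- The expected work of `P`, infinite if `P` does not terminate almost surely. -/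
def Program.expectedWork (P : Program) {n : ℕ} (m : ℕ) (a : Fin n → ℕ) : ENNReal :=
  (∑' r, P.law m a r * (r.2.work : ENNReal)) + (1 - P.prob m a Set.univ) * ⊤

/-- Words of stack space in a sequential execution with trace `t`: every frame holds `V` locals and
a return address. -/
def Program.stackWords (P : Program) (t : Trace) : ℕ := (t.frames + 1) * (P.V + 1)

/-- Every array entry is a word. -/
def Program.IsInput (P : Program) {n : ℕ} (a : Fin n → ℕ) : Prop :=
  ∀ i, a i < 2 ^ P.wordBits n

/-- The space parameter `⌈n ^ (1 - ε)⌉`. -/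
def spaceParam (n : ℕ) (ε : ℝ) : ℕ := ⌈(n : ℝ) ^ (1 - ε)⌉₊

/-- `P` randomly permutes its input: it terminates with probability one, and the final content of
the array is distributed as `a ∘ σ` for a uniformly random permutation `σ`. -/
def Program.RandomlyPermutes (P : Program) (ε : ℝ) : Prop :=
  ∀ (n : ℕ) (a : Fin n → ℕ), P.IsInput a →
    P.prob (spaceParam n ε) a Set.univ = 1 ∧
    ∀ b : Fin n → ℕ,
      P.prob (spaceParam n ε) a {r | ∀ i : Fin n, r.1.mem (.arr i) = b i} =
        (Nat.card {σ : Equiv.Perm (Fin n) // a ∘ σ = b} : ENNReal) / (n.factorial : ENNReal)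

/-- The expected work is `O(f(n))`. -/
def Program.ExpectedWorkBigO (P : Program) (ε : ℝ) (f : ℕ → ℝ) : Prop :=
  ∃ C : ℝ, 0 < C ∧ ∀ n : ℕ, 2 ≤ n → ∀ a : Fin n → ℕ, P.IsInput a →
    P.expectedWork (spaceParam n ε) a ≤ ENNReal.ofReal (C * f n)

/-- The span is `O(f(n))` with high probability: for every `c ≥ 1`, it is at most `C * c * f(n)`
with probability at least `1 - n ^ (-c)`. -/
def Program.SpanBigOWhp (P : Program) (ε : ℝ) (f : ℕ → ℝ) : Prop :=
  ∃ C : ℝ, 0 < C ∧ ∀ c : ℝ, 1 ≤ c → ∀ n : ℕ, 2 ≤ n → ∀ a : Fin n → ℕ, P.IsInput a →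
    1 - ENNReal.ofReal ((n : ℝ) ^ (-c)) ≤
      P.prob (spaceParam n ε) a {r | (r.2.span : ℝ) ≤ C * c * f n}

/-- The heap space is `O(f(n))` in every execution. -/
def Program.HeapBigO (P : Program) (ε : ℝ) (f : ℕ → ℝ) : Prop :=
  ∃ C : ℝ, 0 < C ∧ ∀ n : ℕ, 2 ≤ n → ∀ a : Fin n → ℕ, P.IsInput a →
    ∀ r, P.law (spaceParam n ε) a r ≠ 0 → (r.2.heapWords : ℝ) ≤ C * f n

/-- The stack space of a sequential run is `O(f(n))` in every execution. -/
def Program.StackBigO (P : Program) (ε : ℝ) (f : ℕ → ℝ) : Prop :=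
  ∃ C : ℝ, 0 < C ∧ ∀ n : ℕ, 2 ≤ n → ∀ a : Fin n → ℕ, P.IsInput a →
    ∀ r, P.law (spaceParam n ε) a r ≠ 0 → (P.stackWords r.2 : ℝ) ≤ C * f n

/-- Relaxed parallel in-place: for all `0 < ε < 1`, the program uses `O(log n)` words of stack
space sequentially and `O(n ^ (1 - ε))` words of heap space, and its span is
`O(n ^ ε * polylog n)` with high probability. -/
def Program.IsRelaxedPIP (P : Program) : Prop :=
  ∀ ε : ℝ, 0 < ε → ε < 1 →
    P.StackBigO ε (fun n => Real.log n) ∧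
    P.HeapBigO ε (fun n => (n : ℝ) ^ (1 - ε)) ∧
    ∃ d : ℕ, P.SpanBigOWhp ε (fun n => (n : ℝ) ^ ε * Real.log n ^ d)

end ForkJoin

end

/-! The program is the Knuth shuffle: for `i = 1, …, n - 1` a target `j` is drawn uniformly from
`{0, …, i}` and the entries `i` and `j` are exchanged. The result is uniform because a permutation
determines its last draw, as the preimage of the last position; induction gives `permLaw_apply`. All
the rest concerns doing these exchanges in parallel and in little memory without changing their
product.

Correctness of the parallel execution. The steps are handled in blocks of length `min s m (n - s)`,
where `s` is the start of the block. All targets of a block are drawn first. Then, in rounds, every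
pending item raises the slots of its two positions to its stamp by atomic maxima. Stamps grow with
time, so slots are never cleared, and within a round earlier steps have larger stamps. An item wins
if both slots carry its stamp, which happens exactly when no earlier pending item is in conflict
with it (`win_iff`). A winner commutes with all pending items before it, so executing the winners at
once and keeping the losers in order preserves the product (`knuth_split`). Positions before the
block are hashed modulo its length, which keeps the slots within `2 * m` cells; a collision only
causes an unneeded loss.

Number of rounds. For the analysis, an item has weight one plus twice the sum of the weights of the
earlier items in conflict with it. A loser has an earlier pending rival, so after `k` rounds all
pending weights are at least `2 ^ k`. Hence a block of total weight `W` needs at most `log W + 1`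
rounds, and the numbers of pending items in all rounds add up to at most `W`
(`pot_filter_add_length`, `settle_det`). In a block of length `b`, a new item conflicts with a given
earlier one with probability at most `3 / b` (`expect_conf_le`), so each draw multiplies the
expected total weight by at most `1 + 6 / b` and adds a bounded amount. This yields `729 * b` for a
block (`expect_weight_itemsOf_le`) and `729 * n` overall. Linear expected work follows, and Markov's
inequality with the factor `n ^ c` turns the bound into `log W = O(c log n)` with high probability;
no finer concentration is needed.

Costs. Groups of `L = log n + 2` items are processed sequentially, and the groups of a block by a
binary fork tree of depth at most `L`. So a round has span `O(L)` and the stack has `O(log n)`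
frames. The overhead of a round, proportional to the number of groups, is absorbed by
`groups_mul_log_le`. There are `O(n ^ ε)` blocks (`blockCount_add_one_le`).

Form of the proof. `Sem` couples an execution with a ghost variable, here the list of draws, and
final memory and trace are controlled pathwise in terms of it. `sweep_runs` treats the fork tree
once for all phases; `settle_det`, `block_runs` and `main_runs` assemble the program. Afterwards
only the distribution `draws` has to be studied. -/

noncomputable section

namespace ForkJoin

/-! ### Fuel-indexed outcomes coupled with a random source -/

/-- `Sem F p Q`: for all large fuels the outcome `F` is terminating with probability one, and can be
coupled with a ghost variable of law `p` such that `Q` holds almost surely. -/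
def Sem {V : ℕ} {α : Type} (F : ℕ → Outcome V) (p : PMF α) (Q : α → State V → Trace → Prop) : Prop :=
  ∃ μ : PMF (α × State V × Trace), μ.support.Finite ∧ μ.map Prod.fst = p ∧
    (∃ K, ∀ k, K ≤ k → F k = μ.map fun z => some z.2) ∧
    ∀ z ∈ μ.support, Q z.1 z.2.1 z.2.2

theorem bind_congr_support {α β : Type} (p : PMF α) (f g : α → PMF β)
    (h : ∀ x ∈ p.support, f x = g x) : p.bind f = p.bind g := by
  ext y
  simp only [PMF.bind_apply]
  refine tsum_congr fun x => ?_
  by_cases hx : p x = 0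
  · simp [hx]
  · rw [h x ((PMF.mem_support_iff _ _).2 hx)]

namespace Sem

variable {V : ℕ} {α β γ : Type}

theorem done {s : State V} {t : Trace} {a : α} {Q : α → State V → Trace → Prop} (h : Q a s t) :
    Sem (fun _ => Outcome.done s t) (PMF.pure a) Q := by
  refine ⟨PMF.pure (a, s, t), ?_, ?_, ⟨0, fun k _ => ?_⟩, ?_⟩
  · simp
  · simp [PMF.pure_map]
  · simp [PMF.pure_map, Outcome.done]
  · intro z hz
    simp only [PMF.support_pure, Set.mem_singleton_iff] at hz
    subst hz; exact h

theorem mono {F : ℕ → Outcome V} {p : PMF α} {Q Q' : α → State V → Trace → Prop}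
    (h : Sem F p Q) (hQ : ∀ a s t, a ∈ p.support → Q a s t → Q' a s t) : Sem F p Q' := by
  obtain ⟨μ, hf, hp, hK, hμ⟩ := h
  refine ⟨μ, hf, hp, hK, fun z hz => hQ _ _ _ ?_ (hμ z hz)⟩
  rw [← hp, PMF.support_map]
  exact ⟨z, hz, rfl⟩

theorem shift {F F' : ℕ → Outcome V} {p : PMF α} {Q : α → State V → Trace → Prop}
    (h : Sem F p Q) (hF : ∀ k, F' (k + 1) = F k) : Sem F' p Q := by
  obtain ⟨μ, hf, hp, ⟨K, hK⟩, hμ⟩ := h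
  refine ⟨μ, hf, hp, ⟨K + 1, fun k hk => ?_⟩, hμ⟩
  obtain ⟨k, rfl⟩ : ∃ k', k = k' + 1 := ⟨k - 1, by omega⟩
  rw [hF, hK k (by omega)]

theorem map {F : ℕ → Outcome V} {p : PMF α} {Q : α → State V → Trace → Prop}
    {Q' : β → State V → Trace → Prop} (g : α → β)
    (h : Sem F p Q) (hQ : ∀ a s t, a ∈ p.support → Q a s t → Q' (g a) s t) :
    Sem F (p.map g) Q' := by
  obtain ⟨μ, hf, hp, ⟨K, hK⟩, hμ⟩ := h
  refine ⟨μ.map fun z => (g z.1, z.2), ?_, ?_, ⟨K, fun k hk => ?_⟩, ?_⟩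
  · rw [PMF.support_map]; exact hf.image _
  · rw [PMF.map_comp, ← hp, PMF.map_comp]; rfl
  · rw [hK k hk, PMF.map_comp]; rfl
  · intro z hz
    rw [PMF.support_map] at hz
    obtain ⟨z', hz', rfl⟩ := hz
    refine hQ _ _ _ ?_ (hμ z' hz')
    rw [← hp, PMF.support_map]
    exact ⟨z', hz', rfl⟩

/-- For each value of the first ghost variable the continuation has its own coupling; the joint law
is their composition, and `g` merges the two ghost variables. Finite supports are carried along
because they let one fuel bound serve all branches. -/
theorem andThen {F : ℕ → Outcome V} {G : ℕ → State V → Trace → Outcome V} {p : PMF α}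
    {q : α → PMF β} {Q : α → State V → Trace → Prop} {R : γ → State V → Trace → Prop}
    (g : α → β → γ) (hF : Sem F p Q)
    (hG : ∀ a s t, Q a s t → Sem (fun k => G k s t) (q a) (fun b => R (g a b))) :
    Sem (fun k => (F k).andThen (G k)) (p.bind fun a => (q a).map (g a)) R := by
  classical
  obtain ⟨μ, hf, hp, ⟨K, hK⟩, hμ⟩ := hF
  have key : ∀ z : α × State V × Trace, ∃ ν : PMF (β × State V × Trace), z ∈ μ.support →
      ν.support.Finite ∧ ν.map Prod.fst = q z.1 ∧
      (∃ K, ∀ k, K ≤ k → G k z.2.1 z.2.2 = ν.map fun y => some y.2) ∧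
      ∀ y ∈ ν.support, R (g z.1 y.1) y.2.1 y.2.2 := by
    intro z
    by_cases hz : z ∈ μ.support
    · obtain ⟨ν, hν⟩ := hG _ _ _ (hμ z hz)
      exact ⟨ν, fun _ => hν⟩
    -- Off the support any distribution will do; it is borrowed from a point of the support.
    · obtain ⟨z0, hz0⟩ := μ.support_nonempty
      obtain ⟨ν, hν⟩ := hG _ _ _ (hμ z0 hz0)
      exact ⟨ν, fun h => absurd h hz⟩
  choose ν hν using key
  have key2 : ∀ z : α × State V × Trace, ∃ K, z ∈ μ.support →
      ∀ k, K ≤ k → G k z.2.1 z.2.2 = (ν z).map fun y => some y.2 := by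
    intro z
    by_cases hz : z ∈ μ.support
    · obtain ⟨K, hK⟩ := (hν z hz).2.2.1
      exact ⟨K, fun _ => hK⟩
    · exact ⟨0, fun h => absurd h hz⟩
  choose Kf hKf using key2
  -- A common fuel threshold for the finitely many continuations.
  obtain ⟨B, hB⟩ := (hf.image Kf).bddAbove
  refine ⟨μ.bind fun z => (ν z).map fun y => (g z.1 y.1, y.2), ?_, ?_,
    ⟨max K B, fun k hk => ?_⟩, ?_⟩
  · rw [PMF.support_bind]
    refine hf.biUnion fun z hz => ?_
    rw [PMF.support_map]
    exact (hν z hz).1.image _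
  · rw [PMF.map_bind, ← hp, PMF.bind_map]
    refine bind_congr_support _ _ _ fun z hz => ?_
    simp only [Function.comp_apply]
    rw [← (hν z hz).2.1, PMF.map_comp, PMF.map_comp]; rfl
  · change (F k).andThen (G k) = _
    rw [hK k (le_trans (le_max_left _ _) hk)]
    simp only [Outcome.andThen]
    rw [PMF.bind_map, PMF.map_bind]
    refine bind_congr_support _ _ _ fun z hz => ?_
    simp only [Function.comp_apply]
    rw [hKf z hz k (le_trans (hB ⟨z, hz, rfl⟩) (le_trans (le_max_right _ _) hk)), PMF.map_comp]
    rfl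
  · intro y hy
    rw [PMF.support_bind] at hy
    simp only [Set.mem_iUnion] at hy
    obtain ⟨z, hz, hy⟩ := hy
    rw [PMF.support_map] at hy
    obtain ⟨y', hy', rfl⟩ := hy
    exact (hν z hz).2.2.2 y' hy'

/-- Sequencing of two deterministic outcomes. -/
theorem andThen_det {F : ℕ → Outcome V} {G : ℕ → State V → Trace → Outcome V}
    {Q : State V → Trace → Prop} {R : State V → Trace → Prop}
    (hF : Sem F (PMF.pure ()) (fun _ => Q))
    (hG : ∀ s t, Q s t → Sem (fun k => G k s t) (PMF.pure ()) (fun _ => R)) :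
    Sem (fun k => (F k).andThen (G k)) (PMF.pure ()) (fun _ => R) := by
  have := andThen (q := fun _ => PMF.pure ()) (R := fun _ : Unit => R) (fun _ _ => ()) hF
    (fun _ s t h => hG s t h)
  simpa [PMF.pure_map] using this

/-- A deterministic outcome, followed by a random one. -/
theorem andThen_left {F : ℕ → Outcome V} {G : ℕ → State V → Trace → Outcome V} {q : PMF β}
    {Q : State V → Trace → Prop} {R : β → State V → Trace → Prop}
    (hF : Sem F (PMF.pure ()) (fun _ => Q))
    (hG : ∀ s t, Q s t → Sem (fun k => G k s t) q R) :
    Sem (fun k => (F k).andThen (G k)) q R := by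
  have := andThen (q := fun _ => q) (R := R) (fun _ b => b) hF (fun _ s t h => hG s t h)
  simpa [show (fun b : β => b) = id from rfl, PMF.map_id] using this

/-- A random outcome, followed by a deterministic one. -/
theorem andThen_right {F : ℕ → Outcome V} {G : ℕ → State V → Trace → Outcome V} {p : PMF α}
    {Q : α → State V → Trace → Prop} {R : α → State V → Trace → Prop}
    (hF : Sem F p Q)
    (hG : ∀ a s t, Q a s t → Sem (fun k => G k s t) (PMF.pure ()) (fun _ => R a)) :
    Sem (fun k => (F k).andThen (G k)) p R := by
  have := andThen (q := fun _ => PMF.pure ()) (R := R) (fun a _ => a) hF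
    (fun a s t h => hG a s t h)
  simpa [PMF.pure_map] using this

end Sem

/-! ### Upper bounds for traces -/

/-- An upper bound for a trace: work, span and frames are bounded by numbers, the sets of cells by
sets. -/
structure Cost where
  work : ℕ
  span : ℕ
  frames : ℕ
  reads : Set Loc
  writes : Set Loc
  maxes : Set Loc

/-- The trace `t` satisfies the bound `B`. -/
structure Trace.Le (t : Trace) (B : Cost) : Prop where
  work : t.work ≤ B.work
  span : t.span ≤ B.span
  frames : t.frames ≤ B.frames
  reads : ↑t.reads ⊆ B.reads
  writes : ↑t.writes ⊆ B.writes
  maxes : ↑t.maxes ⊆ B.maxes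

theorem Trace.Le.seq {t u : Trace} {B C D : Cost} (ht : t.Le B) (hu : u.Le C)
    (hw : B.work + C.work ≤ D.work) (hs : B.span + C.span ≤ D.span)
    (hf : max B.frames C.frames ≤ D.frames) (hr : B.reads ∪ C.reads ⊆ D.reads)
    (hwr : B.writes ∪ C.writes ⊆ D.writes) (hm : B.maxes ∪ C.maxes ⊆ D.maxes) :
    (t.seq u).Le D where
  work := (add_le_add ht.work hu.work).trans hw
  span := (add_le_add ht.span hu.span).trans hs
  frames := (max_le_max ht.frames hu.frames).trans hf
  reads := by
    simp only [Trace.seq, Finset.coe_union]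
    exact (Set.union_subset_union ht.reads hu.reads).trans hr
  writes := by
    simp only [Trace.seq, Finset.coe_union]
    exact (Set.union_subset_union ht.writes hu.writes).trans hwr
  maxes := by
    simp only [Trace.seq, Finset.coe_union]
    exact (Set.union_subset_union ht.maxes hu.maxes).trans hm

/-- Bounds on the accessed cells that exclude a race. -/
def Cost.NoRace (B C : Cost) : Prop :=
  Disjoint B.writes (C.reads ∪ C.writes ∪ C.maxes) ∧
  Disjoint C.writes (B.reads ∪ B.writes ∪ B.maxes) ∧
  Disjoint B.reads C.maxes ∧ Disjoint C.reads B.maxes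

/-- Disjointness passes to subsets, so race freedom may be checked on the upper bounds instead of
the random traces. -/
theorem Trace.Le.noRace {t u : Trace} {B C : Cost} (ht : t.Le B) (hu : u.Le C)
    (h : B.NoRace C) : t.NoRace u := by
  obtain ⟨h1, h2, h3, h4⟩ := h
  refine ⟨?_, ?_, ?_, ?_⟩ <;> rw [← Finset.disjoint_coe] <;> push_cast
  · exact h1.mono ht.writes (Set.union_subset_union (Set.union_subset_union hu.reads hu.writes) hu.maxes)
  · exact h2.mono hu.writes (Set.union_subset_union (Set.union_subset_union ht.reads ht.writes) ht.maxes)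
  · exact h3.mono ht.reads hu.maxes
  · exact h4.mono hu.reads ht.maxes

/-! ### Rules for commands -/

section Rules

variable {P : Program} {w n : ℕ} {α β γ : Type}

/-- Random execution of a command. -/
abbrev Runs (P : Program) (w n : ℕ) (c : Com P.V P.K) (s : State P.V) (p : PMF α)
    (Q : α → State P.V → Trace → Prop) : Prop :=
  Sem (fun k => exec P w n k c s) p Q

/-- Deterministic execution of a command. -/
abbrev Det (P : Program) (w n : ℕ) (c : Com P.V P.K) (s : State P.V)
    (Q : State P.V → Trace → Prop) : Prop :=
  Runs P w n c s (PMF.pure ()) fun _ => Q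

theorem Det.mono {c : Com P.V P.K} {s : State P.V} {Q Q' : State P.V → Trace → Prop}
    (h : Det P w n c s Q) (hQ : ∀ s t, Q s t → Q' s t) : Det P w n c s Q' :=
  Sem.mono h fun _ s t _ => hQ s t

theorem Det.runs {c : Com P.V P.K} {s : State P.V} {Q : State P.V → Trace → Prop} (a : α)
    {Q' : α → State P.V → Trace → Prop}
    (h : Det P w n c s Q) (hQ : ∀ s t, Q s t → Q' a s t) : Runs P w n c s (PMF.pure a) Q' := by
  have := Sem.map (Q' := Q') (fun _ => a) h fun _ s t _ => hQ s t
  simpa [PMF.pure_map] using this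

theorem Det.set {x : Fin P.V} {e : Expr P.V} {s : State P.V} {Q : State P.V → Trace → Prop} (v : ℕ)
    (hv : e.eval w s.env = v) (h : Q (s.setVar x v) (.tick (1 + e.size))) :
    Det P w n (.set x e) s Q := by
  subst hv
  exact Sem.shift (Sem.done h) fun k => rfl

theorem Det.load {x : Fin P.V} {r : Region} {e : Expr P.V} {s : State P.V}
    {Q : State P.V → Trace → Prop} (v : ℕ)
    (hv : e.eval w s.env = v) (hval : (r.loc v).Valid n)
    (h : Q (s.setVar x (s.mem (r.loc v))) { Trace.tick (1 + e.size) with reads := {r.loc v} }) :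
    Det P w n (.load x r e) s Q := by
  subst hv
  exact Sem.shift (Sem.done h) fun k => by simp only [exec, if_pos hval]

theorem Det.store {r : Region} {e v : Expr P.V} {s : State P.V}
    {Q : State P.V → Trace → Prop} (a b : ℕ)
    (ha : e.eval w s.env = a) (hb : v.eval w s.env = b) (hval : (r.loc a).Valid n)
    (h : Q (s.setMem (r.loc a) b)
      { Trace.tick (1 + e.size + v.size) with writes := {r.loc a} }) :
    Det P w n (.store r e v) s Q := by
  subst ha hb
  exact Sem.shift (Sem.done h) fun k => by simp only [exec, if_pos hval]

theorem Det.storeMax {r : Region} {e v : Expr P.V} {s : State P.V}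
    {Q : State P.V → Trace → Prop} (a b : ℕ)
    (ha : e.eval w s.env = a) (hb : v.eval w s.env = b) (hval : (r.loc a).Valid n)
    (h : Q (s.setMem (r.loc a) (max (s.mem (r.loc a)) b))
      { Trace.tick (1 + e.size + v.size) with maxes := {r.loc a} }) :
    Det P w n (.storeMax r e v) s Q := by
  subst ha hb
  exact Sem.shift (Sem.done h) fun k => by simp only [exec, if_pos hval]

theorem Det.seq {c d : Com P.V P.K} {s : State P.V} {Q : State P.V → Trace → Prop}
    (h : Det P w n c s fun s₁ t₁ => Det P w n d s₁ fun s₂ t₂ => Q s₂ (t₁.seq t₂)) :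
    Det P w n (.seq c d) s Q := by
  refine Sem.shift (Sem.andThen_det h fun s₁ t₁ h₁ => ?_) fun k => rfl
  exact Sem.andThen_det h₁ fun s₂ t₂ h₂ => Sem.done h₂

theorem Runs.seq_left {c d : Com P.V P.K} {s : State P.V} {p : PMF α}
    {Q : α → State P.V → Trace → Prop}
    (h : Det P w n c s fun s₁ t₁ => Runs P w n d s₁ p fun a s₂ t₂ => Q a s₂ (t₁.seq t₂)) :
    Runs P w n (.seq c d) s p Q := by
  refine Sem.shift (Sem.andThen_left h fun s₁ t₁ h₁ => ?_) fun k => rfl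
  exact Sem.andThen_right h₁ fun a s₂ t₂ h₂ => Sem.done h₂

theorem Runs.seq_right {c d : Com P.V P.K} {s : State P.V} {p : PMF α}
    {Q : α → State P.V → Trace → Prop}
    (h : Runs P w n c s p fun a s₁ t₁ => Det P w n d s₁ fun s₂ t₂ => Q a s₂ (t₁.seq t₂)) :
    Runs P w n (.seq c d) s p Q := by
  refine Sem.shift (Sem.andThen_right h fun a s₁ t₁ h₁ => ?_) fun k => rfl
  exact Sem.andThen_det h₁ fun s₂ t₂ h₂ => Sem.done h₂

theorem Runs.seq {c d : Com P.V P.K} {s : State P.V} {p : PMF α} {q : α → PMF β}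
    {Q : γ → State P.V → Trace → Prop} (g : α → β → γ)
    (h : Runs P w n c s p fun a s₁ t₁ =>
      Runs P w n d s₁ (q a) fun b s₂ t₂ => Q (g a b) s₂ (t₁.seq t₂)) :
    Runs P w n (.seq c d) s (p.bind fun a => (q a).map (g a)) Q := by
  refine Sem.shift (Sem.andThen g h fun a s₁ t₁ h₁ => ?_) fun k => rfl
  exact Sem.andThen_right h₁ fun b s₂ t₂ h₂ => Sem.done h₂

theorem Runs.ite {e : Expr P.V} {c d : Com P.V P.K} {s : State P.V} {p : PMF α}
    {Q : α → State P.V → Trace → Prop}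
    (h₁ : e.eval w s.env ≠ 0 →
      Runs P w n c s p fun a s t => Q a s ((Trace.tick (1 + e.size)).seq t))
    (h₂ : e.eval w s.env = 0 →
      Runs P w n d s p fun a s t => Q a s ((Trace.tick (1 + e.size)).seq t)) :
    Runs P w n (.ite e c d) s p Q := by
  by_cases he : e.eval w s.env = 0
  · exact Sem.shift (Sem.andThen_right (h₂ he) fun a s₁ t₁ h => Sem.done h)
      fun k => by simp only [exec, if_pos he]
  · exact Sem.shift (Sem.andThen_right (h₁ he) fun a s₁ t₁ h => Sem.done h)
      fun k => by simp only [exec, if_neg he]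

theorem Det.loop_exit {e : Expr P.V} {c : Com P.V P.K} {s : State P.V}
    {Q : State P.V → Trace → Prop} (he : e.eval w s.env = 0) (h : Q s (.tick (1 + e.size))) :
    Det P w n (.loop e c) s Q :=
  Sem.shift (Sem.done h) fun k => by simp only [exec, if_pos he]

theorem Runs.loop_step {e : Expr P.V} {c : Com P.V P.K} {s : State P.V} {p : PMF α}
    {Q : α → State P.V → Trace → Prop} (he : e.eval w s.env ≠ 0)
    (h : Runs P w n (.seq c (.loop e c)) s p fun a s t =>
      Q a s ((Trace.tick (1 + e.size)).seq t)) :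
    Runs P w n (.loop e c) s p Q :=
  Sem.shift (Sem.andThen_right h fun a s₁ t₁ h => Sem.done h)
    fun k => by simp only [exec, if_neg he]

theorem Runs.call {x : Fin P.V} {f : Fin P.K} {as : Fin P.V → Expr P.V} {s : State P.V}
    {p : PMF α} {Q : α → State P.V → Trace → Prop}
    (h : Runs P w n (P.body f) ⟨fun i => (as i).eval w s.env, s.mem⟩ p fun a s₁ t₁ =>
      Q a ⟨Function.update s.env x ((P.ret f).eval w s₁.env), s₁.mem⟩
        ((Trace.tick (1 + argsSize as + (P.ret f).size)).seq t₁.inFrame)) :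
    Runs P w n (.call x f as) s p Q :=
  Sem.shift (Sem.andThen_right h fun _ _ _ h => Sem.done h) fun _ => rfl

/-- The semantics runs the second thread on the memory left by the first, so the threads are
analysed one after the other; absence of races becomes an obligation on the two traces. -/
theorem Runs.par {x y : Fin P.V} {f g : Fin P.K} {as bs : Fin P.V → Expr P.V} {s : State P.V}
    {p : PMF α} {q : α → PMF β} {Q : γ → State P.V → Trace → Prop} (F : α → β → γ)
    (h : Runs P w n (P.body f) ⟨fun i => (as i).eval w s.env, s.mem⟩ p fun a s₁ t₁ =>
      Runs P w n (P.body g) ⟨fun i => (bs i).eval w s.env, s₁.mem⟩ (q a) fun b s₂ t₂ =>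
        t₁.NoRace t₂ ∧
        Q (F a b) ⟨Function.update (Function.update s.env x ((P.ret f).eval w s₁.env)) y
            ((P.ret g).eval w s₂.env), s₂.mem⟩
          ((Trace.tick (1 + argsSize as + argsSize bs + (P.ret f).size + (P.ret g).size)).seq
            (t₁.inFrame.par t₂.inFrame))) :
    Runs P w n (.par x f as y g bs) s (p.bind fun a => (q a).map (F a)) Q := by
  refine Sem.shift (Sem.andThen F h fun a s₁ t₁ h₁ => ?_) fun k => rfl
  refine Sem.andThen_right h₁ fun b s₂ t₂ h₂ => ?_
  simp only [if_pos h₂.1]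
  exact Sem.done h₂.2

/-- The uniform distribution on `{0, …, k}`. -/
def unif (k : ℕ) : PMF ℕ := (PMF.uniformOfFintype (Fin (k + 1))).map Fin.val

theorem Runs.rand {x : Fin P.V} {e : Expr P.V} {s : State P.V} (k : ℕ)
    {Q : ℕ → State P.V → Trace → Prop} (he : e.eval w s.env = k + 1)
    (h : ∀ v, v ≤ k → Q v (s.setVar x v) (.tick (1 + e.size))) :
    Runs P w n (.rand x e) s (unif k) Q := by
  refine ⟨(unif k).map fun v => (v, s.setVar x v, .tick (1 + e.size)), ?_, ?_,
    ⟨1, fun K hK => ?_⟩, ?_⟩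
  · rw [PMF.support_map, unif, PMF.support_map]
    exact ((Set.toFinite _).image _).image _
  · rw [PMF.map_comp]; exact PMF.map_id _
  · obtain ⟨K, rfl⟩ : ∃ K', K = K' + 1 := ⟨K - 1, by omega⟩
    rw [PMF.map_comp, unif, PMF.map_comp]
    -- The type `Fin` of the drawn element depends on the value of `e`, so that value is generalized
    -- before it is replaced by `k + 1`.
    have aux : ∀ u, u = k + 1 → (if h : u = 0 then Outcome.fail else
        haveI : NeZero u := ⟨h⟩
        PMF.bind (PMF.uniformOfFintype (Fin u)) fun v =>
          Outcome.done (s.setVar x v) (.tick (1 + e.size))) =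
        (PMF.uniformOfFintype (Fin (k + 1))).map
          (fun v : Fin (k + 1) => some (s.setVar x v.val, Trace.tick (1 + e.size))) := by
      rintro u rfl
      rw [dif_neg (by omega)]
      rfl
    exact aux _ he
  · intro z hz
    rw [PMF.support_map, unif, PMF.support_map] at hz
    obtain ⟨v, ⟨u, -, rfl⟩, rfl⟩ := hz
    exact h _ (by have := u.2; simp only; omega)

end Rules

end ForkJoin

end

noncomputable section

namespace ForkJoin

/-! ### Arithmetic of expressions -/

section Expr

variable {V : ℕ} {w : ℕ} {env : Fin V → ℕ} {a b : Expr V}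

instance : Add (Expr V) := ⟨.bin .add⟩
instance : Sub (Expr V) := ⟨.bin .sub⟩
instance : Mul (Expr V) := ⟨.bin .mul⟩
instance : Div (Expr V) := ⟨.bin .div⟩
instance : Mod (Expr V) := ⟨.bin .mod⟩

/-- Word arithmetic agrees with that of `ℕ` as long as nothing overflows. For subtraction, division
and remainder it suffices that the first operand is a word. -/
theorem Expr.eval_add {x y : ℕ} (ha : a.eval w env = x) (hb : b.eval w env = y)
    (h : x + y < 2 ^ w) : (a + b).eval w env = x + y := by
  subst ha hb; exact Nat.mod_eq_of_lt h

theorem Expr.eval_mul {x y : ℕ} (ha : a.eval w env = x) (hb : b.eval w env = y)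
    (h : x * y < 2 ^ w) : (a * b).eval w env = x * y := by
  subst ha hb; exact Nat.mod_eq_of_lt h

theorem Expr.eval_sub {x y : ℕ} (ha : a.eval w env = x) (hb : b.eval w env = y)
    (h : x < 2 ^ w) : (a - b).eval w env = x - y := by
  subst ha hb; exact Nat.mod_eq_of_lt ((Nat.sub_le _ _).trans_lt h)

theorem Expr.eval_div {x y : ℕ} (ha : a.eval w env = x) (hb : b.eval w env = y)
    (h : x < 2 ^ w) : (a / b).eval w env = x / y := by
  subst ha hb; exact Nat.mod_eq_of_lt ((Nat.div_le_self _ _).trans_lt h)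

theorem Expr.eval_mod {x y : ℕ} (ha : a.eval w env = x) (hb : b.eval w env = y)
    (h : x < 2 ^ w) : (a % b).eval w env = x % y := by
  subst ha hb; exact Nat.mod_eq_of_lt ((Nat.mod_le _ _).trans_lt h)

theorem Expr.eval_lt {x y : ℕ} (ha : a.eval w env = x) (hb : b.eval w env = y) (hw : 0 < w) :
    (Expr.bin .lt a b).eval w env = if x < y then 1 else 0 := by
  subst ha hb
  have : 1 < 2 ^ w := Nat.one_lt_two_pow hw.ne'
  refine Nat.mod_eq_of_lt ?_
  simp only [BinOp.apply]; split_ifs <;> omega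

theorem Expr.eval_eq {x y : ℕ} (ha : a.eval w env = x) (hb : b.eval w env = y) (hw : 0 < w) :
    (Expr.bin .eq a b).eval w env = if x = y then 1 else 0 := by
  subst ha hb
  have : 1 < 2 ^ w := Nat.one_lt_two_pow hw.ne'
  refine Nat.mod_eq_of_lt ?_
  simp only [BinOp.apply]; split_ifs <;> omega

theorem Expr.eval_const {k : ℕ} (h : k < 2 ^ w) : (Expr.const k).eval w env = k :=
  Nat.mod_eq_of_lt h

@[simp] theorem Expr.size_add : (a + b).size = 1 + a.size + b.size := rfl
@[simp] theorem Expr.size_sub : (a - b).size = 1 + a.size + b.size := rfl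
@[simp] theorem Expr.size_div : (a / b).size = 1 + a.size + b.size := rfl

end Expr

/-! ### The program -/

namespace Shuffle

/-- The local variable with number `i`. In the procedure that sweeps over the groups of a block,
these are: `0`, `1` the range of groups, `2` the phase, `3` the input size, `4` the space parameter,
`5` start and `6` length of the block, `7` the length of a group, `8` the current time stamp,
`9` a loop counter, `10` a write position or the result, `11` a code, `12` and `14` the two positions
that it encodes, `13` the end of a loop, `15` a stamp, `16` and `17` slots or array entries. -/
abbrev x (i : Fin 18) : Expr 18 := .var i

/-- Layout of the heap for the space parameter `m`: the cells below `2 * m` are slots, the next `m`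
cells hold the codes of pending items, and the last `m` cells the number of pending items of each
group. The item with positions `i` and `j` has the code `i * n + j`. -/
def drawLoop : Com 18 2 :=
  .loop (.bin .lt (x 9) (x 13)) <|
    .seq (.rand 14 (x 5 + x 9 + .const 1)) <|
    .seq (.store .aux (x 4 + x 4 + x 9) ((x 5 + x 9) * x 3 + x 14)) <|
    .set 9 (x 9 + .const 1)

/-- Draw the targets of a group and list the codes of its items. -/
def drawCom : Com 18 2 :=
  .seq (.set 9 (x 0 * x 7)) <|
  .seq (.set 13 (x 9 + x 7)) <|
  .seq (.ite (.bin .lt (x 6) (x 13)) (.set 13 (x 6)) .skip) <|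
  .seq drawLoop <|
  .seq (.set 10 (x 13 - x 0 * x 7)) <|
  .store .aux (x 4 + x 4 + x 4 + x 0) (x 10)

/-- Load and decode an item. -/
def decodeCom : Com 18 2 :=
  .seq (.load 11 .aux (x 4 + x 4 + x 9)) <|
  .seq (.set 12 (x 11 / x 3)) <|
  .seq (.set 14 (x 11 % x 3)) <|
  .seq (.set 15 (x 8 * (x 3 + .const 1) + (x 3 - x 12))) <|
  .ite (.bin .lt (x 14) (x 5)) (.set 16 (x 4 + x 14 % x 6)) (.set 16 (x 14 - x 5))

/-- The loop bounds for the pending items of a group. -/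
def boundsCom : Com 18 2 :=
  .seq (.set 9 (x 0 * x 7)) <|
  .seq (.load 13 .aux (x 4 + x 4 + x 4 + x 0)) <|
  .seq (.set 13 (x 13 + x 9)) <|
  .set 10 (x 9)

def reserveLoop : Com 18 2 :=
  .loop (.bin .lt (x 9) (x 13)) <|
    .seq decodeCom <|
    .seq (.storeMax .aux (x 12 - x 5) (x 15)) <|
    .seq (.storeMax .aux (x 16) (x 15)) <|
    .set 9 (x 9 + .const 1)

def swapCom : Com 18 2 :=
  .seq (.load 16 .arr (x 12)) <|
  .seq (.load 17 .arr (x 14)) <|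
  .seq (.store .arr (x 12) (x 17)) <|
  .store .arr (x 14) (x 16)

/-- Losers are compacted, in their order, at the front of the list of their group. -/
def keepCom : Com 18 2 :=
  .seq (.store .aux (x 4 + x 4 + x 10) (x 11)) <|
  .set 10 (x 10 + .const 1)

/-- The slot of `j` is read first, because its address sits in the variable `16`, which is then
overwritten with the stamp found in the slot of `i`. The product of the two tests is their
conjunction. -/
def commitBody : Com 18 2 :=
  .seq decodeCom <|
  .seq (.load 17 .aux (x 16)) <|
  .seq (.load 16 .aux (x 12 - x 5)) <|
  .seq (.ite (.bin .eq (x 16) (x 15) * .bin .eq (x 17) (x 15)) swapCom keepCom) <|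
  .set 9 (x 9 + .const 1)

def commitLoop : Com 18 2 := .loop (.bin .lt (x 9) (x 13)) commitBody

/-- Every pending item of the group reserves its two slots. -/
def reserveCom : Com 18 2 := .seq boundsCom (.seq reserveLoop (.set 10 (.const 0)))

/-- The pending items of the group that own both of their slots are executed, the others stay
pending. -/
def commitCom : Com 18 2 :=
  .seq boundsCom <|
  .seq commitLoop <|
  .seq (.set 10 (x 10 - x 0 * x 7)) <|
  .store .aux (x 4 + x 4 + x 4 + x 0) (x 10)

/-- Phase `0` draws, phase `1` reserves, phase `2` commits; the inner test uses `1 - 1 = 0` and `2 -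
1 ≠ 0`. -/
def leafCom : Com 18 2 :=
  .ite (x 2) (.ite (x 2 - .const 1) commitCom reserveCom) drawCom

/-- The arguments of a recursive call for a subrange of groups. -/
def rangeArgs (lo hi : Expr 18) : Fin 18 → Expr 18 :=
  Function.update (Function.update Expr.var 0 lo) 1 hi

/-- Sweep over a range of groups, in parallel. -/
def sweepCom : Com 18 2 :=
  .ite (.bin .lt (x 0 + .const 1) (x 1))
    (.seq (.par 16 0 (rangeArgs (x 0) ((x 0 + x 1) / .const 2))
      17 0 (rangeArgs ((x 0 + x 1) / .const 2) (x 1))) (.set 10 (x 16 + x 17)))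
    leafCom

/-- The arguments of a sweep over all groups. In the main procedure, the variables are: `0` the input
size, `1` the space parameter, `2` the length of a group, `3` a temporary, `4` start and `6` length
of the block, `5` the time stamp, `7` the number of groups, `8` the number of pending items. -/
def sweepArgs (phase : ℕ) : Fin 18 → Expr 18 :=
  ![.const 0, x 7, .const phase, x 0, x 1, x 4, x 6, x 2, x 5, .const 0, .const 0, .const 0,
    .const 0, .const 0, .const 0, .const 0, .const 0, .const 0]

/-- `x 2 :=` one plus the number of binary digits of `n`. -/
def lengthCom : Com 18 2 :=
  .seq (.set 2 (.const 1)) <|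
  .seq (.set 3 (x 0)) <|
  .loop (x 3) (.seq (.set 3 (x 3 / .const 2)) (.set 2 (x 2 + .const 1)))

/-- Reserve and commit until nothing is pending. -/
def settleLoop : Com 18 2 :=
  .loop (x 8) <|
    .seq (.call 9 0 (sweepArgs 1)) <|
    .seq (.call 8 0 (sweepArgs 2)) <|
    .set 5 (x 5 + .const 1)

/-- Start and extent of the next block. -/
def nextBlockCom : Com 18 2 :=
  .seq (.set 6 (x 4)) <|
  .seq (.ite (.bin .lt (x 1) (x 6)) (.set 6 (x 1)) .skip) <|
  .seq (.ite (.bin .lt (x 0 - x 4) (x 6)) (.set 6 (x 0 - x 4)) .skip) <|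
  .set 7 ((x 6 + x 2 - .const 1) / x 2)

/-- A sweep returns the sum of the values of its groups. In the drawing and commit phases this is
the number of pending items, which ends up in the variable `8` and controls `settleLoop`. -/
def blockLoop : Com 18 2 :=
  .loop (.bin .lt (x 4) (x 0)) <|
    .seq nextBlockCom <|
    .seq (.call 8 0 (sweepArgs 0)) <|
    .seq settleLoop <|
    .set 4 (x 4 + x 6)

/-- Step `0` of the shuffle is trivial, so the first block starts at `1`. Time starts at `1` so that
the zero cells of a fresh heap are older than every stamp. -/
def mainCom : Com 18 2 :=
  .seq lengthCom <|
  .seq (.set 4 (.const 1)) <|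
  .seq (.set 5 (.const 1)) blockLoop

/-- Random permutation by a blockwise Knuth shuffle, with deterministic reservations in blocks. -/
abbrev program : Program where
  V := 18
  K := 2
  body := ![sweepCom, mainCom]
  ret := ![x 10, x 10]
  main := 1
  wordFactor := 8
  wordFactor_pos := by norm_num

/-! ### The sweep over a range of groups -/

/-- Values of the parameters of a sweep. -/
structure Params (env : Fin 18 → ℕ) (lo hi ph n m s b L T : ℕ) : Prop where
  h0 : env 0 = lo
  h1 : env 1 = hi
  h2 : env 2 = ph
  h3 : env 3 = n
  h4 : env 4 = m
  h5 : env 5 = s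
  h6 : env 6 = b
  h7 : env 7 = L
  h8 : env 8 = T

theorem Params.congr {env env' : Fin 18 → ℕ} {lo hi ph n m s b L T : ℕ}
    (h : Params env lo hi ph n m s b L T) (he : ∀ r : Fin 18, r.val < 9 → env' r = env r) :
    Params env' lo hi ph n m s b L T := by
  constructor
  · rw [he 0 (by decide), h.h0]
  · rw [he 1 (by decide), h.h1]
  · rw [he 2 (by decide), h.h2]
  · rw [he 3 (by decide), h.h3]
  · rw [he 4 (by decide), h.h4]
  · rw [he 5 (by decide), h.h5]
  · rw [he 6 (by decide), h.h6]
  · rw [he 7 (by decide), h.h7]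
  · rw [he 8 (by decide), h.h8]

/-- Independent draws for consecutive groups. -/
def groupDraws (q : ℕ → PMF (List ℕ)) : ℕ → ℕ → PMF (List ℕ)
  | _, 0 => PMF.pure []
  | lo, k + 1 => (q lo).bind fun xs => (groupDraws q (lo + 1) k).map (xs ++ ·)

theorem groupDraws_add (q : ℕ → PMF (List ℕ)) (lo k l : ℕ) :
    groupDraws q lo (k + l) =
      (groupDraws q lo k).bind fun xs => (groupDraws q (lo + k) l).map (xs ++ ·) := by
  induction k generalizing lo with
  | zero =>
    simp only [groupDraws, zero_add, add_zero, PMF.pure_bind, List.nil_append]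
    exact (PMF.map_id _).symm
  | succ k ih =>
    rw [show k + 1 + l = (k + l) + 1 by ring]
    simp only [groupDraws, ih, PMF.bind_bind]
    congr 1; funext xs
    rw [PMF.map_bind, PMF.bind_map]
    congr 1; funext ys
    simp only [Function.comp_apply, PMF.map_comp]
    rw [show lo + 1 + k = lo + (k + 1) by ring]
    congr 1; funext zs
    simp

/-- Reserving and committing draw nothing; with an empty list per group they are instances of the
random sweep. -/
theorem groupDraws_pure (lo k : ℕ) : groupDraws (fun _ => PMF.pure []) lo k = PMF.pure [] := by
  induction k generalizing lo with
  | zero => rfl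
  | succ k ih => simp [groupDraws, ih, PMF.pure_map]

/-- The bound for a sweep over the groups `lo, …, hi - 1` with a fork tree of depth `d`. -/
def sweepCost (B : ℕ → Cost) (sp : ℕ) (d lo hi : ℕ) : Cost where
  work := ∑ g ∈ Finset.Ico lo hi, ((B g).work + 400)
  span := sp + 200 * (d + 1)
  frames := d
  reads := ⋃ g ∈ Set.Ico lo hi, (B g).reads
  writes := ⋃ g ∈ Set.Ico lo hi, (B g).writes
  maxes := ⋃ g ∈ Set.Ico lo hi, (B g).maxes

/-- Groups on different sides of the split are distinct, so pairwise race freedom of groups lifts to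
the unions over both halves. -/
theorem sweepCost_noRace {B : ℕ → Cost} {sp d lo mid hi : ℕ}
    (h : ∀ g ∈ Set.Ico lo hi, ∀ g' ∈ Set.Ico lo hi, g ≠ g' → (B g).NoRace (B g'))
    (h1 : lo ≤ mid) (_ : mid ≤ hi) :
    (sweepCost B sp d lo mid).NoRace (sweepCost B sp d mid hi) := by
  have h' : ∀ g ∈ Set.Ico lo mid, ∀ g' ∈ Set.Ico mid hi, (B g).NoRace (B g') := by
    intro g hg g' hg'
    simp only [Set.mem_Ico] at hg hg'
    exact h g ⟨hg.1, by omega⟩ g' ⟨by omega, hg'.2⟩ (by omega)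
  simp only [sweepCost, Cost.NoRace, Set.disjoint_union_right, Set.disjoint_iUnion_left,
    Set.disjoint_iUnion_right]
  simp only [Cost.NoRace, Set.disjoint_union_right] at h'
  refine ⟨⟨⟨?_, ?_⟩, ?_⟩, ⟨⟨?_, ?_⟩, ?_⟩, ?_, ?_⟩
  · intro g hg g' hg'; exact (h' g' hg' g hg).1.1.1
  · intro g hg g' hg'; exact (h' g' hg' g hg).1.1.2
  · intro g hg g' hg'; exact (h' g' hg' g hg).1.2
  · intro g hg g' hg'; exact (h' g hg g' hg').2.1.1.1
  · intro g hg g' hg'; exact (h' g hg g' hg').2.1.1.2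
  · intro g hg g' hg'; exact (h' g hg g' hg').2.1.2
  · intro g hg g' hg'; exact (h' g' hg' g hg).2.2.1
  · intro g hg g' hg'; exact (h' g hg g' hg').2.2.2

theorem groupDraws_one (q : ℕ → PMF (List ℕ)) (lo : ℕ) : groupDraws q lo 1 = q lo := by
  simp only [groupDraws, PMF.pure_map, List.append_nil]
  exact PMF.bind_pure _

theorem argsSize_rangeArgs (lo hi : Expr 18) :
    argsSize (rangeArgs lo hi) = lo.size + hi.size + 16 := by
  have h : ∀ i, (rangeArgs lo hi i).size =
      Function.update (Function.update (fun _ : Fin 18 => 1) 0 lo.size) 1 hi.size i := by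
    intro i
    simp only [rangeArgs, Function.update_apply]
    split_ifs <;> rfl
  have h01 : (0 : Fin 18) ∈ (Finset.univ : Finset (Fin 18)) \ {1} := by decide
  rw [argsSize, Finset.sum_congr rfl fun i _ => h i,
    Finset.sum_update_of_mem (Finset.mem_univ _), Finset.sum_update_of_mem h01]
  have : (((Finset.univ : Finset (Fin 18)) \ {1}) \ {0}).card = 16 := by decide
  simp only [Finset.sum_const, this]
  simp
  ring

theorem Params.rangeArgs {w : ℕ} {env : Fin 18 → ℕ} {lo hi ph n m s b L T : ℕ}
    (h : Params env lo hi ph n m s b L T) {a c : Expr 18} {u v : ℕ}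
    (ha : a.eval w env = u) (hc : c.eval w env = v) :
    Params (fun i => (rangeArgs a c i).eval w env) u v ph n m s b L T := by
  constructor <;> simp [Shuffle.rangeArgs, Expr.eval, ha, hc, h.h2, h.h3, h.h4, h.h5, h.h6, h.h7, h.h8]

/-- `J g xs M` describes the memory once the groups before `g` have been processed with the draws
`xs`. As threads are evaluated from left to right, this invariant passes through the fork tree as
through a loop. Each group brings 400 units of work beyond its own bound, and every subtree leaves
200 of them unspent: of the 400 left by two subtrees, 200 pay for the fork that joins them and 200
are handed upwards. -/
theorem sweep_runs {w N n m s b L T ph lo₀ hi₀ sp : ℕ} {J : ℕ → List ℕ → (Loc → ℕ) → Prop}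
    {q : ℕ → PMF (List ℕ)} {B : ℕ → Cost} {val : ℕ → ℕ}
    (hw : 2 * hi₀ + 2 < 2 ^ w) (hval : ∑ g ∈ Finset.Ico lo₀ hi₀, val g < 2 ^ w)
    (hrace : ∀ g ∈ Set.Ico lo₀ hi₀, ∀ g' ∈ Set.Ico lo₀ hi₀, g ≠ g' → (B g).NoRace (B g'))
    (hspan : ∀ g ∈ Set.Ico lo₀ hi₀, (B g).span ≤ sp)
    (hframes : ∀ g ∈ Set.Ico lo₀ hi₀, (B g).frames = 0)
    (hleaf : ∀ g ∈ Set.Ico lo₀ hi₀, ∀ xs env M, Params env g (g + 1) ph n m s b L T → J g xs M →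
      Runs program w N leafCom ⟨env, M⟩ (q g) fun ys st t =>
        J (g + 1) (xs ++ ys) st.mem ∧ t.Le (B g) ∧ st.env 10 = val g) :
    ∀ d lo hi xs env M, lo₀ ≤ lo → lo < hi → hi ≤ hi₀ → hi - lo ≤ 2 ^ d →
      Params env lo hi ph n m s b L T → J lo xs M →
      Runs program w N sweepCom ⟨env, M⟩ (groupDraws q lo (hi - lo)) fun ys st t =>
        J hi (xs ++ ys) st.mem ∧ t.Le (sweepCost B sp d lo hi) ∧
        t.work + 200 ≤ (sweepCost B sp d lo hi).work ∧
        st.env 10 = ∑ g ∈ Finset.Ico lo hi, val g := by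
  have hw0 : 0 < w := by
    rcases Nat.eq_zero_or_pos w with rfl | h
    · simp at hw
    · exact h
  have leaf : ∀ d lo hi xs env M, lo₀ ≤ lo → lo < hi → hi ≤ hi₀ → ¬ lo + 1 < hi →
      Params env lo hi ph n m s b L T → J lo xs M →
      Runs program w N sweepCom ⟨env, M⟩ (groupDraws q lo (hi - lo)) fun ys st t =>
        J hi (xs ++ ys) st.mem ∧ t.Le (sweepCost B sp d lo hi) ∧
        t.work + 200 ≤ (sweepCost B sp d lo hi).work ∧
        st.env 10 = ∑ g ∈ Finset.Ico lo hi, val g := by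
    intro d lo hi xs env M h0 hlt hhi hsplit hp hJ
    have hc : (Expr.bin .lt (x 0 + .const 1) (x 1)).eval w env = if lo + 1 < hi then 1 else 0 :=
      Expr.eval_lt (Expr.eval_add hp.h0 (Expr.eval_const (by omega)) (by omega)) hp.h1 hw0
    rw [if_neg hsplit] at hc
    obtain rfl : hi = lo + 1 := by omega
    refine Runs.ite (fun h => absurd hc h) (fun _ => ?_)
    rw [show lo + 1 - lo = 1 by omega, groupDraws_one]
    have hmem : lo ∈ Set.Ico lo₀ hi₀ := ⟨h0, by omega⟩
    refine (hleaf lo hmem xs env M hp hJ).mono ?_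
    intro ys st t _ ⟨hJ', ht, hv⟩
    have h1 := ht.work
    have h2 := ht.span
    have h3 := ht.frames
    have h4 := hspan lo hmem
    have h5 := hframes lo hmem
    have hI : Set.Ico lo (lo + 1) = {lo} := by ext; simp; omega
    refine ⟨hJ', ⟨?_, ?_, ?_, ?_, ?_, ?_⟩, ?_, ?_⟩
    · simp [Trace.seq, Trace.tick, Expr.size, sweepCost]; omega
    · simp [Trace.seq, Trace.tick, Expr.size, sweepCost]; omega
    · simp [Trace.seq, Trace.tick, sweepCost]; omega
    · simpa [Trace.seq, Trace.tick, sweepCost, hI] using ht.reads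
    · simpa [Trace.seq, Trace.tick, sweepCost, hI] using ht.writes
    · simpa [Trace.seq, Trace.tick, sweepCost, hI] using ht.maxes
    · simp [Trace.seq, Trace.tick, Expr.size, sweepCost]; omega
    · simpa using hv
  intro d
  induction d with
  | zero =>
    intro lo hi xs env M h0 hlt hhi hd hp hJ
    exact leaf 0 lo hi xs env M h0 hlt hhi (by rw [pow_zero] at hd; omega) hp hJ
  | succ d ih =>
    intro lo hi xs env M h0 hlt hhi hd hp hJ
    have hc : (Expr.bin .lt (x 0 + .const 1) (x 1)).eval w env = if lo + 1 < hi then 1 else 0 :=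
      Expr.eval_lt (Expr.eval_add hp.h0 (Expr.eval_const (by omega)) (by omega)) hp.h1 hw0
    by_cases hsplit : lo + 1 < hi
    · rw [if_pos hsplit] at hc
      have hlo : (x 0).eval w env = lo := hp.h0
      have hhi' : (x 1).eval w env = hi := hp.h1
      have hmid : ((x 0 + x 1) / .const 2).eval w env = (lo + hi) / 2 :=
        Expr.eval_div (Expr.eval_add hlo hhi' (by omega)) (Expr.eval_const (by omega)) (by omega)
      set mid := (lo + hi) / 2 with hm
      have hlm : lo < mid := by omega
      have hmh : mid < hi := by omega
      have hsum : ∑ g ∈ Finset.Ico lo hi, val g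
          = ∑ g ∈ Finset.Ico lo mid, val g + ∑ g ∈ Finset.Ico mid hi, val g :=
        (Finset.sum_Ico_consecutive _ hlm.le hmh.le).symm
      have hsumle : ∑ g ∈ Finset.Ico lo hi, val g < 2 ^ w := by
        refine lt_of_le_of_lt (Finset.sum_le_sum_of_subset ?_) hval
        exact Finset.Ico_subset_Ico h0 hhi
      refine Runs.ite (fun _ => ?_) (fun h => by simp [hc] at h)
      have hdr : groupDraws q lo (hi - lo) = (groupDraws q lo (mid - lo)).bind fun xs =>
          (groupDraws q mid (hi - mid)).map (xs ++ ·) := by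
        have := groupDraws_add q lo (mid - lo) (hi - mid)
        rwa [show mid - lo + (hi - mid) = hi - lo by omega, show lo + (mid - lo) = mid by omega]
          at this
      rw [hdr]
      rw [pow_succ] at hd
      refine Runs.seq_right (Runs.par _ ?_)
      refine (ih lo mid xs _ M h0 hlm (by omega) (by omega) (hp.rangeArgs hlo hmid) hJ).mono ?_
      intro ys s₁ t₁ _ ⟨hJ₁, ht₁, hwk₁, hv₁⟩
      refine (ih mid hi (xs ++ ys) _ s₁.mem (by omega) hmh hhi (by omega) (hp.rangeArgs hmid hhi')
        hJ₁).mono ?_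
      intro zs s₂ t₂ _ ⟨hJ₂, ht₂, hwk₂, hv₂⟩
      refine ⟨ht₁.noRace ht₂ (sweepCost_noRace (fun g hg g' hg' => hrace g ?_ g' ?_) hlm.le hmh.le), ?_⟩
      · exact ⟨h0.trans hg.1, hg.2.trans_le hhi⟩
      · exact ⟨h0.trans hg'.1, hg'.2.trans_le hhi⟩
      refine Det.set (∑ g ∈ Finset.Ico lo hi, val g) ?_ ?_
      · rw [hsum]
        refine Expr.eval_add ?_ ?_ (by omega)
        · simp [Expr.eval, hv₁]
        · simp [Expr.eval, hv₂]
      · have hwsum : (sweepCost B sp (d + 1) lo hi).work =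
            (sweepCost B sp d lo mid).work + (sweepCost B sp d mid hi).work :=
          (Finset.sum_Ico_consecutive _ hlm.le hmh.le).symm
        have hun : Set.Ico lo hi = Set.Ico lo mid ∪ Set.Ico mid hi :=
          (Set.Ico_union_Ico_eq_Ico hlm.le hmh.le).symm
        have hs₁ := ht₁.span
        have hs₂ := ht₂.span
        have hf₁ := ht₁.frames
        have hf₂ := ht₂.frames
        have hw₁ := ht₁.work
        have hw₂ := ht₂.work
        simp only [sweepCost] at hs₁ hs₂ hf₁ hf₂
        refine ⟨by simpa [State.setVar] using hJ₂, ⟨?_, ?_, ?_, ?_, ?_, ?_⟩, ?_, ?_⟩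
        · rw [hwsum]
          simp [Trace.seq, Trace.tick, Trace.par, Trace.inFrame, Expr.size, argsSize_rangeArgs]
          omega
        · simp [Trace.seq, Trace.tick, Trace.par, Trace.inFrame, Expr.size, argsSize_rangeArgs,
            sweepCost]
          omega
        · simp [Trace.seq, Trace.tick, Trace.par, Trace.inFrame, sweepCost]
          omega
        · have h1 := ht₁.reads
          have h2 := ht₂.reads
          simp only [sweepCost] at h1 h2
          simp only [Trace.seq, Trace.tick, Trace.par, Trace.inFrame, sweepCost, hun,
            Set.biUnion_union, Finset.coe_union, Finset.coe_empty, Set.empty_union, Set.union_empty]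
          exact Set.union_subset_union h1 h2
        · have h1 := ht₁.writes
          have h2 := ht₂.writes
          simp only [sweepCost] at h1 h2
          simp only [Trace.seq, Trace.tick, Trace.par, Trace.inFrame, sweepCost, hun,
            Set.biUnion_union, Finset.coe_union, Finset.coe_empty, Set.empty_union, Set.union_empty]
          exact Set.union_subset_union h1 h2
        · have h1 := ht₁.maxes
          have h2 := ht₂.maxes
          simp only [sweepCost] at h1 h2
          simp only [Trace.seq, Trace.tick, Trace.par, Trace.inFrame, sweepCost, hun,
            Set.biUnion_union, Finset.coe_union, Finset.coe_empty, Set.empty_union, Set.union_empty]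
          exact Set.union_subset_union h1 h2
        · rw [hwsum]
          simp [Trace.seq, Trace.tick, Trace.par, Trace.inFrame, Expr.size, argsSize_rangeArgs]
          omega
        · simp [State.setVar]
    · exact leaf (d + 1) lo hi xs env M h0 hlt hhi hsplit hp hJ

/-! ### Items, slots and stamps -/

/-- A step `i` of the Knuth shuffle, which exchanges the entries `i` and `j`, with a weight `z` that
is used in the analysis only. -/
structure Item where
  i : ℕ
  j : ℕ
  z : ℕ

/-- The heap cell at which the position `x` of the array is reserved. -/
def slot (m s b x : ℕ) : ℕ := if x < s then m + x % b else x - s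

/-- The priority of step `i` at time `T`. -/
def stamp (n T i : ℕ) : ℕ := T * (n + 1) + (n - i)

/-- The item is a step of the current block. -/
structure Item.Ok (c : Item) (s b : ℕ) : Prop where
  le : s ≤ c.i
  lt : c.i < s + b
  j_le : c.j ≤ c.i

/-- The parameters of a block. -/
structure Geom (w n m s b L T : ℕ) : Prop where
  s_pos : 1 ≤ s
  b_pos : 1 ≤ b
  b_le_s : b ≤ s
  b_le_m : b ≤ m
  sb_le : s + b ≤ n
  m_le : m ≤ n
  L_pos : 1 ≤ L
  L_le : L ≤ n + 2
  T_le : T ≤ 4 * n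
  word : 16 * ((n + 1) * (n + 1)) < 2 ^ w

section

variable {w N n m s b L T lo hi ph : ℕ}

namespace Geom

theorem w_pos (h : Geom w n m s b L T) : 0 < w := by
  rcases Nat.eq_zero_or_pos w with rfl | hw
  · have := h.word; simp at this
  · exact hw

theorem lin (h : Geom w n m s b L T) : 16 * (n + 1) < 2 ^ w := by
  have := h.word
  nlinarith

theorem stamp_lt (h : Geom w n m s b L T) (i : ℕ) : stamp n T i < 2 ^ w := by
  have h1 := h.word
  have h2 : T * (n + 1) ≤ 4 * n * (n + 1) := Nat.mul_le_mul_right _ h.T_le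
  have h3 : n - i ≤ n := Nat.sub_le _ _
  unfold stamp
  nlinarith

theorem code_lt (h : Geom w n m s b L T) {i j : ℕ} (hi : i < n) (hj : j < n) :
    i * n + j < 2 ^ w := by
  have h1 := h.word
  nlinarith

theorem group_le (h : Geom w n m s b L T) {g : ℕ} (hg : g ≤ n) : g * L + L < 2 ^ w := by
  have h1 := h.word
  have h2 : (g + 1) * L ≤ (n + 1) * (n + 2) := Nat.mul_le_mul (by omega) h.L_le
  nlinarith

/-- Positions of the block go to cells below `b`, earlier ones to cells from `m` to `m + b - 1`, and
`b ≤ m`. -/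
theorem slot_lt (h : Geom w n m s b L T) {y : ℕ} (hy : y < s + b) : slot m s b y < 2 * m := by
  have h1 := h.b_le_m
  have h2 := Nat.mod_lt y h.b_pos
  unfold slot
  split_ifs <;> omega

end Geom

theorem Params.update {env : Fin 18 → ℕ} (h : Params env lo hi ph n m s b L T) (r : Fin 18) (v : ℕ)
    (hr : 9 ≤ r.val) : Params (Function.update env r v) lo hi ph n m s b L T :=
  h.congr fun r' hr' => Function.update_of_ne (by rintro rfl; omega) _ _

theorem code_div {i j n : ℕ} (hj : j < n) : (i * n + j) / n = i := by
  rw [mul_comm, Nat.mul_add_div (by omega), Nat.div_eq_of_lt hj, add_zero]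

theorem code_mod {i j n : ℕ} (hj : j < n) : (i * n + j) % n = j := by
  rw [mul_comm, Nat.mul_add_mod, Nat.mod_eq_of_lt hj]

theorem decode_det {env : Fin 18 → ℕ} {M : Loc → ℕ} {k : ℕ} {c : Item}
    (hG : Geom w n m s b L T) (hp : Params env lo hi ph n m s b L T) (h9 : env 9 = k) (hk : k < b)
    (hc : c.Ok s b) (hM : M (.aux (2 * m + k)) = c.i * n + c.j) :
    Det program w N decodeCom ⟨env, M⟩ fun st t =>
      st.mem = M ∧ (∀ r : Fin 18, r.val ≤ 10 ∨ r = 13 → st.env r = env r) ∧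
      st.env 11 = c.i * n + c.j ∧ st.env 12 = c.i ∧ st.env 14 = c.j ∧
      st.env 15 = stamp n T c.i ∧ st.env 16 = slot m s b c.j ∧
      t.Le ⟨60, 60, 0, {.aux (2 * m + k)}, ∅, ∅⟩ := by
  have hlin := hG.lin
  have hb := hG.b_le_m
  have hm := hG.m_le
  have hsb := hG.sb_le
  have hin : c.i < n := by have := hc.lt; omega
  have hjn : c.j < n := by have := hc.j_le; omega
  have hcode := hG.code_lt hin hjn
  have hst := hG.stamp_lt c.i
  refine Det.seq (Det.load (2 * m + k) ?_ trivial ?_)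
  · rw [two_mul]
    exact Expr.eval_add (Expr.eval_add hp.h4 hp.h4 (by omega)) h9 (by omega)
  simp only [State.setVar, Region.loc, hM]
  have hp := hp.update 11 (c.i * n + c.j) (by decide)
  refine Det.seq (Det.set c.i ?_ ?_)
  · rw [← code_div (i := c.i) hjn]
    refine Expr.eval_div (by simp [Expr.eval, code_div hjn]) hp.h3 hcode
  simp only [State.setVar]
  have hp := hp.update 12 c.i (by decide)
  refine Det.seq (Det.set c.j ?_ ?_)
  · rw [← code_mod (i := c.i) hjn]
    refine Expr.eval_mod (by simp [Expr.eval, code_mod hjn]) hp.h3 hcode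
  simp only [State.setVar]
  have hp := hp.update 14 c.j (by decide)
  refine Det.seq (Det.set (stamp n T c.i) ?_ ?_)
  · unfold stamp at hst ⊢
    refine Expr.eval_add (Expr.eval_mul hp.h8 (Expr.eval_add hp.h3 (Expr.eval_const (by omega))
      (by omega)) (by omega)) (Expr.eval_sub hp.h3 ?_ (by omega)) hst
    simp [Expr.eval]
  simp only [State.setVar]
  have hp := hp.update 15 (stamp n T c.i) (by decide)
  have h14 : ∀ v, (x 14).eval w (Function.update (Function.update (Function.update
      (Function.update env 11 (c.i * n + c.j)) 12 c.i) 14 c.j) 15 v) = c.j := by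
    intro v; simp [Expr.eval]
  have hcond := Expr.eval_lt (w := w) (b := x 5) (h14 (stamp n T c.i)) hp.h5 hG.w_pos
  have hmod := Nat.mod_lt c.j hG.b_pos
  refine Runs.ite (fun h => ?_) (fun h => ?_)
  · have hlt : c.j < s := by
      by_contra hge
      rw [if_neg hge] at hcond
      exact h hcond
    have hsl : slot m s b c.j = m + c.j % b := if_pos hlt
    refine Det.set (m + c.j % b) ?_ ?_
    · exact Expr.eval_add hp.h4 (Expr.eval_mod (h14 _) hp.h6 (by omega)) (by omega)
    · refine ⟨rfl, ?_, ?_, ?_, ?_, ?_, ?_, ⟨?_, ?_, ?_, ?_, ?_, ?_⟩⟩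
      · intro r hr
        simp only [State.setVar, Function.update_apply]
        rcases hr with hr | rfl
        · repeat rw [if_neg (by rintro rfl; simp at hr)]
        · rfl
      all_goals simp [State.setVar, Trace.seq, Trace.tick, Expr.size, hsl]
  · have hge : ¬ c.j < s := by
      intro hlt
      rw [if_pos hlt] at hcond
      rw [hcond] at h; simp at h
    have hsl : slot m s b c.j = c.j - s := if_neg hge
    refine Det.set (c.j - s) ?_ ?_
    · exact Expr.eval_sub (h14 _) hp.h5 (by omega)
    · refine ⟨rfl, ?_, ?_, ?_, ?_, ?_, ?_, ⟨?_, ?_, ?_, ?_, ?_, ?_⟩⟩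
      · intro r hr
        simp only [State.setVar, Function.update_apply]
        rcases hr with hr | rfl
        · repeat rw [if_neg (by rintro rfl; simp at hr)]
        · rfl
      all_goals simp [State.setVar, Trace.seq, Trace.tick, Expr.size, hsl]

/-- The bounds of the loop over a pending list. -/
theorem bounds_det {env : Fin 18 → ℕ} {M : Loc → ℕ} {g len : ℕ}
    (hG : Geom w n m s b L T) (hp : Params env g hi ph n m s b L T) (hg : g < n)
    (hlen : len ≤ n) (hM : M (.aux (3 * m + g)) = len) :
    Det program w N boundsCom ⟨env, M⟩ fun st t =>
      st.mem = M ∧ Params st.env g hi ph n m s b L T ∧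
      st.env 9 = g * L ∧ st.env 10 = g * L ∧ st.env 13 = g * L + len ∧
      t.Le ⟨60, 60, 0, {.aux (3 * m + g)}, ∅, ∅⟩ := by
  have hlin := hG.lin
  have hm := hG.m_le
  have hgr : g * L + n < 2 ^ w := by
    have h1 := hG.word
    have h2 : g * L ≤ n * (n + 2) := Nat.mul_le_mul hg.le hG.L_le
    nlinarith
  refine Det.seq (Det.set (g * L) (Expr.eval_mul hp.h0 hp.h7 (by omega)) ?_)
  simp only [State.setVar]
  have hp := hp.update 9 (g * L) (by decide)
  refine Det.seq (Det.load (3 * m + g) ?_ trivial ?_)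
  · rw [show 3 * m + g = m + m + m + g by ring]
    exact Expr.eval_add (Expr.eval_add (Expr.eval_add hp.h4 hp.h4 (by omega)) hp.h4 (by omega))
      hp.h0 (by omega)
  simp only [State.setVar, Region.loc, hM]
  have hp := hp.update 13 len (by decide)
  refine Det.seq (Det.set (g * L + len) ?_ ?_)
  · rw [add_comm]
    exact Expr.eval_add (by simp [Expr.eval]) (by simp [Expr.eval]) (by omega)
  simp only [State.setVar]
  have hp := hp.update 13 (g * L + len) (by decide)
  refine Det.set (g * L) (by simp [Expr.eval]) ?_
  have hp := hp.update 10 (g * L) (by decide)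
  refine ⟨rfl, hp, ?_, ?_, ?_, ⟨?_, ?_, ?_, ?_, ?_, ?_⟩⟩
  all_goals simp [State.setVar, Trace.seq, Trace.tick, Expr.size]

end

/-! ### The reservation phase of a group -/

/-- The cells `a, …, e - 1` of the heap. -/
def cells (a e : ℕ) : Set Loc := {l | ∃ y, a ≤ y ∧ y < e ∧ l = .aux y}

theorem cells_mono {a e a' e' : ℕ} (h : a' ≤ a) (h' : e ≤ e') : cells a e ⊆ cells a' e' := by
  rintro l ⟨y, h1, h2, rfl⟩
  exact ⟨y, by omega, by omega, rfl⟩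

theorem aux_mem_cells {y a e : ℕ} : Loc.aux y ∈ cells a e ↔ a ≤ y ∧ y < e := by
  constructor
  · rintro ⟨y', h1, h2, h⟩
    cases h; exact ⟨h1, h2⟩
  · rintro ⟨h1, h2⟩
    exact ⟨y, h1, h2, rfl⟩

theorem singleton_subset_cells {y a e : ℕ} (h1 : a ≤ y) (h2 : y < e) :
    {Loc.aux y} ⊆ cells a e := by
  rw [Set.singleton_subset_iff, aux_mem_cells]; exact ⟨h1, h2⟩

/-- The effect of `storeMax`. -/
def raise (M : Loc → ℕ) (l : Loc) (v : ℕ) : Loc → ℕ := Function.update M l (max (M l) v)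

/-- The memory after the reservations of an item. -/
def resMem (n m s b T : ℕ) (M : Loc → ℕ) (c : Item) : Loc → ℕ :=
  raise (raise M (.aux (slot m s b c.i)) (stamp n T c.i)) (.aux (slot m s b c.j)) (stamp n T c.i)

section

variable {w N n m s b L T lo hi ph : ℕ}

theorem resMem_of_ne {M : Loc → ℕ} {c : Item} {l : Loc} (h1 : l ≠ .aux (slot m s b c.i))
    (h2 : l ≠ .aux (slot m s b c.j)) : resMem n m s b T M c l = M l := by
  unfold resMem raise
  rw [Function.update_of_ne h2, Function.update_of_ne h1]

theorem resMem_of_notMem (hG : Geom w n m s b L T) {M : Loc → ℕ} {c : Item} (hc : c.Ok s b)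
    {l : Loc} (hl : l ∉ cells 0 (2 * m)) : resMem n m s b T M c l = M l := by
  have h1 : c.j < s + b := hc.j_le.trans_lt hc.lt
  refine resMem_of_ne ?_ ?_ <;> rintro rfl <;> refine hl ?_ <;> rw [aux_mem_cells]
  · exact ⟨Nat.zero_le _, hG.slot_lt hc.lt⟩
  · exact ⟨Nat.zero_le _, hG.slot_lt h1⟩

theorem foldl_resMem_of_notMem (hG : Geom w n m s b L T) (l : List Item) (M : Loc → ℕ)
    (hl : ∀ c ∈ l, c.Ok s b) {r : Loc} (hr : r ∉ cells 0 (2 * m)) :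
    l.foldl (resMem n m s b T) M r = M r := by
  induction l generalizing M with
  | nil => rfl
  | cons c l ih =>
    rw [List.foldl_cons, ih _ fun c hc => hl c (List.mem_cons_of_mem _ hc),
      resMem_of_notMem hG (hl c List.mem_cons_self) hr]

/-- The cells from `a` on hold the codes of the items in the list. -/
def Codes (n : ℕ) (M : Loc → ℕ) (a : ℕ) (l : List Item) : Prop :=
  ∀ t (h : t < l.length), M (.aux (a + t)) = l[t].i * n + l[t].j

theorem Codes.head {M : Loc → ℕ} {a : ℕ} {c : Item} {l : List Item} (h : Codes n M a (c :: l)) :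
    M (.aux a) = c.i * n + c.j := by
  have := h 0 (by simp)
  rwa [add_zero] at this

theorem Codes.tail {M : Loc → ℕ} {a : ℕ} {c : Item} {l : List Item} (h : Codes n M a (c :: l)) :
    Codes n M (a + 1) l := by
  intro t ht
  have := h (t + 1) (by simpa using ht)
  rw [show a + 1 + t = a + (t + 1) by ring]
  simpa using this

theorem Codes.cons {M : Loc → ℕ} {a : ℕ} {c : Item} {l : List Item}
    (h : M (.aux a) = c.i * n + c.j) (h' : Codes n M (a + 1) l) : Codes n M a (c :: l) := by
  intro t ht
  rcases t with _ | t
  · simpa using h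
  · have := h' t (by simpa using ht)
    rw [show a + (t + 1) = a + 1 + t by ring]
    simpa using this

theorem Codes.congr {M M' : Loc → ℕ} {a : ℕ} {l : List Item} (h : Codes n M a l)
    (hM : ∀ y, a ≤ y → y < a + l.length → M' (.aux y) = M (.aux y)) : Codes n M' a l := by
  intro t ht
  rw [hM _ (by omega) (by omega)]
  exact h t ht

theorem lt_cond {env : Fin 18 → ℕ} {u v : ℕ} (hw : 0 < w) (h9 : env 9 = u) (h13 : env 13 = v) :
    (Expr.bin .lt (x 9) (x 13)).eval w env = if u < v then 1 else 0 :=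
  Expr.eval_lt h9 h13 hw

/-- The codes lie above the slots, so the updates of the slots leave the codes still to be read
intact. -/
theorem reserveLoop_det (hG : Geom w n m s b L T) (l : List Item) :
    ∀ (env : Fin 18 → ℕ) (M : Loc → ℕ) (k : ℕ), Params env lo hi ph n m s b L T →
      env 9 = k → env 13 = k + l.length → k + l.length ≤ b → (∀ c ∈ l, c.Ok s b) →
      Codes n M (2 * m + k) l →
      Det program w N reserveLoop ⟨env, M⟩ fun st t =>
        st.mem = l.foldl (resMem n m s b T) M ∧
        t.Le ⟨100 * l.length + 10, 100 * l.length + 10, 0,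
          cells (2 * m + k) (2 * m + k + l.length), ∅, cells 0 (2 * m)⟩ := by
  induction l with
  | nil =>
    intro env M k hp h9 h13 hk hok hcodes
    have hc := lt_cond hG.w_pos h9 h13
    simp only [List.length_nil, add_zero, lt_self_iff_false, if_false] at hc
    refine Det.loop_exit hc ⟨rfl, ?_, ?_, ?_, ?_, ?_, ?_⟩ <;> simp [Trace.tick, Expr.size]
  | cons c l ih =>
    intro env M k hp h9 h13 hk hok hcodes
    rw [List.length_cons] at h13 hk
    have hb := hG.b_le_m
    have hm := hG.m_le
    have hlin := hG.lin
    have hcok := hok c List.mem_cons_self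
    have hc := lt_cond hG.w_pos h9 h13
    rw [if_pos (by omega)] at hc
    refine Runs.loop_step (by rw [hc]; exact one_ne_zero) (Det.seq (Det.seq ?_))
    refine (decode_det hG hp h9 (by omega) hcok hcodes.head).mono ?_
    rintro ⟨env₁, M₁⟩ t₁ ⟨hM₁, hfr, h11, h12, h14, h15, h16, ht₁⟩
    simp only at hM₁ hfr h11 h12 h14 h15 h16
    subst hM₁
    have hp₁ := hp.congr (env' := env₁) fun r hr => hfr r (Or.inl (by omega))
    have hin : c.i < n := by have := hcok.lt; have := hG.sb_le; omega
    have hsi : slot m s b c.i = c.i - s := if_neg (by have := hcok.le; omega)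
    refine Det.seq (Det.storeMax (slot m s b c.i) (stamp n T c.i) ?_ h15 trivial ?_)
    · rw [hsi]; exact Expr.eval_sub h12 hp₁.h5 (by omega)
    refine Det.seq (Det.storeMax (slot m s b c.j) (stamp n T c.i) h16 h15 trivial ?_)
    refine Det.set (k + 1) ?_ ?_
    · refine Expr.eval_add ?_ (Expr.eval_const (by omega)) (by omega)
      exact (hfr 9 (by decide)).trans h9
    have hmem : (((State.mk env₁ M₁).setMem (Region.aux.loc (slot m s b c.i))
        (max (M₁ (Region.aux.loc (slot m s b c.i))) (stamp n T c.i))).setMem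
        (Region.aux.loc (slot m s b c.j))
        (max (((State.mk env₁ M₁).setMem (Region.aux.loc (slot m s b c.i))
        (max (M₁ (Region.aux.loc (slot m s b c.i))) (stamp n T c.i))).mem
        (Region.aux.loc (slot m s b c.j))) (stamp n T c.i))).setVar (9 : Fin 18) (k + 1) =
        State.mk (Function.update env₁ 9 (k + 1)) (resMem n m s b T M₁ c) := rfl
    rw [hmem]
    refine (ih _ _ (k + 1) (hp₁.update 9 (k + 1) (by decide)) (by simp) ?_ (by omega)
      (fun c hc => hok c (List.mem_cons_of_mem _ hc)) ?_).mono ?_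
    · rw [Function.update_of_ne (by decide), hfr 13 (by decide), h13]; ring
    · refine hcodes.tail.congr fun y hy _ => resMem_of_notMem hG hcok ?_
      rw [aux_mem_cells]; omega
    · rintro st t ⟨hst, ht⟩
      refine ⟨hst, ?_⟩
      have hw₁ := ht₁.work
      have hs₁ := ht₁.span
      have hf₁ := ht₁.frames
      have hw₂ := ht.work
      have hs₂ := ht.span
      have hf₂ := ht.frames
      have hr₂ := ht.reads
      simp only at hw₁ hs₁ hf₁ hw₂ hs₂ hf₂ hr₂
      have hsl₁ : Loc.aux (slot m s b c.i) ∈ cells 0 (2 * m) :=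
        aux_mem_cells.2 ⟨Nat.zero_le _, hG.slot_lt hcok.lt⟩
      have hsl₂ : Loc.aux (slot m s b c.j) ∈ cells 0 (2 * m) :=
        aux_mem_cells.2 ⟨Nat.zero_le _, hG.slot_lt (hcok.j_le.trans_lt hcok.lt)⟩
      refine ⟨?_, ?_, ?_, ?_, ?_, ?_⟩
      · simp [Trace.seq, Trace.tick, Expr.size]; omega
      · simp [Trace.seq, Trace.tick, Expr.size]; omega
      · simp [Trace.seq, Trace.tick]; omega
      · simp only [Trace.seq, Trace.tick, Finset.coe_union, Finset.coe_empty, Set.empty_union,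
          Set.union_empty, List.length_cons]
        refine Set.union_subset (ht₁.reads.trans ?_) (hr₂.trans (cells_mono (by omega) (by omega)))
        exact singleton_subset_cells (by omega) (by omega)
      · have h1 := ht₁.writes
        have h2 := ht.writes
        simp only [Set.subset_empty_iff, Finset.coe_eq_empty] at h1 h2
        simp [Trace.seq, Trace.tick, h1, h2]
      · have h1 := ht₁.maxes
        have h2 := ht.maxes
        simp only [Set.subset_empty_iff, Finset.coe_eq_empty] at h1
        simp [Trace.seq, Trace.tick, h1, Region.loc, Set.insert_subset_iff, hsl₁, hsl₂]
        exact h2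

/-- The reservation phase of a group. -/
theorem reserve_det (hG : Geom w n m s b L T) {env : Fin 18 → ℕ} {M : Loc → ℕ} {g : ℕ}
    {l : List Item} (hp : Params env g hi 1 n m s b L T) (hgm : g < m)
    (hlen : g * L + l.length ≤ b) (hok : ∀ c ∈ l, c.Ok s b)
    (hcnt : M (.aux (3 * m + g)) = l.length) (hcodes : Codes n M (2 * m + g * L) l) :
    Det program w N leafCom ⟨env, M⟩ fun st t =>
      st.env 10 = 0 ∧ st.mem = l.foldl (resMem n m s b T) M ∧
      t.Le ⟨100 * l.length + 100, 100 * l.length + 100, 0,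
          cells (2 * m) (4 * m), ∅, cells 0 (2 * m)⟩ := by
  have hlin := hG.lin
  have hb := hG.b_le_m
  have hm := hG.m_le
  have hg : g < n := by omega
  have h2 : (x 2).eval w env = 1 := hp.h2
  have h2' : (x 2 - .const 1).eval w env = 1 - 1 :=
    Expr.eval_sub h2 (Expr.eval_const (by omega)) (by omega)
  refine Runs.ite (fun _ => ?_) (fun h => by simp [h2] at h)
  refine Runs.ite (fun h => absurd h2' h) (fun _ => ?_)
  refine Det.seq ((bounds_det hG hp hg (by omega) hcnt).mono ?_)
  rintro ⟨env₁, M₁⟩ t₁ ⟨hM₁, hp₁, h9, h10, h13, ht₁⟩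
  simp only at hM₁ hp₁ h9 h10 h13
  subst hM₁
  refine Det.seq ((reserveLoop_det hG l env₁ M₁ (g * L) hp₁ h9 h13 hlen hok hcodes).mono ?_)
  rintro st t ⟨hst, ht⟩
  refine Det.set 0 (Expr.eval_const (by omega)) ⟨by simp [State.setVar], hst, ?_⟩
  have hw₁ := ht₁.work
  have hs₁ := ht₁.span
  have hf₁ := ht₁.frames
  have hw₂ := ht.work
  have hs₂ := ht.span
  have hf₂ := ht.frames
  simp only at hw₁ hs₁ hf₁ hw₂ hs₂ hf₂
  refine ⟨?_, ?_, ?_, ?_, ?_, ?_⟩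
  · simp [Trace.seq, Trace.tick, Expr.size]; omega
  · simp [Trace.seq, Trace.tick, Expr.size]; omega
  · simp [Trace.seq, Trace.tick]; omega
  · simp only [Trace.seq, Trace.tick, Finset.coe_union, Finset.coe_empty, Set.empty_union,
      Set.union_empty]
    refine Set.union_subset (ht₁.reads.trans (singleton_subset_cells (by omega) (by omega)))
      (ht.reads.trans (cells_mono (by omega) (by omega)))
  · have h1 := ht₁.writes
    have h2 := ht.writes
    simp only [Set.subset_empty_iff, Finset.coe_eq_empty] at h1 h2
    simp [Trace.seq, Trace.tick, h1, h2]
  · have h1 := ht₁.maxes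
    have h2 := ht.maxes
    simp only [Set.subset_empty_iff, Finset.coe_eq_empty] at h1
    simp [Trace.seq, Trace.tick, h1]
    exact h2

end

/-! ### The commit phase of a group -/

/-- The item owns both of its slots. -/
def Win (n m s b T : ℕ) (S : ℕ → ℕ) (c : Item) : Prop :=
  S (slot m s b c.i) = stamp n T c.i ∧ S (slot m s b c.j) = stamp n T c.i

instance (n m s b T : ℕ) (S : ℕ → ℕ) : DecidablePred (Win n m s b T S) := fun _ => by
  unfold Win; infer_instance

/-- The items of the list that win. -/
def winners (n m s b T : ℕ) (S : ℕ → ℕ) (l : List Item) : List Item :=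
  l.filter fun c => Win n m s b T S c

/-- The items of the list that lose. -/
def losers (n m s b T : ℕ) (S : ℕ → ℕ) (l : List Item) : List Item :=
  l.filter fun c => ¬ Win n m s b T S c

/-- The permutation that is effected by the items of the list. -/
def knuth (l : List Item) : Equiv.Perm ℕ := (l.map fun c => Equiv.swap c.i c.j).prod

@[simp] theorem knuth_nil : knuth [] = 1 := rfl

@[simp] theorem knuth_cons (c : Item) (l : List Item) :
    knuth (c :: l) = Equiv.swap c.i c.j * knuth l := by simp [knuth]

@[simp] theorem knuth_append (l l' : List Item) : knuth (l ++ l') = knuth l * knuth l' := by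
  simp [knuth]

/-- The array cells that are touched by the items of the list. -/
def itemCells (l : List Item) : Set Loc := {r | ∃ c ∈ l, r = .arr c.i ∨ r = .arr c.j}

section

variable {w n m s b L T lo hi ph : ℕ} {S : ℕ → ℕ}

theorem swap_det {env : Fin 18 → ℕ} {M : Loc → ℕ} {i j : ℕ} (hi : i < n) (hj : j < n)
    (h12 : env 12 = i) (h14 : env 14 = j) :
    Det program w n swapCom ⟨env, M⟩ fun st t =>
      (∀ r : Fin 18, r.val < 16 → st.env r = env r) ∧
      (∀ y, st.mem (.aux y) = M (.aux y)) ∧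
      (∀ y, st.mem (.arr y) = M (.arr (Equiv.swap i j y))) ∧
      t.Le ⟨20, 20, 0, {.arr i, .arr j}, {.arr i, .arr j}, ∅⟩ := by
  refine Det.seq (Det.load i h12 hi ?_)
  refine Det.seq (Det.load j (by simpa [Expr.eval, State.setVar] using h14) hj ?_)
  refine Det.seq (Det.store i (M (.arr j)) (by simpa [Expr.eval, State.setVar] using h12)
    (by simp [Expr.eval, State.setVar, Region.loc]) hi ?_)
  refine Det.store j (M (.arr i)) (by simpa [Expr.eval, State.setVar, State.setMem] using h14)
    (by simp [Expr.eval, State.setVar, State.setMem, Region.loc]) hj ?_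
  simp only [State.setVar, State.setMem, Region.loc]
  refine ⟨?_, ?_, ?_, ⟨?_, ?_, ?_, ?_, ?_, ?_⟩⟩
  · intro r hr
    rw [Function.update_of_ne (by rintro rfl; simp at hr),
      Function.update_of_ne (by rintro rfl; simp at hr)]
  · intro y
    simp
  · intro y
    rw [Equiv.swap_apply_def]
    simp only [Function.update_apply, Loc.arr.injEq]
    split_ifs <;> simp_all
  all_goals simp [Trace.seq, Trace.tick, Expr.size]

theorem keep_det (hG : Geom w n m s b L T) {env : Fin 18 → ℕ} {M : Loc → ℕ} {p v : ℕ}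
    (hp : Params env lo hi ph n m s b L T) (h10 : env 10 = p) (h11 : env 11 = v) (hpb : p < b) :
    Det program w n keepCom ⟨env, M⟩ fun st t =>
      (∀ r : Fin 18, r.val ≠ 10 → st.env r = env r) ∧ st.env 10 = p + 1 ∧
      st.mem = Function.update M (.aux (2 * m + p)) v ∧
      t.Le ⟨20, 20, 0, ∅, {.aux (2 * m + p)}, ∅⟩ := by
  have hlin := hG.lin
  have hb := hG.b_le_m
  have hm := hG.m_le
  refine Det.seq (Det.store (2 * m + p) v ?_ h11 trivial ?_)
  · rw [two_mul]
    exact Expr.eval_add (Expr.eval_add hp.h4 hp.h4 (by omega)) h10 (by omega)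
  refine Det.set (p + 1) (Expr.eval_add h10 (Expr.eval_const (by omega)) (by omega)) ?_
  refine ⟨?_, ?_, rfl, ⟨?_, ?_, ?_, ?_, ?_, ?_⟩⟩
  · intro r hr
    simp only [State.setVar, State.setMem]
    rw [Function.update_of_ne (by rintro rfl; simp at hr)]
  all_goals simp [State.setVar, Region.loc, Trace.seq, Trace.tick, Expr.size]

/-- The body of the loop `commitLoop`. -/
theorem commitBody_det (hG : Geom w n m s b L T) {env : Fin 18 → ℕ} {M : Loc → ℕ} {k p : ℕ}
    {c : Item} (hp : Params env lo hi ph n m s b L T) (h9 : env 9 = k) (h10 : env 10 = p)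
    (hpk : p ≤ k) (hk : k < b) (hcok : c.Ok s b) (hcode : M (.aux (2 * m + k)) = c.i * n + c.j)
    (hS : ∀ y < 2 * m, M (.aux y) = S y) :
    Det program w n commitBody ⟨env, M⟩ fun st t =>
      Params st.env lo hi ph n m s b L T ∧ st.env 9 = k + 1 ∧ st.env 13 = env 13 ∧
      st.env 10 = p + (losers n m s b T S [c]).length ∧
      (∀ y, y ≠ 2 * m + p → st.mem (.aux y) = M (.aux y)) ∧
      (¬ Win n m s b T S c → st.mem (.aux (2 * m + p)) = c.i * n + c.j) ∧
      (Win n m s b T S c → st.mem (.aux (2 * m + p)) = M (.aux (2 * m + p))) ∧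
      (∀ y, st.mem (.arr y) = M (.arr (knuth (winners n m s b T S [c]) y))) ∧
      t.Le ⟨120, 120, 0,
        cells 0 (2 * m) ∪ {.aux (2 * m + k)} ∪ itemCells (winners n m s b T S [c]),
        {.aux (2 * m + p)} ∪ itemCells (winners n m s b T S [c]), ∅⟩ := by
  have hb := hG.b_le_m
  have hm := hG.m_le
  have hlin := hG.lin
  refine Det.seq ((decode_det hG hp h9 hk hcok hcode).mono ?_)
  rintro ⟨env₁, M₁⟩ t₁ ⟨hM₁, hfr, h11, h12, h14, h15, h16, ht₁⟩
  simp only at hM₁ hfr h11 h12 h14 h15 h16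
  subst hM₁
  have hp₁ := hp.congr (env' := env₁) fun r hr => hfr r (Or.inl (by omega))
  have hin : c.i < n := by have := hcok.lt; have := hG.sb_le; omega
  have hjn : c.j < n := by have := hcok.j_le; omega
  have hsi : slot m s b c.i = c.i - s := if_neg (by have := hcok.le; omega)
  have hsl₁ := hG.slot_lt hcok.lt
  have hsl₂ := hG.slot_lt (hcok.j_le.trans_lt hcok.lt)
  refine Det.seq (Det.load (slot m s b c.j) h16 trivial ?_)
  simp only [State.setVar, Region.loc, hS _ hsl₂]
  have hp₂ := hp₁.update 17 (S (slot m s b c.j)) (by decide)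
  refine Det.seq (Det.load (slot m s b c.i) ?_ trivial ?_)
  · rw [hsi]
    exact Expr.eval_sub (by simpa [Expr.eval] using h12) hp₂.h5 (by omega)
  simp only [State.setVar, Region.loc, hS _ hsl₁]
  have hp₃ := hp₂.update 16 (S (slot m s b c.i)) (by decide)
  set env₃ := Function.update (Function.update env₁ 17 (S (slot m s b c.j))) 16
    (S (slot m s b c.i)) with henv₃
  have hfr₃ : ∀ r : Fin 18, r.val ≤ 15 → env₃ r = env₁ r := by
    intro r hr
    rw [henv₃, Function.update_of_ne (by rintro rfl; simp at hr),
      Function.update_of_ne (by rintro rfl; simp at hr)]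
  have hcond : (Expr.bin .eq (x 16) (x 15) * Expr.bin .eq (x 17) (x 15)).eval w env₃ =
      if Win n m s b T S c then 1 else 0 := by
    have e16 : (x 16).eval w env₃ = S (slot m s b c.i) := by simp [Expr.eval, henv₃]
    have e17 : (x 17).eval w env₃ = S (slot m s b c.j) := by simp [Expr.eval, henv₃]
    have e15 : (x 15).eval w env₃ = stamp n T c.i := (hfr₃ 15 (by decide)).trans h15
    rw [Expr.eval_mul (Expr.eval_eq e16 e15 hG.w_pos) (Expr.eval_eq e17 e15 hG.w_pos)]
    · unfold Win
      split_ifs <;> simp_all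
    · split_ifs <;> omega
  have hw₁ := ht₁.work
  have hs₁ := ht₁.span
  have hf₁ := ht₁.frames
  have hw1 := ht₁.writes
  have hm1 := ht₁.maxes
  simp only [Set.subset_empty_iff, Finset.coe_eq_empty] at hw₁ hs₁ hf₁ hw1 hm1
  have hr1 := ht₁.reads
  have hslc₁ : Loc.aux (slot m s b c.i) ∈ cells 0 (2 * m) :=
    aux_mem_cells.2 ⟨Nat.zero_le _, hsl₁⟩
  have hslc₂ : Loc.aux (slot m s b c.j) ∈ cells 0 (2 * m) :=
    aux_mem_cells.2 ⟨Nat.zero_le _, hsl₂⟩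
  clear_value env₃
  refine Det.seq (Runs.ite (fun hne => ?_) (fun h0 => ?_))
  · have hwin : Win n m s b T S c := by
      by_contra h
      rw [if_neg h] at hcond
      exact hne hcond
    have hW : winners n m s b T S [c] = [c] := by simp [winners, hwin]
    have hL : losers n m s b T S [c] = [] := by simp [losers, hwin]
    have hI : itemCells [c] = {.arr c.i, .arr c.j} := by ext r; simp [itemCells]
    rw [hW, hL, hI]
    refine (swap_det (i := c.i) (j := c.j) hin hjn ((hfr₃ 12 (by decide)).trans h12)
      ((hfr₃ 14 (by decide)).trans h14)).mono ?_
    rintro ⟨env₄, M₄⟩ t₄ ⟨hfr₄, haux, harr, ht₄⟩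
    simp only at hfr₄ haux harr
    have hfr₅ : ∀ r : Fin 18, r.val ≤ 10 ∨ r = 13 → env₄ r = env r := by
      intro r hr
      have h15 : r.val ≤ 15 := by rcases hr with hr | rfl; · omega
                                  · decide
      rw [hfr₄ r (by omega), hfr₃ r h15, hfr r hr]
    refine Det.set (k + 1) ?_ ?_
    · exact Expr.eval_add ((hfr₅ 9 (by decide)).trans h9) (Expr.eval_const (by omega)) (by omega)
    simp only [State.setVar]
    have hw₄ := ht₄.work
    have hs₄ := ht₄.span
    have hf₄ := ht₄.frames
    have hr₄ := ht₄.reads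
    have hwr₄ := ht₄.writes
    have hm₄ := ht₄.maxes
    simp only [Set.subset_empty_iff, Finset.coe_eq_empty] at hw₄ hs₄ hf₄ hm₄
    refine ⟨(hp.congr fun r hr => hfr₅ r (Or.inl (by omega))).update 9 _ (by decide), by simp,
      ?_, ?_, fun y _ => haux y, fun h => absurd hwin h, fun _ => haux _, fun y => ?_, ?_⟩
    · rw [Function.update_of_ne (by decide), hfr₅ 13 (by decide)]
    · rw [Function.update_of_ne (by decide), hfr₅ 10 (by decide), h10]; rfl
    · rw [harr]; simp
    · refine ⟨?_, ?_, ?_, ?_, ?_, ?_⟩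
      · simp [Trace.seq, Trace.tick, Expr.size]; omega
      · simp [Trace.seq, Trace.tick, Expr.size]; omega
      · simp [Trace.seq, Trace.tick]; omega
      · simp only [Trace.seq, Trace.tick, Finset.coe_union, Finset.coe_empty, Set.empty_union,
          Set.union_empty, Finset.coe_singleton, Set.union_subset_iff, Set.singleton_subset_iff]
        exact ⟨fun r hr => Or.inl (Or.inr (hr1 hr)), Or.inl (Or.inl hslc₂),
          Or.inl (Or.inl hslc₁), fun r hr => Or.inr (hr₄ hr)⟩
      · simp only [Trace.seq, Trace.tick, Finset.coe_union, Finset.coe_empty, Set.empty_union,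
          Set.union_empty, hw1]
        exact fun r hr => Or.inr (hwr₄ hr)
      · simp [Trace.seq, Trace.tick, hm1, hm₄]
  · have hwin : ¬ Win n m s b T S c := by
      intro h
      rw [if_pos h] at hcond
      rw [hcond] at h0; exact one_ne_zero h0
    have hW : winners n m s b T S [c] = [] := by simp [winners, hwin]
    have hL : losers n m s b T S [c] = [c] := by simp [losers, hwin]
    have hI : itemCells [] = ∅ := by ext r; simp [itemCells]
    rw [hW, hL, hI]
    refine (keep_det hG hp₃ (p := p) (v := c.i * n + c.j)
      ((hfr₃ 10 (by decide)).trans ((hfr 10 (by decide)).trans h10))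
      ((hfr₃ 11 (by decide)).trans h11) (by omega)).mono ?_
    rintro ⟨env₄, M₄⟩ t₄ ⟨hfr₄, h10₄, hM₄, ht₄⟩
    simp only at hfr₄ h10₄ hM₄
    have hfr₅ : ∀ r : Fin 18, r.val ≤ 9 ∨ r = 13 → env₄ r = env r := by
      intro r hr
      have h15 : r.val ≤ 15 ∧ r.val ≠ 10 ∧ (r.val ≤ 10 ∨ r = 13) := by
        rcases hr with hr | rfl
        · exact ⟨by omega, by omega, Or.inl (by omega)⟩
        · decide
      rw [hfr₄ r h15.2.1, hfr₃ r h15.1, hfr r h15.2.2]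
    refine Det.set (k + 1) ?_ ?_
    · exact Expr.eval_add ((hfr₅ 9 (by decide)).trans h9) (Expr.eval_const (by omega)) (by omega)
    simp only [State.setVar]
    have hw₄ := ht₄.work
    have hs₄ := ht₄.span
    have hf₄ := ht₄.frames
    have hr₄ := ht₄.reads
    have hwr₄ := ht₄.writes
    have hm₄ := ht₄.maxes
    simp only [Set.subset_empty_iff, Finset.coe_eq_empty] at hw₄ hs₄ hf₄ hm₄ hr₄
    refine ⟨(hp.congr fun r hr => hfr₅ r (Or.inl (by omega))).update 9 _ (by decide), by simp,
      ?_, ?_, fun y hy => ?_, fun _ => ?_, fun h => absurd h hwin, fun y => ?_, ?_⟩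
    · rw [Function.update_of_ne (by decide), hfr₅ 13 (by decide)]
    · rw [Function.update_of_ne (by decide)]; exact h10₄
    · rw [hM₄, Function.update_of_ne (by simpa using hy)]
    · rw [hM₄]; simp
    · rw [hM₄]; simp
    · refine ⟨?_, ?_, ?_, ?_, ?_, ?_⟩
      · simp [Trace.seq, Trace.tick, Expr.size]; omega
      · simp [Trace.seq, Trace.tick, Expr.size]; omega
      · simp [Trace.seq, Trace.tick]; omega
      · simp only [Trace.seq, Trace.tick, Finset.coe_union, Finset.coe_empty,
          Set.union_empty, Finset.coe_singleton, Set.union_subset_iff, Set.singleton_subset_iff,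
          hr₄]
        exact ⟨fun r hr => Or.inr (hr1 hr), Or.inl hslc₂, Or.inl hslc₁⟩
      · simp only [Trace.seq, Trace.tick, Finset.coe_union, Finset.coe_empty, Set.empty_union,
          Set.union_empty, hw1]
        exact hwr₄
      · simp [Trace.seq, Trace.tick, hm1, hm₄]

theorem winners_cons (c : Item) (l : List Item) :
    winners n m s b T S (c :: l) = winners n m s b T S [c] ++ winners n m s b T S l := by
  simp [winners, List.filter_cons]
  split_ifs <;> rfl

theorem losers_cons (c : Item) (l : List Item) :
    losers n m s b T S (c :: l) = losers n m s b T S [c] ++ losers n m s b T S l := by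
  simp [losers, List.filter_cons]
  split_ifs <;> rfl

theorem itemCells_append (l l' : List Item) : itemCells (l ++ l') = itemCells l ∪ itemCells l' := by
  ext r
  simp [itemCells, or_and_right, exists_or]

/-- The write position `p` never passes the read position `k`, so compaction in place does not
destroy unread codes. The slots are not written in this phase, so all items are judged by the same
`S`. -/
theorem commitLoop_det (hG : Geom w n m s b L T) (l : List Item) :
    ∀ (env : Fin 18 → ℕ) (M : Loc → ℕ) (k p : ℕ), Params env lo hi ph n m s b L T →
      env 9 = k → env 10 = p → env 13 = k + l.length → p ≤ k → k + l.length ≤ b →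
      (∀ c ∈ l, c.Ok s b) → Codes n M (2 * m + k) l → (∀ y < 2 * m, M (.aux y) = S y) →
      Det program w n commitLoop ⟨env, M⟩ fun st t =>
        Params st.env lo hi ph n m s b L T ∧
        st.env 10 = p + (losers n m s b T S l).length ∧
        Codes n st.mem (2 * m + p) (losers n m s b T S l) ∧
        (∀ y, y < 2 * m + p ∨ 2 * m + p + l.length ≤ y →
          st.mem (.aux y) = M (.aux y)) ∧
        (∀ y, st.mem (.arr y) = M (.arr (knuth (winners n m s b T S l) y))) ∧
        t.Le ⟨150 * l.length + 10, 150 * l.length + 10, 0,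
          cells 0 (2 * m) ∪ cells (2 * m + k) (2 * m + k + l.length) ∪
            itemCells (winners n m s b T S l),
          cells (2 * m + p) (2 * m + p + l.length) ∪ itemCells (winners n m s b T S l), ∅⟩ := by
  induction l with
  | nil =>
    intro env M k p hp h9 h10 h13 hpk hk hok hcodes hS
    have hc := lt_cond hG.w_pos h9 h13
    simp only [List.length_nil, add_zero, lt_self_iff_false, if_false] at hc
    refine Det.loop_exit hc ⟨hp, ?_, ?_, ?_, ?_, ⟨?_, ?_, ?_, ?_, ?_, ?_⟩⟩ <;>
      simp [losers, winners, Codes, Trace.tick, Expr.size, h10]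
  | cons c l ih =>
    intro env M k p hp h9 h10 h13 hpk hk hok hcodes hS
    rw [List.length_cons] at h13 hk
    have hcok := hok c List.mem_cons_self
    have hc := lt_cond hG.w_pos h9 h13
    rw [if_pos (by omega)] at hc
    refine Runs.loop_step (by rw [hc]; exact one_ne_zero) (Det.seq ?_)
    refine (commitBody_det hG hp h9 h10 hpk (by omega) hcok hcodes.head hS).mono ?_
    rintro ⟨env₁, M₁⟩ t₁ ⟨hp₁, h9₁, h13₁, h10₁, hkeep₁, hlose, hwin, harr₁, ht₁⟩
    simp only at hp₁ h9₁ h13₁ h10₁ hkeep₁ hlose hwin harr₁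
    have hll : (losers n m s b T S [c]).length ≤ 1 := List.length_filter_le _ _
    refine (ih env₁ M₁ (k + 1) (p + (losers n m s b T S [c]).length) hp₁ h9₁ h10₁
      (by omega) (by omega) (by omega) (fun c hc => hok c (List.mem_cons_of_mem _ hc))
      (hcodes.tail.congr fun y _ _ => hkeep₁ y (by omega))
      (fun y hy => (hkeep₁ y (by omega)).trans (hS y hy))).mono ?_
    rintro ⟨env₂, M₂⟩ t₂ ⟨hp₂, h10₂, hcf, hkeep₂, harr₂, ht₂⟩
    simp only at hp₂ h10₂ hcf hkeep₂ harr₂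
    have hw₁ := ht₁.work
    have hs₁ := ht₁.span
    have hf₁ := ht₁.frames
    have hm₁ := ht₁.maxes
    have hw₂ := ht₂.work
    have hs₂ := ht₂.span
    have hf₂ := ht₂.frames
    have hm₂ := ht₂.maxes
    simp only [Set.subset_empty_iff, Finset.coe_eq_empty] at hw₁ hs₁ hf₁ hm₁ hw₂ hs₂ hf₂ hm₂
    rw [winners_cons, losers_cons, itemCells_append, knuth_append, List.length_cons,
      List.length_append]
    dsimp only
    refine ⟨hp₂, by omega, ?_, fun y hy => ?_, fun y => ?_, ⟨?_, ?_, ?_, ?_, ?_, ?_⟩⟩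
    · by_cases h : Win n m s b T S c
      · have hL : losers n m s b T S [c] = [] := by simp [losers, h]
        simpa [hL] using hcf
      · have hL : losers n m s b T S [c] = [c] := by simp [losers, h]
        rw [hL] at hcf hkeep₂ ⊢
        refine Codes.cons ?_ hcf
        rw [hkeep₂ _ (by simp), hlose h]
    · by_cases h : Win n m s b T S c
      · have hL : losers n m s b T S [c] = [] := by simp [losers, h]
        rw [hL] at hkeep₂
        simp only [List.length_nil] at hkeep₂
        rw [hkeep₂ y (by omega)]
        by_cases hy' : y = 2 * m + p
        · rw [hy', hwin h]
        · exact hkeep₁ y hy'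
      · have hL : losers n m s b T S [c] = [c] := by simp [losers, h]
        rw [hL] at hkeep₂
        simp only [List.length_singleton] at hkeep₂
        rw [hkeep₂ y (by omega), hkeep₁ y (by omega)]
    · rw [harr₂, harr₁]; rfl
    · simp [Trace.seq, Trace.tick, Expr.size]; omega
    · simp [Trace.seq, Trace.tick, Expr.size]; omega
    · simp [Trace.seq, Trace.tick]; omega
    · simp only [Trace.seq, Trace.tick, Finset.coe_union, Finset.coe_empty, Set.empty_union,
        Set.union_subset_iff]
      refine ⟨fun r hr => ?_, fun r hr => ?_⟩
      · rcases ht₁.reads hr with (h | h) | h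
        · exact Or.inl (Or.inl h)
        · exact Or.inl (Or.inr (singleton_subset_cells (by omega) (by omega) h))
        · exact Or.inr (Or.inl h)
      · rcases ht₂.reads hr with (h | h) | h
        · exact Or.inl (Or.inl h)
        · exact Or.inl (Or.inr (cells_mono (by omega) (by omega) h))
        · exact Or.inr (Or.inr h)
    · simp only [Trace.seq, Trace.tick, Finset.coe_union, Finset.coe_empty, Set.empty_union,
        Set.union_subset_iff]
      refine ⟨fun r hr => ?_, fun r hr => ?_⟩
      · rcases ht₁.writes hr with h | h
        · exact Or.inl (singleton_subset_cells (by omega) (by omega) h)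
        · exact Or.inr (Or.inl h)
      · rcases ht₂.writes hr with h | h
        · exact Or.inl (cells_mono (by omega) (by omega) h)
        · exact Or.inr (Or.inr h)
    · simp [Trace.seq, Trace.tick, hm₁, hm₂]

/-- The commit phase of a group. -/
theorem commit_det (hG : Geom w n m s b L T) {env : Fin 18 → ℕ} {M : Loc → ℕ} {g : ℕ}
    {l : List Item} (hp : Params env g hi 2 n m s b L T) (hgm : g < m)
    (hlen : g * L + l.length ≤ b) (hok : ∀ c ∈ l, c.Ok s b)
    (hcnt : M (.aux (3 * m + g)) = l.length) (hcodes : Codes n M (2 * m + g * L) l)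
    (hS : ∀ y < 2 * m, M (.aux y) = S y) :
    Det program w n leafCom ⟨env, M⟩ fun st t =>
      st.env 10 = (losers n m s b T S l).length ∧
      st.mem (.aux (3 * m + g)) = (losers n m s b T S l).length ∧
      Codes n st.mem (2 * m + g * L) (losers n m s b T S l) ∧
      (∀ y, y ≠ 3 * m + g → y < 2 * m + g * L ∨ 2 * m + g * L + l.length ≤ y →
        st.mem (.aux y) = M (.aux y)) ∧
      (∀ y, st.mem (.arr y) = M (.arr (knuth (winners n m s b T S l) y))) ∧
      t.Le ⟨150 * l.length + 150, 150 * l.length + 150, 0,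
        cells 0 (2 * m) ∪ (cells (2 * m + g * L) (2 * m + g * L + l.length) ∪
          {.aux (3 * m + g)}) ∪ itemCells (winners n m s b T S l),
        cells (2 * m + g * L) (2 * m + g * L + l.length) ∪
          {.aux (3 * m + g)} ∪ itemCells (winners n m s b T S l), ∅⟩ := by
  have hlin := hG.lin
  have hb := hG.b_le_m
  have hm := hG.m_le
  have hg : g < n := by omega
  have hll : (losers n m s b T S l).length ≤ l.length := List.length_filter_le _ _
  have h2 : (x 2).eval w env = 2 := hp.h2
  have h2' : (x 2 - .const 1).eval w env = 2 - 1 :=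
    Expr.eval_sub h2 (Expr.eval_const (by omega)) (by omega)
  refine Runs.ite (fun _ => ?_) (fun h => by simp [h2] at h)
  refine Runs.ite (fun _ => ?_) (fun h => by simp [h2'] at h)
  refine Det.seq ((bounds_det hG hp hg (by omega) hcnt).mono ?_)
  rintro ⟨env₁, M₁⟩ t₁ ⟨hM₁, hp₁, h9, h10, h13, ht₁⟩
  simp only at hM₁ hp₁ h9 h10 h13
  subst hM₁
  refine Det.seq ((commitLoop_det hG l env₁ M₁ (g * L) (g * L) hp₁ h9 h10 h13 le_rfl hlen hok
    hcodes hS).mono ?_)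
  rintro ⟨env₂, M₂⟩ t₂ ⟨hp₂, hv, hcf, hkeep, harr, ht₂⟩
  simp only at hp₂ hv hcf hkeep harr
  refine Det.seq (Det.set (losers n m s b T S l).length ?_ ?_)
  · rw [show (losers n m s b T S l).length =
      g * L + (losers n m s b T S l).length - g * L by omega]
    exact Expr.eval_sub hv (Expr.eval_mul hp₂.h0 hp₂.h7 (by omega)) (by omega)
  simp only [State.setVar]
  have hp₃ := hp₂.update 10 (losers n m s b T S l).length (by decide)
  refine Det.store (3 * m + g) (losers n m s b T S l).length ?_ (by simp [Expr.eval]) trivial ?_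
  · rw [show 3 * m + g = m + m + m + g by ring]
    exact Expr.eval_add (Expr.eval_add (Expr.eval_add hp₃.h4 hp₃.h4 (by omega)) hp₃.h4 (by omega))
      hp₃.h0 (by omega)
  simp only [State.setMem, Region.loc]
  refine ⟨by simp, by simp, hcf.congr fun y hy hy' => ?_, fun y hy hy' => ?_, fun y => ?_, ?_⟩
  · rw [Function.update_of_ne (by simp; omega)]
  · rw [Function.update_of_ne (by simpa using hy), hkeep y (by omega)]
  · rw [Function.update_of_ne (by simp), harr]
  · have hw₁ := ht₁.work
    have hs₁ := ht₁.span
    have hf₁ := ht₁.frames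
    have hwr₁ := ht₁.writes
    have hm₁ := ht₁.maxes
    have hw₂ := ht₂.work
    have hs₂ := ht₂.span
    have hf₂ := ht₂.frames
    have hm₂ := ht₂.maxes
    simp only [Set.subset_empty_iff, Finset.coe_eq_empty] at hw₁ hs₁ hf₁ hwr₁ hm₁ hw₂ hs₂ hf₂ hm₂
    refine ⟨?_, ?_, ?_, ?_, ?_, ?_⟩
    · simp [Trace.seq, Trace.tick, Expr.size]; omega
    · simp [Trace.seq, Trace.tick, Expr.size]; omega
    · simp [Trace.seq, Trace.tick]; omega
    · simp only [Trace.seq, Trace.tick, Finset.coe_union, Finset.coe_empty, Set.empty_union,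
        Set.union_empty, Set.union_subset_iff]
      refine ⟨fun r hr => Or.inl (Or.inr (Or.inr (ht₁.reads hr))), fun r hr => ?_⟩
      rcases ht₂.reads hr with (h | h) | h
      · exact Or.inl (Or.inl h)
      · exact Or.inl (Or.inr (Or.inl h))
      · exact Or.inr h
    · simp only [Trace.seq, Trace.tick, Finset.coe_union, Finset.coe_empty, Set.empty_union,
        hwr₁, Set.union_subset_iff, Finset.coe_singleton,
        Set.singleton_subset_iff]
      refine ⟨fun r hr => ?_, Or.inl (Or.inr rfl)⟩
      rcases ht₂.writes hr with h | h
      · exact Or.inl (Or.inl h)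
      · exact Or.inr h
    · simp [Trace.seq, Trace.tick, hm₁, hm₂]

end

/-! ### The drawing phase of a group -/

/-- Independent uniform draws from `{0, …, lo}`, `{0, …, lo + 1}`, … -/
def draws : ℕ → ℕ → PMF (List ℕ)
  | _, 0 => PMF.pure []
  | lo, k + 1 => (unif lo).bind fun v => (draws (lo + 1) k).map (v :: ·)

/-- The range of a draw depends on its index and not on earlier values, so a list of draws splits
into independent parts. -/
theorem draws_add (lo k l : ℕ) :
    draws lo (k + l) = (draws lo k).bind fun xs => (draws (lo + k) l).map (xs ++ ·) := by
  induction k generalizing lo with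
  | zero =>
    simp only [draws, zero_add, add_zero, PMF.pure_bind, List.nil_append]
    exact (PMF.map_id _).symm
  | succ k ih =>
    rw [show k + 1 + l = (k + l) + 1 by ring]
    simp only [draws, ih, PMF.bind_bind]
    congr 1; funext v
    rw [PMF.map_bind, PMF.bind_map]
    congr 1; funext ys
    simp only [Function.comp_apply, PMF.map_comp]
    rw [show lo + 1 + k = lo + (k + 1) by ring]
    congr 1

/-- The heap holds the codes of the drawn items from the cell `a` on. -/
def Drawn (n : ℕ) (M : Loc → ℕ) (a lo : ℕ) (xs : List ℕ) : Prop :=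
  ∀ t (h : t < xs.length), M (.aux (a + t)) = (lo + t) * n + xs[t]

theorem Drawn.cons {n : ℕ} {M : Loc → ℕ} {a lo v : ℕ} {xs : List ℕ}
    (h : M (.aux a) = lo * n + v) (h' : Drawn n M (a + 1) (lo + 1) xs) :
    Drawn n M a lo (v :: xs) := by
  intro t ht
  rcases t with _ | t
  · simpa using h
  · have := h' t (by simpa using ht)
    rw [show a + (t + 1) = a + 1 + t by ring, show lo + (t + 1) = lo + 1 + t by ring]
    simpa using this

theorem Drawn.append {n : ℕ} {M : Loc → ℕ} {a lo : ℕ} {xs ys : List ℕ}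
    (h : Drawn n M a lo xs) (h' : Drawn n M (a + xs.length) (lo + xs.length) ys) :
    Drawn n M a lo (xs ++ ys) := by
  intro t ht
  by_cases hx : t < xs.length
  · rw [h t hx, List.getElem_append_left hx]
  · have := h' (t - xs.length) (by rw [List.length_append] at ht; omega)
    rw [List.getElem_append_right (by omega), ← show a + xs.length + (t - xs.length) = a + t by omega,
      this, show lo + xs.length + (t - xs.length) = lo + t by omega]

theorem Drawn.congr {n : ℕ} {M M' : Loc → ℕ} {a lo : ℕ} {xs : List ℕ} (h : Drawn n M a lo xs)
    (hM : ∀ y, a ≤ y → y < a + xs.length → M' (.aux y) = M (.aux y)) : Drawn n M' a lo xs := by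
  intro t ht
  rw [hM _ (by omega) (by omega)]
  exact h t ht

section

variable {w n m s b L T lo hi ph : ℕ}

/-- The loop of `drawCom`. -/
theorem drawLoop_runs (hG : Geom w n m s b L T) (len : ℕ) :
    ∀ (env : Fin 18 → ℕ) (M : Loc → ℕ) (k : ℕ), Params env lo hi ph n m s b L T →
      env 9 = k → env 13 = k + len → k + len ≤ b →
      Runs program w n drawLoop ⟨env, M⟩ (draws (s + k) len) fun xs st t =>
        Params st.env lo hi ph n m s b L T ∧ st.env 13 = k + len ∧ xs.length = len ∧
        Drawn n st.mem (2 * m + k) (s + k) xs ∧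
        (∀ y, y < 2 * m + k ∨ 2 * m + k + len ≤ y → st.mem (.aux y) = M (.aux y)) ∧
        (∀ y, st.mem (.arr y) = M (.arr y)) ∧
        t.Le ⟨60 * len + 10, 60 * len + 10, 0, ∅, cells (2 * m + k) (2 * m + k + len), ∅⟩ := by
  induction len with
  | zero =>
    intro env M k hp h9 h13 hk
    have hc := lt_cond hG.w_pos h9 h13
    simp only [add_zero, lt_self_iff_false, if_false] at hc
    refine Det.runs (Q := fun s t => s = ⟨env, M⟩ ∧
      t = Trace.tick (1 + (Expr.bin .lt (x 9) (x 13)).size)) [] (Det.loop_exit hc ⟨rfl, rfl⟩) ?_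
    rintro _ _ ⟨rfl, rfl⟩
    refine ⟨hp, h13, rfl, ?_, fun _ _ => rfl, fun _ => rfl, ⟨?_, ?_, ?_, ?_, ?_, ?_⟩⟩
    · intro t ht; simp at ht
    all_goals simp [Trace.tick, Expr.size]
  | succ len ih =>
    intro env M k hp h9 h13 hk
    have hb := hG.b_le_m
    have hm := hG.m_le
    have hlin := hG.lin
    have hsb := hG.sb_le
    have hc := lt_cond hG.w_pos h9 h13
    rw [if_pos (by omega)] at hc
    refine Runs.loop_step (by rw [hc]; exact one_ne_zero) ?_
    refine Runs.seq (q := fun _ => draws (s + k + 1) len) List.cons (Runs.seq_right ?_)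
    refine Runs.rand (s + k) ?_ fun v hv => ?_
    · exact Expr.eval_add (Expr.eval_add hp.h5 h9 (by omega)) (Expr.eval_const (by omega)) (by omega)
    simp only [State.setVar]
    have hp₁ := hp.update 14 v (by decide)
    have h9₁ : (x 9).eval w (Function.update env 14 v) = k := by simpa [Expr.eval] using h9
    have hcode := hG.code_lt (i := s + k) (j := v) (by omega) (by omega)
    refine Det.seq (Det.store (2 * m + k) ((s + k) * n + v) ?_ ?_ trivial ?_)
    · rw [two_mul]
      exact Expr.eval_add (Expr.eval_add hp₁.h4 hp₁.h4 (by omega)) h9₁ (by omega)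
    · exact Expr.eval_add (Expr.eval_mul (Expr.eval_add hp₁.h5 h9₁ (by omega)) hp₁.h3 (by omega))
        (by simp [Expr.eval]) hcode
    refine Det.set (k + 1) ?_ ?_
    · exact Expr.eval_add h9₁ (Expr.eval_const (by omega)) (by omega)
    simp only [State.setVar, State.setMem, Region.loc]
    refine (ih _ _ (k + 1) (hp₁.update 9 (k + 1) (by decide)) (by simp)
      (by simp [h13]; ring) (by omega)).mono ?_
    rintro xs ⟨env₂, M₂⟩ t₂ - ⟨hp₂, h13₂, hlen, hdr, haux, harr, ht⟩
    simp only at hp₂ h13₂ hdr haux harr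
    have hw := ht.work
    have hs := ht.span
    have hf := ht.frames
    have hr := ht.reads
    have hmx := ht.maxes
    simp only [Set.subset_empty_iff, Finset.coe_eq_empty] at hw hs hf hr hmx
    dsimp only
    refine ⟨hp₂, by omega, by simp [hlen], Drawn.cons ?_ hdr, fun y hy => ?_, fun y => ?_,
      ⟨?_, ?_, ?_, ?_, ?_, ?_⟩⟩
    · rw [haux _ (by omega)]; simp
    · rw [haux y (by omega), Function.update_of_ne (by simp; omega)]
    · rw [harr]; simp
    · simp [Trace.seq, Trace.tick, Expr.size]; omega
    · simp [Trace.seq, Trace.tick, Expr.size]; omega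
    · simp [Trace.seq, Trace.tick]; omega
    · simp [Trace.seq, Trace.tick, hr]
    · simp only [Trace.seq, Trace.tick, Finset.coe_union, Finset.coe_empty, Set.empty_union,
        Set.union_empty, Finset.coe_singleton, Set.union_subset_iff]
      exact ⟨singleton_subset_cells (by omega) (by omega),
        ht.writes.trans (cells_mono (by omega) (by omega))⟩
    · simp [Trace.seq, Trace.tick, hmx]

/-- The number of items of group `g`. -/
def groupLen (b L g : ℕ) : ℕ := min b (g * L + L) - g * L

/-- The drawing phase of a group. -/
theorem draw_runs (hG : Geom w n m s b L T) {env : Fin 18 → ℕ} {M : Loc → ℕ} {g : ℕ}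
    (hp : Params env g hi 0 n m s b L T) (hgb : g * L < b) :
    Runs program w n leafCom ⟨env, M⟩ (draws (s + g * L) (groupLen b L g)) fun xs st t =>
      st.env 10 = groupLen b L g ∧ xs.length = groupLen b L g ∧
      st.mem (.aux (3 * m + g)) = groupLen b L g ∧
      Drawn n st.mem (2 * m + g * L) (s + g * L) xs ∧
      (∀ y, y ≠ 3 * m + g → y < 2 * m + g * L ∨ 2 * m + g * L + groupLen b L g ≤ y →
        st.mem (.aux y) = M (.aux y)) ∧
      (∀ y, st.mem (.arr y) = M (.arr y)) ∧
      t.Le ⟨60 * groupLen b L g + 100, 60 * groupLen b L g + 100, 0, ∅,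
        cells (2 * m + g * L) (2 * m + g * L + groupLen b L g) ∪ {.aux (3 * m + g)}, ∅⟩ := by
  have hlin := hG.lin
  have hb := hG.b_le_m
  have hm := hG.m_le
  have hgg : g ≤ g * L := Nat.le_mul_of_pos_right g hG.L_pos
  have hgl := hG.group_le (g := g) (by omega)
  have hL := hG.L_pos
  have hgp : groupLen b L g = min b (g * L + L) - g * L := rfl
  have h2 : (x 2).eval w env = 0 := hp.h2
  refine Runs.ite (fun h => absurd h2 h) (fun _ => ?_)
  refine Runs.seq_left (Det.set (g * L) (Expr.eval_mul hp.h0 hp.h7 (by omega)) ?_)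
  simp only [State.setVar]
  have hp₁ := hp.update 9 (g * L) (by decide)
  refine Runs.seq_left (Det.set (g * L + L) (Expr.eval_add (by simp [Expr.eval]) hp₁.h7 hgl) ?_)
  simp only [State.setVar]
  have hp₂ := hp₁.update 13 (g * L + L) (by decide)
  set env₂ := Function.update (Function.update env 9 (g * L)) 13 (g * L + L) with henv₂
  have h13₂ : (x 13).eval w env₂ = g * L + L := by simp [Expr.eval, henv₂]
  have h9₂ : env₂ 9 = g * L := by simp [henv₂]
  have hcond := Expr.eval_lt (env := env₂) (a := x 6) hp₂.h6 h13₂ hG.w_pos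
  clear_value env₂
  refine Runs.seq_left (Det.mono (Q := fun st t => st.mem = M ∧ Params st.env g hi 0 n m s b L T ∧
    st.env 9 = g * L ∧ st.env 13 = g * L + groupLen b L g ∧ t.Le ⟨8, 8, 0, ∅, ∅, ∅⟩) ?_ ?_)
  · refine Runs.ite (fun h => ?_) (fun h => ?_)
    · have hlt : b < g * L + L := by
        by_contra h'
        rw [if_neg h'] at hcond
        exact h hcond
      refine Det.set b hp₂.h6 ⟨rfl, hp₂.update 13 b (by decide), ?_, ?_, ⟨?_, ?_, ?_, ?_, ?_, ?_⟩⟩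
      · simpa [State.setVar] using h9₂
      · simp [State.setVar, hgp]; omega
      all_goals simp [Trace.seq, Trace.tick, Expr.size]
    · have hge : ¬ b < g * L + L := by
        intro h'
        rw [if_pos h', h] at hcond
        exact absurd hcond (by norm_num)
      have hsk : Det program w n .skip ⟨env₂, M⟩ fun st t => st = ⟨env₂, M⟩ ∧ t = .tick 1 :=
        Sem.shift (Sem.done ⟨rfl, rfl⟩) fun _ => rfl
      refine hsk.mono ?_
      rintro _ _ ⟨rfl, rfl⟩
      refine ⟨rfl, hp₂, h9₂, h13₂.trans (by omega), ⟨?_, ?_, ?_, ?_, ?_, ?_⟩⟩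
      all_goals simp [Trace.seq, Trace.tick, Expr.size]
  rintro ⟨env₃, M₃⟩ t₃ ⟨hM₃, hp₃, h9₃, h13₃, ht₃⟩
  simp only at hM₃ hp₃ h9₃ h13₃
  subst hM₃
  refine Runs.seq_right ((drawLoop_runs hG (groupLen b L g) env₃ M₃ (g * L) hp₃ h9₃ h13₃
    (by omega)).mono ?_)
  rintro xs ⟨env₄, M₄⟩ t₄ - ⟨hp₄, h13₄, hlen, hdr, haux, harr, ht₄⟩
  simp only at hp₄ h13₄ hdr haux harr
  refine Det.seq (Det.set (groupLen b L g) ?_ ?_)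
  · rw [show groupLen b L g = g * L + groupLen b L g - g * L by omega]
    exact Expr.eval_sub h13₄ (Expr.eval_mul hp₄.h0 hp₄.h7 (by omega)) (by omega)
  simp only [State.setVar]
  have hp₅ := hp₄.update 10 (groupLen b L g) (by decide)
  refine Det.store (3 * m + g) (groupLen b L g) ?_ (by simp [Expr.eval]) trivial ?_
  · rw [show 3 * m + g = m + m + m + g by ring]
    exact Expr.eval_add (Expr.eval_add (Expr.eval_add hp₅.h4 hp₅.h4 (by omega)) hp₅.h4 (by omega))
      hp₅.h0 (by omega)
  simp only [State.setMem, Region.loc]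
  have hw₃ := ht₃.work
  have hs₃ := ht₃.span
  have hf₃ := ht₃.frames
  have hr₃ := ht₃.reads
  have hwr₃ := ht₃.writes
  have hm₃ := ht₃.maxes
  have hw₄ := ht₄.work
  have hs₄ := ht₄.span
  have hf₄ := ht₄.frames
  have hr₄ := ht₄.reads
  have hm₄ := ht₄.maxes
  simp only [Set.subset_empty_iff, Finset.coe_eq_empty] at hw₃ hs₃ hf₃ hr₃ hwr₃ hm₃ hw₄ hs₄ hf₄ hr₄ hm₄
  refine ⟨by simp, hlen, by simp, hdr.congr fun y hy hy' => ?_, fun y hy hy' => ?_, fun y => ?_,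
    ⟨?_, ?_, ?_, ?_, ?_, ?_⟩⟩
  · rw [Function.update_of_ne (by simp; omega)]
  · rw [Function.update_of_ne (by simpa using hy), haux y (by omega)]
  · rw [Function.update_of_ne (by simp), harr]
  · simp [Trace.seq, Trace.tick, Expr.size]; omega
  · simp [Trace.seq, Trace.tick, Expr.size]; omega
  · simp [Trace.seq, Trace.tick]; omega
  · simp [Trace.seq, Trace.tick, hr₃, hr₄]
  · simp only [Trace.seq, Trace.tick, Finset.coe_union, Finset.coe_empty, Set.empty_union,
      hwr₃, Finset.coe_singleton]
    exact Set.union_subset_union_left _ ht₄.writes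
  · simp [Trace.seq, Trace.tick, hm₃, hm₄]

end

/-! ### Conflicts -/

/-- The later item `c` uses a slot of the earlier item `a`. -/
def Conf (m s b : ℕ) (a c : Item) : Prop :=
  slot m s b c.j = slot m s b a.i ∨ slot m s b c.j = slot m s b a.j

instance (m s b : ℕ) (a c : Item) : Decidable (Conf m s b a c) := by unfold Conf; infer_instance

/-- Order and weights of items in a block. -/
def Sched (m s b : ℕ) (a c : Item) : Prop :=
  a.i < c.i ∧ (Conf m s b a c → 2 * a.z + 1 ≤ c.z)

section

variable {w n m s b L T : ℕ}

theorem le_raise (M : Loc → ℕ) (l r : Loc) (v : ℕ) : M r ≤ raise M l v r := by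
  unfold raise
  by_cases h : r = l
  · subst h; simp
  · rw [Function.update_of_ne h]

theorem le_raise_self (M : Loc → ℕ) (l : Loc) (v : ℕ) : v ≤ raise M l v l := by
  simp [raise]

theorem raise_eq_or (M : Loc → ℕ) (l r : Loc) (v : ℕ) :
    raise M l v r = M r ∨ (r = l ∧ raise M l v r = v) := by
  unfold raise
  by_cases h : r = l
  · subst h
    rcases le_total (M r) v with h' | h'
    · right; simp [h']
    · left; simp [h']
  · left; rw [Function.update_of_ne h]

theorem le_resMem (M : Loc → ℕ) (c : Item) (r : Loc) : M r ≤ resMem n m s b T M c r :=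
  (le_raise _ _ _ _).trans (le_raise _ _ _ _)

theorem le_foldl_resMem (l : List Item) (M : Loc → ℕ) (r : Loc) :
    M r ≤ l.foldl (resMem n m s b T) M r := by
  induction l generalizing M with
  | nil => exact le_rfl
  | cons c l ih => exact (le_resMem M c r).trans (ih _)

theorem stamp_le_foldl_resMem {l : List Item} {c : Item} (hc : c ∈ l) (M : Loc → ℕ) {y : ℕ}
    (hy : y = slot m s b c.i ∨ y = slot m s b c.j) :
    stamp n T c.i ≤ l.foldl (resMem n m s b T) M (.aux y) := by
  induction l generalizing M with
  | nil => simp at hc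
  | cons d l ih =>
    rcases List.mem_cons.1 hc with rfl | hc
    · refine le_trans ?_ (le_foldl_resMem l _ _)
      rcases hy with rfl | rfl
      · exact (le_raise_self _ _ _).trans (le_raise _ _ _ _)
      · exact le_raise_self _ _ _
    · exact ih hc _

/-- A maximum is one of its arguments; hence a new value in a slot identifies an item that uses the
slot. -/
theorem foldl_resMem_eq_or (l : List Item) (M : Loc → ℕ) (y : ℕ) :
    l.foldl (resMem n m s b T) M (.aux y) = M (.aux y) ∨
      ∃ c ∈ l, (y = slot m s b c.i ∨ y = slot m s b c.j) ∧
        l.foldl (resMem n m s b T) M (.aux y) = stamp n T c.i := by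
  induction l generalizing M with
  | nil => exact Or.inl rfl
  | cons d l ih =>
    rw [List.foldl_cons]
    rcases ih (resMem n m s b T M d) with h | ⟨c, hc, hy, h⟩
    · rw [h]
      rcases raise_eq_or (raise M (.aux (slot m s b d.i)) (stamp n T d.i))
        (.aux (slot m s b d.j)) (.aux y) (stamp n T d.i) with h1 | ⟨h1, h2⟩
      · rcases raise_eq_or M (.aux (slot m s b d.i)) (.aux y) (stamp n T d.i) with h3 | ⟨h3, h4⟩
        · left; exact h1.trans h3
        · right
          cases h3
          exact ⟨d, List.mem_cons_self, Or.inl rfl, h1.trans h4⟩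
      · right
        cases h1
        exact ⟨d, List.mem_cons_self, Or.inr rfl, h2⟩
    · right
      exact ⟨c, List.mem_cons_of_mem _ hc, hy, h⟩

/-- Stamps of time `T` are at most `T * (n + 1) + n`. After the round all slots are therefore below
every stamp of time `T + 1` and need not be cleared. -/
theorem foldl_resMem_lt (l : List Item) {M : Loc → ℕ} {y : ℕ} (h : M (.aux y) < T * (n + 1)) :
    l.foldl (resMem n m s b T) M (.aux y) < (T + 1) * (n + 1) := by
  rcases foldl_resMem_eq_or l M y with h' | ⟨c, -, -, h'⟩ <;> rw [h']
  · exact h.trans_le (Nat.mul_le_mul_right _ (by omega))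
  · unfold stamp
    have : n - c.i ≤ n := Nat.sub_le _ _
    rw [add_mul]; omega

/-- Both positions of `a` are below `c.i`. Slots of positions in the block are distinct, and earlier
positions are sent to cells from `m ≥ b` on. So only the slot of `c.j` can be contested by an
earlier item. -/
theorem Item.Ok.slot_ne (hG : Geom w n m s b L T) {a c : Item} (ha : a.Ok s b) (hc : c.Ok s b)
    (h : a.i < c.i) : slot m s b a.i ≠ slot m s b c.i ∧ slot m s b a.j ≠ slot m s b c.i := by
  have h1 := ha.le
  have h2 := hc.le
  have h3 := ha.j_le
  have h4 := hc.lt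
  have h5 := hG.b_le_m
  unfold slot
  rw [if_neg (by omega), if_neg (by omega)]
  refine ⟨by omega, ?_⟩
  split_ifs <;> omega

/-- After the reservations, an item wins if and only if no earlier pending item is in conflict with
it. -/
theorem win_iff (hG : Geom w n m s b L T) {P : List Item} {M : Loc → ℕ} {S : ℕ → ℕ}
    (hok : ∀ c ∈ P, c.Ok s b) (hM : ∀ y < 2 * m, M (.aux y) < T * (n + 1))
    (hS : ∀ y < 2 * m, S y = P.foldl (resMem n m s b T) M (.aux y)) {c : Item} (hc : c ∈ P) :
    Win n m s b T S c ↔ ∀ a ∈ P, a.i < c.i → ¬ Conf m s b a c := by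
  have hcok := hok c hc
  have hcn : c.i < n := by have := hcok.lt; have := hG.sb_le; omega
  have hsl₁ := hG.slot_lt hcok.lt
  have hsl₂ := hG.slot_lt (hcok.j_le.trans_lt hcok.lt)
  constructor
  -- An earlier item in conflict has put its larger stamp into the slot of `c.j`.
  · rintro ⟨-, h⟩ a ha hlt hconf
    rw [hS _ hsl₂] at h
    have := stamp_le_foldl_resMem (n := n) (T := T) ha M hconf
    rw [h] at this
    unfold stamp at this
    omega
  · intro hno
    have key : ∀ y, (y = slot m s b c.i ∨ y = slot m s b c.j) →
        P.foldl (resMem n m s b T) M (.aux y) = stamp n T c.i := by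
      intro y hy
      have hy2 : y < 2 * m := by rcases hy with rfl | rfl <;> assumption
      have hge := stamp_le_foldl_resMem (n := n) (T := T) hc M hy
      rcases foldl_resMem_eq_or (n := n) (m := m) (s := s) (b := b) (T := T) P M y with
        h | ⟨a, ha, hay, h⟩
      -- Old contents are below `T * (n + 1)` and hence below the stamp that `c` has written.
      · have h1 := hM y hy2
        rw [h] at hge
        unfold stamp at hge
        omega
      · rw [h] at hge ⊢
        have han : a.i < n := by have := (hok a ha).lt; have := hG.sb_le; omega
        -- An earlier owner of the slot would be in conflict with `c`, and a later one has a smaller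
        -- stamp than `c`.
        rcases lt_trichotomy a.i c.i with hlt | heq | hgt
        · exfalso
          have hne := (hok a ha).slot_ne hG hcok hlt
          rcases hy with rfl | rfl
          · rcases hay with h' | h'
            · exact hne.1 h'.symm
            · exact hne.2 h'.symm
          · exact hno a ha hlt hay
        · rw [heq]
        · unfold stamp at hge
          omega
    refine ⟨?_, ?_⟩
    · rw [hS _ hsl₁]; exact key _ (Or.inl rfl)
    · rw [hS _ hsl₂]; exact key _ (Or.inr rfl)

/-- Equal positions have equal slots, so a conflict test on slots detects every common array cell
involving `c.j`; and `c.i` exceeds both positions of `a`. -/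
theorem not_conf_disjoint {a c : Item} (ha : a.Ok s b) (hlt : a.i < c.i)
    (h : ¬ Conf m s b a c) : c.i ≠ a.i ∧ c.i ≠ a.j ∧ c.j ≠ a.i ∧ c.j ≠ a.j := by
  have h1 := ha.j_le
  refine ⟨by omega, by omega, fun h' => h (Or.inl (by rw [h'])), fun h' => h (Or.inr (by rw [h']))⟩

theorem swap_commute {i j k l : ℕ} (h1 : k ≠ i) (h2 : k ≠ j) (h3 : l ≠ i) (h4 : l ≠ j) :
    Commute (Equiv.swap i j) (Equiv.swap k l) := by
  refine Equiv.Perm.Disjoint.commute fun y => ?_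
  by_cases hi : y = i
  · right; subst hi; exact Equiv.swap_apply_of_ne_of_ne h1.symm h3.symm
  · by_cases hj : y = j
    · right; subst hj; exact Equiv.swap_apply_of_ne_of_ne h2.symm h4.symm
    · left; exact Equiv.swap_apply_of_ne_of_ne hi hj

/-- A winner commutes with every item before it, so it can be pulled to the front past the losers.
-/
theorem knuth_split {S : ℕ → ℕ} (l : List Item)
    (h : l.Pairwise fun a c => Win n m s b T S c →
      Commute (Equiv.swap a.i a.j) (Equiv.swap c.i c.j)) :
    knuth l = knuth (winners n m s b T S l) * knuth (losers n m s b T S l) := by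
  induction l with
  | nil => simp [winners, losers]
  | cons a l ih =>
    rw [List.pairwise_cons] at h
    by_cases hw : Win n m s b T S a
    · have h1 : winners n m s b T S (a :: l) = a :: winners n m s b T S l := by
        simp [winners, hw]
      have h2 : losers n m s b T S (a :: l) = losers n m s b T S l := by simp [losers, hw]
      rw [h1, h2, knuth_cons, knuth_cons, ih h.2, mul_assoc]
    · have h1 : winners n m s b T S (a :: l) = winners n m s b T S l := by simp [winners, hw]
      have h2 : losers n m s b T S (a :: l) = a :: losers n m s b T S l := by simp [losers, hw]
      rw [h1, h2, knuth_cons, knuth_cons, ih h.2, ← mul_assoc, ← mul_assoc]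
      congr 1
      refine Commute.list_prod_right _ _ fun y hy => ?_
      simp only [winners, List.mem_map, List.mem_filter, decide_eq_true_eq] at hy
      obtain ⟨c, ⟨hc, hwc⟩, rfl⟩ := hy
      exact h.1 c hc hwc

/-! ### Weights -/

/-- The items that are given by consecutive draws, after the items `acc`. -/
def itemsAfter (m s b : ℕ) : List Item → ℕ → List ℕ → List Item
  | _, _, [] => []
  | acc, i, v :: xs =>
    let c : Item := ⟨i, v, 1 + 2 *
      ((acc.filter fun a => Conf m s b a ⟨i, v, 0⟩).map Item.z).sum⟩
    c :: itemsAfter m s b (acc ++ [c]) (i + 1) xs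

/-- The items of a block. -/
def itemsOf (m s b : ℕ) (xs : List ℕ) : List Item := itemsAfter m s b [] s xs

/-- The sum of the weights. -/
def weight (l : List Item) : ℕ := (l.map Item.z).sum

@[simp] theorem weight_nil : weight [] = 0 := rfl

@[simp] theorem weight_cons (c : Item) (l : List Item) : weight (c :: l) = c.z + weight l := by
  simp [weight]

@[simp] theorem weight_append (l l' : List Item) : weight (l ++ l') = weight l + weight l' := by
  simp [weight]

theorem le_weight {c : Item} {l : List Item} (h : c ∈ l) : c.z ≤ weight l :=
  List.le_sum_of_mem (List.mem_map_of_mem h)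

theorem weight_filter_le (l : List Item) (p : Item → Bool) : weight (l.filter p) ≤ weight l := by
  induction l with
  | nil => simp
  | cons c l ih =>
    rw [List.filter_cons]
    split_ifs <;> simp <;> omega

/-- The weight of a new item contains twice the weight of each earlier item in conflict with it,
plus one. -/
theorem itemsAfter_pairwise (acc : List Item) (i : ℕ) (xs : List ℕ)
    (h : acc.Pairwise (Sched m s b)) (hi : ∀ a ∈ acc, a.i < i) :
    (acc ++ itemsAfter m s b acc i xs).Pairwise (Sched m s b) := by
  induction xs generalizing acc i with
  | nil => simpa [itemsAfter] using h
  | cons v xs ih =>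
    simp only [itemsAfter]
    set c : Item := ⟨i, v, 1 + 2 *
      ((acc.filter fun a => Conf m s b a ⟨i, v, 0⟩).map Item.z).sum⟩ with hc
    have := ih (acc ++ [c]) (i + 1) ?_ ?_
    · rwa [List.append_assoc, List.singleton_append] at this
    · rw [List.pairwise_append]
      refine ⟨h, List.pairwise_singleton _ _, fun a ha d hd => ?_⟩
      rw [List.mem_singleton] at hd
      subst hd
      refine ⟨hi a ha, fun hconf => ?_⟩
      have h1 : a ∈ acc.filter fun a => Conf m s b a ⟨i, v, 0⟩ := by
        rw [List.mem_filter]; exact ⟨ha, decide_eq_true hconf⟩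
      have h2 := le_weight h1
      rw [hc]
      unfold weight at h2
      simp only
      omega
    · intro a ha
      rcases List.mem_append.1 ha with ha | ha
      · have := hi a ha; omega
      · rw [List.mem_singleton] at ha
        rw [ha, hc]; simp

theorem itemsAfter_length (acc : List Item) (i : ℕ) (xs : List ℕ) :
    (itemsAfter m s b acc i xs).length = xs.length := by
  induction xs generalizing acc i with
  | nil => rfl
  | cons v xs ih => simp [itemsAfter, ih]

theorem itemsAfter_getElem (acc : List Item) (i : ℕ) (xs : List ℕ) (t : ℕ)
    (h : t < (itemsAfter m s b acc i xs).length) :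
    (itemsAfter m s b acc i xs)[t].i = i + t ∧
      (itemsAfter m s b acc i xs)[t].j = xs[t]'(by rwa [itemsAfter_length] at h) := by
  induction xs generalizing acc i t with
  | nil => simp [itemsAfter] at h
  | cons v xs ih =>
    rcases t with _ | t
    · simp [itemsAfter]
    · simp only [itemsAfter, List.length_cons, Nat.add_lt_add_iff_right] at h
      simp only [itemsAfter, List.getElem_cons_succ]
      have := ih _ _ t h
      refine ⟨this.1.trans (by ring), this.2⟩

/-- Even if the new item conflicts with all earlier ones, the total weight plus one at most triples.
This worst-case bound serves to limit the time stamps, which must fit into words in every execution.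
-/
theorem weight_itemsAfter_le (acc : List Item) (i : ℕ) (xs : List ℕ) :
    weight acc + weight (itemsAfter m s b acc i xs) + 1 ≤ 3 ^ xs.length * (weight acc + 1) := by
  induction xs generalizing acc i with
  | nil => simp [itemsAfter]
  | cons v xs ih =>
    simp only [itemsAfter]
    set c : Item := ⟨i, v, 1 + 2 *
      ((acc.filter fun a => Conf m s b a ⟨i, v, 0⟩).map Item.z).sum⟩ with hc
    have h1 := ih (acc ++ [c]) (i + 1)
    have h2 : c.z ≤ 1 + 2 * weight acc := by
      have := weight_filter_le acc fun a => Conf m s b a ⟨i, v, 0⟩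
      rw [hc]; unfold weight at this ⊢; simp only; omega
    rw [weight_append, weight_cons, weight_nil] at h1
    rw [weight_cons, List.length_cons, pow_succ]
    have h3 : weight acc + (c.z + 0) + 1 ≤ 3 * (weight acc + 1) := by omega
    calc _ = weight acc + (c.z + 0) + weight (itemsAfter m s b (acc ++ [c]) (i + 1) xs) + 1 := by
          ring
      _ ≤ _ := h1
      _ ≤ 3 ^ xs.length * (3 * (weight acc + 1)) := Nat.mul_le_mul_left _ h3
      _ = _ := by ring

end

/-! ### Sweeps called by the main procedure -/

/-- The array and the first `4 * m` cells of the heap. -/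
def heapCells (m : ℕ) : Set Loc := {r | ∀ y, r = .aux y → y < 4 * m}

theorem cells_subset_heapCells {a e m : ℕ} (h : e ≤ 4 * m) : cells a e ⊆ heapCells m := by
  rintro r ⟨y, h1, h2, rfl⟩ y' hy'
  cases hy'; omega

theorem aux_subset_heapCells {y m : ℕ} (h : y < 4 * m) : {Loc.aux y} ⊆ heapCells m := by
  rintro r rfl y' hy'
  cases hy'; exact h

theorem itemCells_subset_heapCells (l : List Item) (m : ℕ) : itemCells l ⊆ heapCells m := by
  rintro r ⟨c, -, rfl | rfl⟩ y' hy' <;> cases hy'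

/-- A bound for a part of the main procedure. -/
def mainCost (m frames work span : ℕ) : Cost :=
  ⟨work, span, frames, heapCells m, heapCells m, heapCells m⟩

/-- The variables of the main procedure. -/
structure MainVars (env : Fin 18 → ℕ) (n m L s T b G : ℕ) : Prop where
  h0 : env 0 = n
  h1 : env 1 = m
  h2 : env 2 = L
  h4 : env 4 = s
  h5 : env 5 = T
  h6 : env 6 = b
  h7 : env 7 = G

/-- The division of a block into groups. -/
structure Layout (n b L G : ℕ) : Prop where
  pos : 0 < G
  lt : ∀ g < G, g * L < b
  le : b ≤ G * L
  n_le : n ≤ 2 ^ L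

theorem argsSize_sweepArgs (ph : ℕ) : argsSize (sweepArgs ph) = 18 := by
  have h : ∀ i, (sweepArgs ph i).size = 1 := by
    intro i
    fin_cases i <;> rfl
  simp [argsSize, h]

theorem groups_le {g g' L : ℕ} (h : g < g') : g * L + L ≤ g' * L := by
  have := Nat.mul_le_mul_right L (show g + 1 ≤ g' from h)
  rwa [add_mul, one_mul] at this

/-- The pending items of all groups. -/
def flat (lists : ℕ → List Item) (G : ℕ) : List Item := (List.range G).flatMap lists

theorem flat_succ (lists : ℕ → List Item) (G : ℕ) :
    flat lists (G + 1) = flat lists G ++ lists G := by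
  simp [flat, List.range_succ]

theorem length_flat (lists : ℕ → List Item) (G : ℕ) :
    (flat lists G).length = ∑ g ∈ Finset.Ico 0 G, (lists g).length := by
  induction G with
  | zero => simp [flat]
  | succ G ih => rw [flat_succ, List.length_append, ih, Finset.sum_Ico_succ_top (Nat.zero_le _)]

theorem mem_flat {lists : ℕ → List Item} {G g : ℕ} (hg : g < G) {c : Item} (hc : c ∈ lists g) :
    c ∈ flat lists G := by
  simp only [flat, List.mem_flatMap, List.mem_range]
  exact ⟨g, hg, hc⟩

section

variable {w n m s b L T G : ℕ}

theorem MainVars.params {env : Fin 18 → ℕ} (h : MainVars env n m L s T b G) {ph : ℕ}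
    (hw : ph < 2 ^ w) :
    Params (fun i => (sweepArgs ph i).eval w env) 0 G ph n m s b L T := by
  constructor
  · exact Expr.eval_const (by omega)
  · exact h.h7
  · exact Expr.eval_const hw
  · exact h.h0
  · exact h.h1
  · exact h.h4
  · exact h.h6
  · exact h.h2
  · exact h.h5

theorem Layout.G_le (h : Layout n b L G) (hL : 1 ≤ L) : G ≤ b := by
  have h1 := h.pos
  have h2 := h.lt (G - 1) (by omega)
  have h3 := Nat.le_mul_of_pos_right (G - 1) hL
  omega

/-- A sweep over all groups. -/
theorem callSweep_runs (hG : Geom w n m s b L T) (hl : Layout n b L G) {ph sp wk : ℕ}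
    {r : Fin 18} {J : ℕ → List ℕ → (Loc → ℕ) → Prop}
    {q : ℕ → PMF (List ℕ)} {B : ℕ → Cost} {val : ℕ → ℕ} {env : Fin 18 → ℕ} {M : Loc → ℕ}
    (hv : MainVars env n m L s T b G) (hph : ph < 3)
    (hval : ∑ g ∈ Finset.Ico 0 G, val g ≤ n)
    (hrace : ∀ g < G, ∀ g' < G, g ≠ g' → (B g).NoRace (B g'))
    (hspan : ∀ g < G, (B g).span ≤ sp)
    (hframes : ∀ g < G, (B g).frames = 0)
    (hwk : ∑ g ∈ Finset.Ico 0 G, ((B g).work + 400) ≤ wk)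
    (hr : ∀ g < G, (B g).reads ⊆ heapCells m)
    (hwr : ∀ g < G, (B g).writes ⊆ heapCells m)
    (hm : ∀ g < G, (B g).maxes ⊆ heapCells m)
    (hJ : J 0 [] M)
    (hleaf : ∀ g < G, ∀ xs env M, Params env g (g + 1) ph n m s b L T → J g xs M →
      Runs program w n leafCom ⟨env, M⟩ (q g) fun ys st t =>
        J (g + 1) (xs ++ ys) st.mem ∧ t.Le (B g) ∧ st.env 10 = val g) :
    Runs program w n (.call r 0 (sweepArgs ph)) ⟨env, M⟩ (groupDraws q 0 G) fun xs st t =>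
      st.env = Function.update env r (∑ g ∈ Finset.Ico 0 G, val g) ∧ J G xs st.mem ∧
      t.Le (mainCost m (L + 1) (wk + 100) (sp + 200 * L + 300)) := by
  have hlin := hG.lin
  have hGb := hl.G_le hG.L_pos
  have hm' := hG.m_le
  have hbm := hG.b_le_m
  have hGL : G ≤ 2 ^ L := by have := hl.n_le; omega
  refine Runs.call ?_
  refine (sweep_runs (B := B) (J := J) (val := val) (lo₀ := 0) (hi₀ := G) (sp := sp)
    (by omega) (by omega)
    (fun g hg g' hg' => hrace g hg.2 g' hg'.2) (fun g hg => hspan g hg.2)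
    (fun g hg => hframes g hg.2) (fun g hg => hleaf g hg.2) L 0 G []
    (fun i => (sweepArgs ph i).eval w env) M le_rfl hl.pos le_rfl hGL
    (hv.params (by omega)) hJ).mono ?_
  rintro xs ⟨env₁, M₁⟩ t - ⟨hJ', ht, -, hv'⟩
  simp only at hJ' hv'
  have e10 : (x 10).eval w env₁ = ∑ g ∈ Finset.Ico 0 G, val g := hv'
  have h1 := ht.work
  have h2 := ht.span
  have h3 := ht.frames
  simp only [sweepCost] at h1 h2 h3
  refine ⟨?_, hJ', ⟨?_, ?_, ?_, ?_, ?_, ?_⟩⟩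
  · change Function.update env r ((x 10).eval w env₁) = _
    rw [e10]
  · simp [Trace.seq, Trace.tick, Trace.inFrame, mainCost, argsSize_sweepArgs, Expr.size]
    simp at hwk h1
    omega
  · simp [Trace.seq, Trace.tick, Trace.inFrame, mainCost, argsSize_sweepArgs, Expr.size]; omega
  · simp [Trace.seq, Trace.tick, Trace.inFrame, mainCost]; omega
  · simp only [Trace.seq, Trace.tick, Trace.inFrame, Finset.coe_union, Finset.coe_empty,
      Set.empty_union]
    exact ht.reads.trans (Set.iUnion₂_subset fun g hg => hr g hg.2)
  · simp only [Trace.seq, Trace.tick, Trace.inFrame, Finset.coe_union, Finset.coe_empty,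
      Set.empty_union]
    exact ht.writes.trans (Set.iUnion₂_subset fun g hg => hwr g hg.2)
  · simp only [Trace.seq, Trace.tick, Trace.inFrame, Finset.coe_union, Finset.coe_empty,
      Set.empty_union]
    exact ht.maxes.trans (Set.iUnion₂_subset fun g hg => hm g hg.2)

/-- A deterministic sweep over all groups. -/
theorem callSweep_det {r : Fin 18} {ph : ℕ} {env : Fin 18 → ℕ} {M : Loc → ℕ}
    {Q : State 18 → Trace → Prop} {Q' : List ℕ → State 18 → Trace → Prop}
    (h : Runs program w n (.call r 0 (sweepArgs ph)) ⟨env, M⟩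
      (groupDraws (fun _ => PMF.pure []) 0 G) Q') (hQ : ∀ xs st t, Q' xs st t → Q st t) :
    Det program w n (.call r 0 (sweepArgs ph)) ⟨env, M⟩ Q := by
  rw [groupDraws_pure] at h
  have := Sem.map (Q' := fun _ : Unit => Q) (fun _ => ()) h fun a st t _ => hQ a st t
  rwa [PMF.pure_map] at this

/-- The pending lists are stored in the heap. -/
structure Rep (n m b L G : ℕ) (M : Loc → ℕ) (lists : ℕ → List Item) : Prop where
  cnt : ∀ g < G, M (.aux (3 * m + g)) = (lists g).length
  codes : ∀ g < G, Codes n M (2 * m + g * L) (lists g)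
  fit : ∀ g < G, g * L + (lists g).length ≤ b ∧ (lists g).length ≤ L

theorem sum_costs {f : ℕ → ℕ} (a c : ℕ) :
    ∑ g ∈ Finset.Ico 0 G, (a * f g + c + 400) = a * ∑ g ∈ Finset.Ico 0 G, f g + (c + 400) * G := by
  rw [Finset.mul_sum]
  simp only [add_assoc, Finset.sum_add_distrib, Finset.sum_const, Nat.card_Ico, smul_eq_mul,
    Nat.sub_zero]
  ring

/-- The groups read above the slots and touch the slots by maxima only, so collisions of slots
between groups are not races. -/
theorem reserve_phase (hG : Geom w n m s b L T) (hl : Layout n b L G) {env : Fin 18 → ℕ}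
    {M : Loc → ℕ} {lists : ℕ → List Item} (hv : MainVars env n m L s T b G)
    (hrep : Rep n m b L G M lists) (hok : ∀ c ∈ flat lists G, c.Ok s b) :
    Det program w n (.call 9 0 (sweepArgs 1)) ⟨env, M⟩ fun st t =>
      (∀ r : Fin 18, r ≠ 9 → st.env r = env r) ∧
      st.mem = (flat lists G).foldl (resMem n m s b T) M ∧
      t.Le (mainCost m (L + 1) (100 * (flat lists G).length + 600 * G) (700 * L)) := by
  have hbm := hG.b_le_m
  have hGb := hl.G_le hG.L_pos
  have hL := hG.L_pos
  refine callSweep_det (callSweep_runs hG hl (r := 9) (ph := 1) (sp := 100 * L + 100)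
    (wk := 100 * (flat lists G).length + 500 * G)
    (J := fun g _ M' => M' = (flat lists g).foldl (resMem n m s b T) M)
    (q := fun _ => PMF.pure [])
    (B := fun g => ⟨100 * (lists g).length + 100, 100 * (lists g).length + 100, 0,
          cells (2 * m) (4 * m), ∅, cells 0 (2 * m)⟩)
    (val := fun _ => 0) hv (by norm_num) (by simp) ?_ ?_ (fun _ _ => rfl) ?_
    (fun g _ => cells_subset_heapCells le_rfl) (fun g _ => Set.empty_subset _)
    (fun g _ => cells_subset_heapCells (by omega)) rfl ?_) ?_
  · intro g _ g' _ _
    have hd : Disjoint (cells (2 * m) (4 * m)) (cells 0 (2 * m)) := by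
      rw [Set.disjoint_left]
      rintro r ⟨y, h1, h2, rfl⟩ h3
      rw [aux_mem_cells] at h3; omega
    exact ⟨Set.empty_disjoint _, Set.empty_disjoint _, hd, hd⟩
  · intro g hg
    have := (hrep.fit g hg).2
    simp only; omega
  · rw [sum_costs, length_flat]
  · rintro g hg xs env' M' hp rfl
    have hout : ∀ y, 2 * m ≤ y → (flat lists g).foldl (resMem n m s b T) M (.aux y) =
        M (.aux y) := by
      intro y hy
      refine foldl_resMem_of_notMem hG _ _ (fun c hc => hok c ?_) ?_
      · simp only [flat, List.mem_flatMap, List.mem_range] at hc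
        obtain ⟨g', hg', hc⟩ := hc
        exact mem_flat (by omega) hc
      · rw [aux_mem_cells]; omega
    refine Det.runs [] (reserve_det hG hp (l := lists g) (by omega) (hrep.fit g hg).1
      (fun c hc => hok c (mem_flat hg hc)) ?_ ?_) ?_
    · rw [hout _ (by omega), hrep.cnt g hg]
    · exact (hrep.codes g hg).congr fun y hy _ => hout y (by omega)
    · rintro st t ⟨h10, hst, ht⟩
      refine ⟨?_, ht, h10⟩
      rw [hst, flat_succ, List.foldl_append]
  · rintro xs st t ⟨henv, hJ, ht⟩
    refine ⟨fun r hr => ?_, hJ, ?_⟩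
    · rw [henv, Function.update_of_ne hr]
    · have h1 := ht.work
      have h2 := ht.span
      simp only [mainCost] at h1 h2
      have := hl.pos
      exact ⟨by simp only [mainCost]; omega, by simp only [mainCost]; omega, ht.frames, ht.reads,
        ht.writes, ht.maxes⟩

end

section

variable {w n m s b L T G : ℕ}

/-- The private cells of a group. -/
theorem groupCells_disjoint {g g' len len' : ℕ} (hne : g ≠ g')
    (h1 : g * L + len ≤ b ∧ len ≤ L) (h2 : g' * L + len' ≤ b ∧ len' ≤ L) (hbm : b ≤ m)
    {y : ℕ} (h : y ∈ Set.Ico (2 * m + g * L) (2 * m + g * L + len) ∨ y = 3 * m + g)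
    (h' : y ∈ Set.Ico (2 * m + g' * L) (2 * m + g' * L + len') ∨ y = 3 * m + g') : False := by
  simp only [Set.mem_Ico] at h h'
  rcases Nat.lt_or_gt_of_ne hne with hlt | hlt
  · have := groups_le (L := L) hlt
    omega
  · have := groups_le (L := L) hlt
    omega

/-- Slots are only read, lists and counters are private to a group, and the array cells of winners
of different groups are disjoint; this rules out races. The invariant of the sweep has the lists of
the groups before `g` already replaced by their losers. -/
theorem commit_phase (hG : Geom w n m s b L T) (hl : Layout n b L G) {env : Fin 18 → ℕ}
    {M : Loc → ℕ} {lists : ℕ → List Item} {S : ℕ → ℕ} (hv : MainVars env n m L s T b G)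
    (hrep : Rep n m b L G M lists) (hok : ∀ c ∈ flat lists G, c.Ok s b)
    (hlen : (flat lists G).length ≤ b) (hS : ∀ y < 2 * m, M (.aux y) = S y)
    (hdisj : ∀ g < G, ∀ g' < G, g ≠ g' → Disjoint (itemCells (winners n m s b T S (lists g)))
      (itemCells (winners n m s b T S (lists g')))) :
    Det program w n (.call 8 0 (sweepArgs 2)) ⟨env, M⟩ fun st t =>
      (∀ r : Fin 18, r ≠ 8 → st.env r = env r) ∧
      st.env 8 = (flat (fun g => losers n m s b T S (lists g)) G).length ∧
      Rep n m b L G st.mem (fun g => losers n m s b T S (lists g)) ∧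
      (∀ y < 2 * m, st.mem (.aux y) = S y) ∧
      (∀ y, st.mem (.arr y) = M (.arr (knuth (winners n m s b T S (flat lists G)) y))) ∧
      t.Le (mainCost m (L + 1) (150 * (flat lists G).length + 700 * G) (800 * L)) := by
  have hbm := hG.b_le_m
  have hGb := hl.G_le hG.L_pos
  have hL := hG.L_pos
  have hsb := hG.sb_le
  have hll : ∀ g, (losers n m s b T S (lists g)).length ≤ (lists g).length := fun g =>
    List.length_filter_le _ _
  refine callSweep_det (callSweep_runs hG hl (r := 8) (ph := 2) (sp := 150 * L + 150)
    (wk := 150 * (flat lists G).length + 550 * G)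
    (J := fun g _ M' =>
      Rep n m b L G M' (fun g' => if g' < g then losers n m s b T S (lists g') else lists g') ∧
      (∀ y < 2 * m, M' (.aux y) = S y) ∧
      (∀ y, M' (.arr y) = M (.arr (knuth (winners n m s b T S (flat lists g)) y))))
    (q := fun _ => PMF.pure [])
    (B := fun g => ⟨150 * (lists g).length + 150, 150 * (lists g).length + 150, 0,
        cells 0 (2 * m) ∪ (cells (2 * m + g * L) (2 * m + g * L + (lists g).length) ∪
          {.aux (3 * m + g)}) ∪ itemCells (winners n m s b T S (lists g)),
        cells (2 * m + g * L) (2 * m + g * L + (lists g).length) ∪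
          {.aux (3 * m + g)} ∪ itemCells (winners n m s b T S (lists g)), ∅⟩)
    (val := fun g => (losers n m s b T S (lists g)).length) hv (by norm_num) ?_ ?_ ?_
    (fun _ _ => rfl) ?_ ?_ ?_ (fun g _ => Set.empty_subset _) ?_ ?_) ?_
  · calc _ ≤ ∑ g ∈ Finset.Ico 0 G, (lists g).length := Finset.sum_le_sum fun g _ => hll g
      _ = (flat lists G).length := (length_flat _ _).symm
      _ ≤ n := by omega
  · have key : ∀ g < G, ∀ g' < G, g ≠ g' → Disjoint
        (cells (2 * m + g * L) (2 * m + g * L + (lists g).length) ∪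
          {.aux (3 * m + g)} ∪ itemCells (winners n m s b T S (lists g)))
        (cells 0 (2 * m) ∪ (cells (2 * m + g' * L) (2 * m + g' * L + (lists g').length) ∪
          {.aux (3 * m + g')}) ∪ itemCells (winners n m s b T S (lists g'))) := by
      intro g hg g' hg' hne
      rw [Set.disjoint_left]
      intro r hr hr'
      rcases r with y | y
      · have e : ∀ a e, Loc.arr y ∉ cells a e := by
          rintro a e ⟨_, _, _, h⟩; cases h
        simp only [Set.mem_union, e, Set.mem_singleton_iff, reduceCtorEq, false_or] at hr hr'
        exact Set.disjoint_left.1 (hdisj g hg g' hg' hne) hr hr'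
      · have e : ∀ l, Loc.aux y ∉ itemCells l := by
          rintro l ⟨c, _, h | h⟩ <;> cases h
        simp only [Set.mem_union, e, Set.mem_singleton_iff, Loc.aux.injEq, or_false,
          aux_mem_cells] at hr hr'
        rcases hr' with hr' | hr'
        · omega
        · exact groupCells_disjoint hne (hrep.fit g hg) (hrep.fit g' hg') hbm hr hr'
    have key' : ∀ g < G, ∀ g' < G, g ≠ g' → Disjoint
        (cells (2 * m + g * L) (2 * m + g * L + (lists g).length) ∪
          {.aux (3 * m + g)} ∪ itemCells (winners n m s b T S (lists g)))
        (cells (2 * m + g' * L) (2 * m + g' * L + (lists g').length) ∪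
          {.aux (3 * m + g')} ∪ itemCells (winners n m s b T S (lists g'))) := by
      intro g hg g' hg' hne
      refine (key g hg g' hg' hne).mono_right ?_
      exact Set.union_subset_union_left _ Set.subset_union_right
    intro g hg g' hg' hne
    refine ⟨?_, ?_, Set.disjoint_empty _, Set.disjoint_empty _⟩
    · simp only [Set.union_empty, Set.disjoint_union_right] at key key' ⊢
      exact ⟨key g hg g' hg' hne, key' g hg g' hg' hne⟩
    · simp only [Set.union_empty, Set.disjoint_union_right] at key key' ⊢
      exact ⟨key g' hg' g hg hne.symm, key' g' hg' g hg hne.symm⟩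
  · intro g hg
    have := (hrep.fit g hg).2
    simp only; omega
  · rw [sum_costs, length_flat]
  · intro g hg
    have := (hrep.fit g hg).1
    exact Set.union_subset (Set.union_subset (cells_subset_heapCells (by omega))
      (Set.union_subset (cells_subset_heapCells (by omega)) (aux_subset_heapCells (by omega))))
      (itemCells_subset_heapCells _ _)
  · intro g hg
    have := (hrep.fit g hg).1
    exact Set.union_subset (Set.union_subset (cells_subset_heapCells (by omega))
      (aux_subset_heapCells (by omega))) (itemCells_subset_heapCells _ _)
  · refine ⟨by simpa using hrep, hS, fun y => by simp [flat, winners]⟩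
  · rintro g hg xs env' M' hp ⟨hrep', hS', harr⟩
    have hcnt := hrep'.cnt g hg
    have hcodes := hrep'.codes g hg
    simp only [lt_self_iff_false, if_false] at hcnt hcodes
    refine Det.runs [] (commit_det hG hp (l := lists g) (S := S) (by omega) (hrep.fit g hg).1
      (fun c hc => hok c (mem_flat hg hc)) hcnt hcodes hS') ?_
    rintro ⟨env₁, M₁⟩ t ⟨h10, hcnt₁, hcodes₁, hkeep, harr₁, ht⟩
    simp only at h10 hcnt₁ hcodes₁ hkeep harr₁
    have hfit := hrep.fit g hg
    refine ⟨⟨⟨?_, ?_, ?_⟩, ?_, ?_⟩, ht, h10⟩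
    · intro g' hg'
      by_cases he : g' = g
      · subst he; simpa using hcnt₁
      · dsimp only
        rw [hkeep _ (by omega) (by omega), hrep'.cnt g' hg']
        by_cases hlt : g' < g
        · rw [if_pos hlt, if_pos (by omega)]
        · rw [if_neg hlt, if_neg (by omega)]
    · intro g' hg'
      by_cases he : g' = g
      · subst he; simpa using hcodes₁
      · have hc := hrep'.codes g' hg'
        have hf := hrep'.fit g' hg'
        have hiff : (if g' < g + 1 then losers n m s b T S (lists g') else lists g') =
            if g' < g then losers n m s b T S (lists g') else lists g' := by
          by_cases hlt : g' < g
          · rw [if_pos hlt, if_pos (by omega)]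
          · rw [if_neg hlt, if_neg (by omega)]
        simp only at hc hf ⊢
        rw [hiff]
        refine hc.congr fun y hy hy' => ?_
        by_contra hcon
        have hin : y ∈ Set.Ico (2 * m + g * L) (2 * m + g * L + (lists g).length) ∨
            y = 3 * m + g := by
          by_contra hno
          push Not at hno
          simp only [Set.mem_Ico, not_and_or, not_le, not_lt] at hno
          exact hcon (hkeep y hno.2 hno.1)
        exact groupCells_disjoint (Ne.symm he) hfit hf hbm hin (Or.inl ⟨hy, hy'⟩)
    · intro g' hg'
      have := hrep.fit g' hg'
      have := hll g'
      split_ifs <;> omega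
    · intro y hy
      dsimp only
      rw [hkeep y (by omega) (by omega), hS' y hy]
    · intro y
      dsimp only
      rw [harr₁, harr, flat_succ]
      simp [winners]
  · rintro xs st t ⟨henv, ⟨hrep', hS', harr⟩, ht⟩
    refine ⟨fun r hr => ?_, ?_, ⟨?_, ?_, ?_⟩, hS', harr, ?_⟩
    · rw [henv, Function.update_of_ne hr]
    · rw [henv, length_flat]; simp
    · intro g hg; simpa [hg] using hrep'.cnt g hg
    · intro g hg; simpa [hg] using hrep'.codes g hg
    · intro g hg; simpa [hg] using hrep'.fit g hg
    · have h1 := ht.work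
      have h2 := ht.span
      simp only [mainCost] at h1 h2
      have := hl.pos
      exact ⟨by simp only [mainCost]; omega, by simp only [mainCost]; omega, ht.frames, ht.reads,
        ht.writes, ht.maxes⟩

/-! ### Drawing the items of a block -/

theorem mem_support_draws {lo k : ℕ} {xs : List ℕ} (h : xs ∈ (draws lo k).support) :
    xs.length = k ∧ ∀ t (ht : t < xs.length), xs[t] ≤ lo + t := by
  induction k generalizing lo xs with
  | zero =>
    simp only [draws, PMF.support_pure, Set.mem_singleton_iff] at h
    subst h; simp
  | succ k ih =>
    simp only [draws, PMF.support_bind, PMF.support_map, Set.mem_iUnion, Set.mem_image, unif] at h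
    obtain ⟨v, ⟨u, -, rfl⟩, ys, hys, rfl⟩ := h
    obtain ⟨h1, h2⟩ := ih hys
    refine ⟨by simp [h1], fun t ht => ?_⟩
    rcases t with _ | t
    · have := u.2; simp; omega
    · have := h2 t (by simpa using ht)
      simp only [List.getElem_cons_succ]; omega

/-- Consecutive groups cover consecutive steps, so their draws concatenate to the draws of the
block. -/
theorem groupDraws_draws (hl : Layout n b L G) {k : ℕ} (hk : k ≤ G) :
    groupDraws (fun g => draws (s + g * L) (groupLen b L g)) 0 k = draws s (min b (k * L)) := by
  induction k with
  | zero => simp [groupDraws, draws]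
  | succ k ih =>
    have h1 := hl.lt k (by omega)
    have h2 : min b ((k + 1) * L) = k * L + groupLen b L k := by
      unfold groupLen; rw [add_mul, one_mul]; omega
    rw [groupDraws_add, ih (by omega), h2, draws_add, groupDraws_one, zero_add,
      min_eq_right h1.le]

/-- The items of a group, before any of them is executed. -/
def chunk (L : ℕ) (l : List Item) (g : ℕ) : List Item := (l.drop (g * L)).take L

theorem flat_chunk (l : List Item) (k : ℕ) : flat (chunk L l) k = l.take (k * L) := by
  induction k with
  | zero => simp [flat]
  | succ k ih => rw [flat_succ, ih, chunk, add_mul, one_mul, List.take_add]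

theorem itemsOf_getElem (xs : List ℕ) (t : ℕ) (h : t < (itemsOf m s b xs).length) :
    (itemsOf m s b xs)[t].i = s + t ∧
      (itemsOf m s b xs)[t].j = xs[t]'(by rwa [itemsOf, itemsAfter_length] at h) :=
  itemsAfter_getElem [] s xs t h

theorem itemsOf_ok {xs : List ℕ} (hxs : xs ∈ (draws s b).support) :
    ∀ c ∈ itemsOf m s b xs, c.Ok s b := by
  obtain ⟨hlen, hle⟩ := mem_support_draws hxs
  intro c hc
  obtain ⟨t, ht, rfl⟩ := List.getElem_of_mem hc
  obtain ⟨h1, h2⟩ := itemsOf_getElem xs t ht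
  have ht' : t < xs.length := by rwa [itemsOf, itemsAfter_length] at ht
  have := hle t ht'
  constructor
  · exact h1 ▸ Nat.le_add_right _ _
  · exact h1 ▸ by omega
  · rw [h1, h2]; exact this

/-- Weights depend on all earlier draws of the block and not on one group alone. The sweep therefore
tracks the raw draws, and the items are formed from them at the end. -/
theorem draw_phase (hG : Geom w n m s b L T) (hl : Layout n b L G) {env : Fin 18 → ℕ}
    {M : Loc → ℕ} (hv : MainVars env n m L s T b G) :
    Runs program w n (.call 8 0 (sweepArgs 0)) ⟨env, M⟩ (draws s b) fun xs st t =>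
      (∀ r : Fin 18, r ≠ 8 → st.env r = env r) ∧ st.env 8 = b ∧
      Rep n m b L G st.mem (chunk L (itemsOf m s b xs)) ∧
      (∀ y < 2 * m, st.mem (.aux y) = M (.aux y)) ∧
      (∀ y, st.mem (.arr y) = M (.arr y)) ∧
      t.Le (mainCost m (L + 1) (60 * b + 600 * G) (700 * L)) := by
  have hbm := hG.b_le_m
  have hGb := hl.G_le hG.L_pos
  have hL := hG.L_pos
  have hsb := hG.sb_le
  have hsum : ∀ k ≤ G, ∑ g ∈ Finset.Ico 0 k, groupLen b L g = min b (k * L) := by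
    intro k hk
    induction k with
    | zero => simp
    | succ k ih =>
      have h1 := hl.lt k (by omega)
      rw [Finset.sum_Ico_succ_top (Nat.zero_le _), ih (by omega)]
      unfold groupLen; rw [add_mul, one_mul]; omega
  have hsumG : ∑ g ∈ Finset.Ico 0 G, groupLen b L g = b := by
    rw [hsum G le_rfl, min_eq_left hl.le]
  have hfit : ∀ g < G, g * L + groupLen b L g ≤ b ∧ groupLen b L g ≤ L := by
    intro g hg
    have := hl.lt g hg
    unfold groupLen; omega
  have hrun := callSweep_runs hG hl (r := 8) (ph := 0) (sp := 60 * L + 100) (M := M)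
    (wk := 60 * b + 500 * G)
    (J := fun g xs M' => xs.length = min b (g * L) ∧ Drawn n M' (2 * m) s xs ∧
      (∀ g' < g, M' (.aux (3 * m + g')) = groupLen b L g') ∧
      (∀ y < 2 * m, M' (.aux y) = M (.aux y)) ∧ (∀ y, M' (.arr y) = M (.arr y)))
    (q := fun g => draws (s + g * L) (groupLen b L g))
    (B := fun g => ⟨60 * groupLen b L g + 100, 60 * groupLen b L g + 100, 0, ∅,
        cells (2 * m + g * L) (2 * m + g * L + groupLen b L g) ∪ {.aux (3 * m + g)}, ∅⟩)
    (val := fun g => groupLen b L g) hv (by norm_num) (by rw [hsumG]; omega) ?_ ?_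
    (fun _ _ => rfl) (by rw [sum_costs, hsumG]) (fun g _ => Set.empty_subset _) ?_
    (fun g _ => Set.empty_subset _) ?_ ?_
  · rw [groupDraws_draws hl le_rfl, min_eq_left hl.le] at hrun
    refine hrun.mono ?_
    rintro xs st t hxs ⟨henv, ⟨hlen, hdr, hcnt, hslots, harr⟩, ht⟩
    have hilen : (itemsOf m s b xs).length = b := by rw [itemsOf, itemsAfter_length, hlen]
    have hclen : ∀ g < G, (chunk L (itemsOf m s b xs) g).length = groupLen b L g := by
      intro g hg
      have := hl.lt g hg
      rw [chunk, List.length_take, List.length_drop, hilen]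
      unfold groupLen; omega
    refine ⟨fun r hr => ?_, ?_, ⟨?_, ?_, ?_⟩, hslots, harr, ?_⟩
    · rw [henv, Function.update_of_ne hr]
    · rw [henv, hsumG]; simp
    · intro g hg; rw [hcnt g hg, hclen g hg]
    · intro g hg t ht
      have htl := hclen g hg
      have hf := hfit g hg
      have ht' : g * L + t < (itemsOf m s b xs).length := by omega
      have hget : (chunk L (itemsOf m s b xs) g)[t] = (itemsOf m s b xs)[g * L + t] := by
        simp [chunk]
      obtain ⟨h1, h2⟩ := itemsOf_getElem xs (g * L + t) ht'
      rw [hget, h1, h2, ← hdr (g * L + t) (by omega)]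
      congr 2; ring
    · intro g hg; rw [hclen g hg]; exact hfit g hg
    · have h1 := ht.work
      have h2 := ht.span
      simp only [mainCost] at h1 h2
      have := hl.pos
      exact ⟨by simp only [mainCost]; omega, by simp only [mainCost]; omega, ht.frames, ht.reads,
        ht.writes, ht.maxes⟩
  · intro g hg g' hg' hne
    have key : ∀ g < G, ∀ g' < G, g ≠ g' → Disjoint
        (cells (2 * m + g * L) (2 * m + g * L + groupLen b L g) ∪ {.aux (3 * m + g)})
        (cells (2 * m + g' * L) (2 * m + g' * L + groupLen b L g') ∪ {.aux (3 * m + g')}) := by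
      intro g hg g' hg' hne
      rw [Set.disjoint_left]
      intro r hr hr'
      rcases r with y | y
      · have e : ∀ a e, Loc.arr y ∉ cells a e := by
          rintro a e ⟨_, _, _, h⟩; cases h
        simp [e] at hr
      · simp only [Set.mem_union, Set.mem_singleton_iff, Loc.aux.injEq, aux_mem_cells] at hr hr'
        exact groupCells_disjoint hne (hfit g hg) (hfit g' hg') hbm hr hr'
    refine ⟨?_, ?_, Set.disjoint_empty _, Set.disjoint_empty _⟩
    · simpa using key g hg g' hg' hne
    · simpa using key g' hg' g hg hne.symm
  · intro g hg
    have := hfit g hg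
    simp only; omega
  · intro g hg
    have := hfit g hg
    exact Set.union_subset (cells_subset_heapCells (by omega)) (aux_subset_heapCells (by omega))
  · refine ⟨by simp, ?_, by simp, fun _ _ => rfl, fun _ => rfl⟩
    intro t ht; simp at ht
  · rintro g hg xs env' M' hp ⟨hlen, hdr, hcnt, hslots, harr⟩
    have hgb := hl.lt g hg
    have hf := hfit g hg
    rw [min_eq_right hgb.le] at hlen
    refine (draw_runs hG hp hgb).mono ?_
    rintro ys ⟨env₁, M₁⟩ t - ⟨h10, hylen, hcnt₁, hdr₁, hkeep, harr₁, ht⟩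
    simp only at h10 hcnt₁ hdr₁ hkeep harr₁
    refine ⟨⟨?_, ?_, ?_, ?_, ?_⟩, ht, h10⟩
    · rw [List.length_append, hlen, hylen, add_mul, one_mul]
      unfold groupLen; omega
    · refine Drawn.append (hdr.congr fun y hy hy' => hkeep y (by omega) (by omega)) ?_
      rw [hlen]; exact hdr₁
    · intro g' hg'
      by_cases he : g' = g
      · subst he; exact hcnt₁
      · dsimp only
        rw [hkeep _ (by omega) (by omega), hcnt g' (by omega)]
    · intro y hy
      dsimp only
      rw [hkeep y (by omega) (by omega), hslots y hy]
    · intro y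
      dsimp only
      rw [harr₁, harr]

end

/-! ### Settling a block by rounds of reservation and commit -/

section

variable {w n m s b L T G : ℕ}

theorem MainVars.congr {env env' : Fin 18 → ℕ} (h : MainVars env n m L s T b G)
    (he : ∀ r : Fin 18, r.val < 8 → env' r = env r) : MainVars env' n m L s T b G := by
  constructor
  · rw [he 0 (by decide), h.h0]
  · rw [he 1 (by decide), h.h1]
  · rw [he 2 (by decide), h.h2]
  · rw [he 4 (by decide), h.h4]
  · rw [he 5 (by decide), h.h5]
  · rw [he 6 (by decide), h.h6]
  · rw [he 7 (by decide), h.h7]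

theorem MainVars.setTime {env : Fin 18 → ℕ} (h : MainVars env n m L s T b G) (T' : ℕ) :
    MainVars (Function.update env 5 T') n m L s T' b G := by
  constructor
  · rw [Function.update_of_ne (by decide), h.h0]
  · rw [Function.update_of_ne (by decide), h.h1]
  · rw [Function.update_of_ne (by decide), h.h2]
  · rw [Function.update_of_ne (by decide), h.h4]
  · simp
  · rw [Function.update_of_ne (by decide), h.h6]
  · rw [Function.update_of_ne (by decide), h.h7]

theorem Geom.setTime (h : Geom w n m s b L T) {T' : ℕ} (hT : T' ≤ 4 * n) : Geom w n m s b L T' :=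
  ⟨h.s_pos, h.b_pos, h.b_le_s, h.b_le_m, h.sb_le, h.m_le, h.L_pos, h.L_le, hT, h.word⟩

theorem flat_losers (lists : ℕ → List Item) (S : ℕ → ℕ) (G : ℕ) :
    flat (fun g => losers n m s b T S (lists g)) G = losers n m s b T S (flat lists G) := by
  simp [flat, losers, List.filter_flatMap]

/-- A potential that pays for the pending items. -/
def pot (k : ℕ) (l : List Item) : ℕ := (l.map fun c => c.z - k).sum

/-- Each `z - k` is positive. It drops by one for an item that stays and vanishes for one that
leaves, so every item of the list pays at least one unit. -/
theorem pot_filter_add_length (k : ℕ) (l : List Item) (p : Item → Bool) (h : ∀ c ∈ l, k < c.z) :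
    pot (k + 1) (l.filter p) + l.length ≤ pot k l := by
  induction l with
  | nil => simp [pot]
  | cons c l ih =>
    have h1 := ih fun c hc => h c (List.mem_cons_of_mem _ hc)
    have h2 := h c List.mem_cons_self
    rw [List.filter_cons]
    split_ifs
    · simp only [pot, List.map_cons, List.sum_cons, List.length_cons] at h1 ⊢
      omega
    · simp only [pot, List.map_cons, List.sum_cons, List.length_cons] at h1 ⊢
      omega

theorem Trace.Le.seq_main {t u : Trace} {f wk sp wk' sp' wk'' sp'' : ℕ}
    (ht : t.Le (mainCost m f wk sp)) (hu : u.Le (mainCost m f wk' sp'))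
    (hw : wk + wk' ≤ wk'') (hs : sp + sp' ≤ sp'') : (t.seq u).Le (mainCost m f wk'' sp'') :=
  Trace.Le.seq ht hu hw hs (max_self f).le (Set.union_self _).subset (Set.union_self _).subset
    (Set.union_self _).subset

theorem tick_le_main {c f wk sp : ℕ} (hw : c ≤ wk) (hs : c ≤ sp) :
    (Trace.tick c).Le (mainCost m f wk sp) :=
  ⟨hw, hs, Nat.zero_le _, by simp [Trace.tick], by simp [Trace.tick], by simp [Trace.tick]⟩

/-- Of two winners in different groups, the one in the later group has the later step. As it won, it
has no conflict with the other, so they share no array cell. -/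
theorem winners_disjoint {lists : ℕ → List Item} {S : ℕ → ℕ}
    (hok : ∀ c ∈ flat lists G, c.Ok s b) (hpw : (flat lists G).Pairwise (Sched m s b))
    (hwin : ∀ c ∈ flat lists G, Win n m s b T S c →
      ∀ a ∈ flat lists G, a.i < c.i → ¬ Conf m s b a c)
    {g g' : ℕ} (hg : g < G) (hg' : g' < G) (hne : g ≠ g') :
    Disjoint (itemCells (winners n m s b T S (lists g)))
      (itemCells (winners n m s b T S (lists g'))) := by
  wlog hlt : g < g' generalizing g g'
  · exact (this hg' hg hne.symm (by omega)).symm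
  rw [Set.disjoint_left]
  rintro r ⟨a, ha, hra⟩ ⟨c, hc, hrc⟩
  simp only [winners, List.mem_filter, decide_eq_true_eq] at ha hc
  have hpw' := (List.pairwise_flatMap.1 hpw).2
  rw [List.pairwise_iff_getElem] at hpw'
  have hs := hpw' g g' (by simpa using hg) (by simpa using hg') hlt
  simp only [List.getElem_range] at hs
  have hac := (hs a ha.1 c hc.1).1
  have ha' := mem_flat hg ha.1
  have hcc := hwin c (mem_flat hg' hc.1) hc.2 a ha' hac
  obtain ⟨h1, h2, h3, h4⟩ := not_conf_disjoint (hok a ha') hac hcc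
  rcases hra with rfl | rfl <;> rcases hrc with h | h <;>
    simp only [Loc.arr.injEq] at h <;> omega

/-- The loop that settles all items of a block. -/
theorem settle_det (hl : Layout n b L G) (f : ℕ) :
    ∀ (k T : ℕ) (env : Fin 18 → ℕ) (M : Loc → ℕ) (lists : ℕ → List Item),
      Geom w n m s b L T → T + f ≤ 4 * n → MainVars env n m L s T b G →
      env 8 = (flat lists G).length → Rep n m b L G M lists →
      (∀ c ∈ flat lists G, c.Ok s b) → (flat lists G).Pairwise (Sched m s b) →
      (flat lists G).length ≤ b → (∀ y < 2 * m, M (.aux y) < T * (n + 1)) →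
      (∀ c ∈ flat lists G, 2 ^ k ≤ c.z) → (∀ c ∈ flat lists G, c.z < 2 ^ (k + f)) →
      Det program w n settleLoop ⟨env, M⟩ fun st t =>
        (∃ T' ≤ T + f, MainVars st.env n m L s T' b G ∧
          ∀ y < 2 * m, st.mem (.aux y) < T' * (n + 1)) ∧
        (∀ y, st.mem (.arr y) = M (.arr (knuth (flat lists G) y))) ∧
        t.Le (mainCost m (L + 1) (1400 * G * f + 300 * pot k (flat lists G) + 10)
          (1600 * L * f + 10)) := by
  induction f with
  | zero =>
    intro k T env M lists hG hT hv h8 hrep hok hpw hlen hM hlow hhigh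
    -- With no round left, `2 ^ k` bounds the weights from below and strictly from above.
    have hnil : flat lists G = [] := by
      rw [List.eq_nil_iff_forall_not_mem]
      intro c hc
      have h1 := hlow c hc
      have h2 := hhigh c hc
      rw [add_zero] at h2; omega
    have hc : (x 8).eval w env = 0 := h8.trans (by simp [hnil])
    refine Det.loop_exit hc ⟨⟨T, by omega, hv, hM⟩, fun y => by simp [hnil], tick_le_main ?_ ?_⟩
    · simp [Expr.size]
    · simp [Expr.size]
  | succ f ih =>
    intro k T env M lists hG hT hv h8 hrep hok hpw hlen hM hlow hhigh
    by_cases hnil : flat lists G = []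
    · have hc : (x 8).eval w env = 0 := h8.trans (by simp [hnil])
      refine Det.loop_exit hc ⟨⟨T, by omega, hv, hM⟩, fun y => by simp [hnil],
        tick_le_main ?_ ?_⟩ <;> simp [Expr.size]
    have hpos : 0 < (flat lists G).length := List.length_pos_iff.2 hnil
    have hc : (x 8).eval w env ≠ 0 := by
      have : (x 8).eval w env = _ := h8
      omega
    have hL := hG.L_pos
    have hGp := hl.pos
    refine Runs.loop_step hc (Det.seq (Det.seq ?_))
    refine (reserve_phase hG hl hv hrep hok).mono ?_
    rintro ⟨env₁, M₁⟩ t₁ ⟨henv₁, hM₁, ht₁⟩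
    simp only at henv₁ hM₁
    set S : ℕ → ℕ := fun y => (flat lists G).foldl (resMem n m s b T) M (.aux y) with hSdef
    have hwin : ∀ c ∈ flat lists G, (Win n m s b T S c ↔
        ∀ a ∈ flat lists G, a.i < c.i → ¬ Conf m s b a c) := fun c hc =>
      win_iff hG hok hM (fun _ _ => rfl) hc
    have hv₁ := hv.congr (env' := env₁) fun r hr => henv₁ r (by rintro rfl; simp at hr)
    have hout : ∀ r, r ∉ cells 0 (2 * m) → M₁ r = M r := fun r hr => by
      rw [hM₁]; exact foldl_resMem_of_notMem hG _ _ hok hr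
    have hrep₁ : Rep n m b L G M₁ lists := by
      refine ⟨fun g hg => ?_, fun g hg => ?_, hrep.fit⟩
      · rw [hout _ (by rw [aux_mem_cells]; omega), hrep.cnt g hg]
      · exact (hrep.codes g hg).congr fun y hy _ => hout _ (by rw [aux_mem_cells]; omega)
    refine Det.seq ((commit_phase hG hl hv₁ hrep₁ hok hlen (S := S) (fun y _ => by rw [hM₁])
      fun g hg g' hg' hne => winners_disjoint hok hpw (fun c hc => (hwin c hc).1) hg hg' hne).mono ?_)
    rintro ⟨env₂, M₂⟩ t₂ ⟨henv₂, h8₂, hrep₂, hS₂, harr₂, ht₂⟩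
    simp only at henv₂ h8₂ hrep₂ hS₂ harr₂
    have hlin := hG.lin
    have hv₂ := hv₁.congr (env' := env₂) fun r hr => henv₂ r (by rintro rfl; simp at hr)
    refine Det.set (T + 1) (Expr.eval_add hv₂.h5 (Expr.eval_const (by omega)) (by omega)) ?_
    simp only [State.setVar]
    have hsub : ∀ c ∈ losers n m s b T S (flat lists G), c ∈ flat lists G := fun c hc =>
      List.mem_of_mem_filter hc
    have hk : ∀ c ∈ flat lists G, k < c.z := fun c hc =>
      Nat.lt_two_pow_self.trans_le (hlow c hc)
    have hpot := pot_filter_add_length k (flat lists G) (fun c => ¬ Win n m s b T S c) hk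
    refine (ih (k + 1) (T + 1) _ M₂ (fun g => losers n m s b T S (lists g))
      (hG.setTime (by omega)) (by omega) (hv₂.setTime _) ?_ hrep₂ ?_ ?_ ?_ ?_ ?_ ?_).mono ?_
    · rw [Function.update_of_ne (by decide)]; exact h8₂
    · rw [flat_losers]; exact fun c hc => hok c (hsub c hc)
    · rw [flat_losers]; exact hpw.filter _
    · rw [flat_losers]; exact (List.length_filter_le _ _).trans hlen
    · intro y hy
      rw [hS₂ y hy]
      exact foldl_resMem_lt _ (hM y hy)
    · rw [flat_losers]
      intro c hc
      have hcP := hsub c hc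
      have hcl : ¬ Win n m s b T S c := by
        simpa using (List.mem_filter.1 hc).2
      rw [hwin c hcP] at hcl
      push Not at hcl
      obtain ⟨a, ha, hac, hconf⟩ := hcl
      -- The rival `a` that made `c` lose is itself pending and weighs at least `2 ^ k`, so `c`
      -- weighs more than `2 ^ (k + 1)`.
      have hz : 2 * a.z + 1 ≤ c.z := by
        obtain ⟨t, ht, rfl⟩ := List.getElem_of_mem ha
        obtain ⟨u, hu, rfl⟩ := List.getElem_of_mem hcP
        rw [List.pairwise_iff_getElem] at hpw
        rcases lt_trichotomy t u with h | h | h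
        · exact (hpw t u ht hu h).2 hconf
        · subst h; omega
        · have := (hpw u t hu ht h).1; omega
      have := hlow a ha
      rw [pow_succ]; omega
    · rw [flat_losers]
      intro c hc
      rw [show k + 1 + f = k + (f + 1) by ring]
      exact hhigh c (hsub c hc)
    · rintro ⟨env₃, M₃⟩ t₃ ⟨⟨T', hT', hv₃, hM₃⟩, harr₃, ht₃⟩
      rw [flat_losers] at harr₃ ht₃
      refine ⟨⟨T', by omega, hv₃, hM₃⟩, fun y => ?_, ?_⟩
      · simp only at harr₃ ⊢
        rw [harr₃, harr₂, hout _ (by rintro ⟨_, _, _, h⟩; cases h)]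
        rw [knuth_split (n := n) (m := m) (s := s) (b := b) (T := T) (S := S) (flat lists G)]
        · rfl
        · refine hpw.imp_of_mem fun {a c} ha hc hac hw => ?_
          obtain ⟨h1, h2, h3, h4⟩ := not_conf_disjoint (hok a ha) hac.1
            ((hwin c hc).1 hw a ha hac.1)
          exact swap_commute h1 h2 h3 h4
      -- A round costs 250 per pending item, paid by the drop of the potential, and 1300 per group.
      -- The instructions of the loop itself fit into the remaining 100, as `0 < G`.
      · refine Trace.Le.seq_main (tick_le_main le_rfl le_rfl)
          (Trace.Le.seq_main (Trace.Le.seq_main ht₁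
            (Trace.Le.seq_main ht₂ (tick_le_main le_rfl le_rfl) le_rfl le_rfl) le_rfl le_rfl)
            ht₃ le_rfl le_rfl) ?_ ?_
        · unfold losers
          simp only [Expr.size]
          have : 1400 * G * (f + 1) = 1400 * G * f + 1400 * G := by ring
          omega
        · simp only [Expr.size]
          have : 1600 * L * (f + 1) = 1600 * L * f + 1600 * L := by ring
          omega

end

/-! ### One block, and the loop over the blocks -/

/-- What the block loop needs to know about its parameters. -/
structure Setup (w n m L : ℕ) : Prop where
  m_pos : 1 ≤ m
  m_le : m ≤ n
  L_pos : 1 ≤ L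
  L_le : L ≤ n + 2
  n_le : n ≤ 2 ^ L
  word : 16 * ((n + 1) * (n + 1)) < 2 ^ w

/-- The variables of the main procedure between two blocks. -/
structure LoopVars (env : Fin 18 → ℕ) (n m L s T : ℕ) : Prop where
  h0 : env 0 = n
  h1 : env 1 = m
  h2 : env 2 = L
  h4 : env 4 = s
  h5 : env 5 = T

/-- The length of the block that starts at `s`. -/
def blockLen (n m s : ℕ) : ℕ := min (min s m) (n - s)

/-- The permutation that results from consecutive draws. -/
def drawPerm : ℕ → List ℕ → Equiv.Perm ℕ
  | _, [] => 1
  | s, v :: xs => Equiv.swap s v * drawPerm (s + 1) xs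

theorem drawPerm_append (s : ℕ) (xs ys : List ℕ) :
    drawPerm s (xs ++ ys) = drawPerm s xs * drawPerm (s + xs.length) ys := by
  induction xs generalizing s with
  | nil => simp [drawPerm]
  | cons v xs ih =>
    simp only [List.cons_append, drawPerm, ih, List.length_cons, mul_assoc]
    rw [show s + 1 + xs.length = s + (xs.length + 1) by ring]

section

variable {w n m s b L T G : ℕ}

theorem knuth_itemsAfter (acc : List Item) (i : ℕ) (xs : List ℕ) :
    knuth (itemsAfter m s b acc i xs) = drawPerm i xs := by
  induction xs generalizing acc i with
  | nil => simp [itemsAfter, drawPerm]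
  | cons v xs ih => rw [itemsAfter, knuth_cons, ih, drawPerm]

theorem one_le_z_itemsAfter (acc : List Item) (i : ℕ) (xs : List ℕ) :
    ∀ c ∈ itemsAfter m s b acc i xs, 1 ≤ c.z := by
  induction xs generalizing acc i with
  | nil => simp [itemsAfter]
  | cons v xs ih =>
    intro c hc
    rw [itemsAfter] at hc
    rcases List.mem_cons.1 hc with rfl | hc
    · simp
    · exact ih _ _ c hc

theorem LoopVars.congr {env env' : Fin 18 → ℕ} (h : LoopVars env n m L s T)
    (he : ∀ r : Fin 18, r.val < 6 → env' r = env r) : LoopVars env' n m L s T := by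
  constructor
  · rw [he 0 (by decide), h.h0]
  · rw [he 1 (by decide), h.h1]
  · rw [he 2 (by decide), h.h2]
  · rw [he 4 (by decide), h.h4]
  · rw [he 5 (by decide), h.h5]

/-- Both clippings of the block length, by the space parameter and by the end of the array, have
this shape. -/
theorem cutLength_det {a a' f₀ : ℕ} {e f : Expr 18} {env : Fin 18 → ℕ} {M : Loc → ℕ}
    (hes : e.size ≤ 6) (hfs : f.size ≤ 6) (hv : LoopVars env n m L s T) (h6 : env 6 = a)
    (hf : f.eval w env = a') (he : e.eval w env = if a' < a then 1 else 0) :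
    Det program w n (.ite e (.set 6 f) .skip) ⟨env, M⟩ fun st t =>
      LoopVars st.env n m L s T ∧ st.env 6 = min a a' ∧ st.mem = M ∧
        t.Le (mainCost m f₀ 20 20) := by
  refine Runs.ite (fun h => ?_) fun h => ?_
  · have hlt : a' < a := by
      by_contra hcon
      exact h (he.trans (if_neg hcon))
    refine Det.set a' hf ⟨hv.congr fun r hr => ?_, ?_, rfl,
      Trace.Le.seq_main (tick_le_main le_rfl le_rfl) (tick_le_main le_rfl le_rfl) ?_ ?_⟩
    · simp only [State.setVar]
      rw [Function.update_of_ne (by rintro rfl; simp at hr)]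
    · simp [State.setVar, hlt.le]
    · omega
    · omega
  · have hlt : ¬ a' < a := by
      intro hcon
      have h' := he.symm.trans h
      rw [if_pos hcon] at h'; omega
    refine Sem.shift (Sem.done ⟨hv, ?_, rfl,
      Trace.Le.seq_main (tick_le_main le_rfl le_rfl) (tick_le_main le_rfl le_rfl) ?_ ?_⟩) fun k => rfl
    · exact h6.trans (by omega)
    · omega
    · omega

theorem nextBlock_det (hS : Setup w n m L) (hs : s < n) {env : Fin 18 → ℕ} {M : Loc → ℕ}
    (hv : LoopVars env n m L s T) {f₀ : ℕ} :
    Det program w n nextBlockCom ⟨env, M⟩ fun st t =>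
      MainVars st.env n m L s T (blockLen n m s) ((blockLen n m s + L - 1) / L) ∧ st.mem = M ∧
      t.Le (mainCost m f₀ 60 60) := by
  have hw : 0 < w := by
    rcases Nat.eq_zero_or_pos w with rfl | hw
    · have := hS.word; simp at this
    · exact hw
  have hlin : 16 * (n + 1) < 2 ^ w := by
    have := hS.word
    nlinarith
  have hmn := hS.m_le
  have hLn := hS.L_le
  have hLp := hS.L_pos
  refine Det.seq (Det.set s hv.h4 ?_)
  have hv₁ : LoopVars (Function.update env 6 s) n m L s T := hv.congr fun r hr =>
    Function.update_of_ne (by rintro rfl; simp at hr) _ _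
  have h6₁ : Function.update env 6 s 6 = s := Function.update_self _ _ _
  have h1₁ : (x 1).eval w (Function.update env 6 s) = m := hv₁.h1
  have h6x : (x 6).eval w (Function.update env 6 s) = s := h6₁
  refine Det.seq ((cutLength_det (f₀ := f₀) (M := M) (e := .bin .lt (x 1) (x 6)) (f := x 1)
    (by simp [Expr.size]) (by simp [Expr.size]) hv₁ h6₁ h1₁ (Expr.eval_lt h1₁ h6x hw)).mono ?_)
  rintro ⟨env₂, M₂⟩ t₂ ⟨hv₂, h6₂, hM₂, ht₂⟩
  simp only at hv₂ h6₂ hM₂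
  subst hM₂
  have h3 : (x 0 - x 4 : Expr 18).eval w env₂ = n - s := Expr.eval_sub hv₂.h0 hv₂.h4 (by omega)
  have h6y : (x 6).eval w env₂ = min s m := h6₂
  refine Det.seq ((cutLength_det (f₀ := f₀) (e := .bin .lt (x 0 - x 4) (x 6)) (f := x 0 - x 4)
    (by simp [Expr.size]) (by simp [Expr.size]) hv₂ h6₂ h3 (Expr.eval_lt h3 h6y hw)).mono ?_)
  rintro ⟨env₃, M₃⟩ t₃ ⟨hv₃, h6₃, hM₃, ht₃⟩
  simp only at hv₃ h6₃ hM₃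
  subst hM₃
  have hb : blockLen n m s = min (min s m) (n - s) := rfl
  rw [← hb] at h6₃
  have hble : blockLen n m s + L - 1 ≤ blockLen n m s + L := Nat.sub_le _ _
  have hdiv : (blockLen n m s + L - 1) / L ≤ blockLen n m s + L := (Nat.div_le_self _ _).trans hble
  refine Det.set ((blockLen n m s + L - 1) / L) (Expr.eval_div (Expr.eval_sub (Expr.eval_add h6₃ hv₃.h2
    (by omega)) (Expr.eval_const (by omega)) (by omega)) hv₃.h2 (by omega)) ⟨?_, rfl, ?_⟩
  · constructor
    · simp only [State.setVar]; rw [Function.update_of_ne (by decide), hv₃.h0]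
    · simp only [State.setVar]; rw [Function.update_of_ne (by decide), hv₃.h1]
    · simp only [State.setVar]; rw [Function.update_of_ne (by decide), hv₃.h2]
    · simp only [State.setVar]; rw [Function.update_of_ne (by decide), hv₃.h4]
    · simp only [State.setVar]; rw [Function.update_of_ne (by decide), hv₃.h5]
    · simp only [State.setVar]; rw [Function.update_of_ne (by decide), h6₃]
    · simp [State.setVar]
  · refine Trace.Le.seq_main (tick_le_main le_rfl le_rfl) (Trace.Le.seq_main ht₂
      (Trace.Le.seq_main ht₃ (tick_le_main le_rfl le_rfl) le_rfl le_rfl) le_rfl le_rfl) ?_ ?_ <;>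
    simp [Expr.size]

/-- Up to constants, the left side is the total overhead of the rounds for `G` groups. If `log W ≤ 2
* L`, it is bounded through `G * L ≤ b + L`. Otherwise `W` is so large that `log W ≤ 2 * 2 ^ (log W
- L)`, and with `G ≤ 2 ^ L` the product is at most `2 * W`. -/
theorem groups_mul_log_le {b L G W : ℕ} (hn : b ≤ 2 ^ L) (hG : G * L ≤ b + L) (hGb : G ≤ b)
    (hW : W ≠ 0) : G * Nat.log 2 W ≤ 2 * (b + L) + 2 * W := by
  set l := Nat.log 2 W with hl
  have hpow : 2 ^ l ≤ W := Nat.pow_log_le_self 2 hW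
  rcases le_or_gt l (2 * L) with h | h
  · have : G * l ≤ G * (2 * L) := Nat.mul_le_mul_left _ h
    nlinarith
  · have h1 : l ≤ 2 * 2 ^ (l - L) := by
      have := (Nat.lt_two_pow_self (n := l - L))
      omega
    calc G * l ≤ 2 ^ L * (2 * 2 ^ (l - L)) := Nat.mul_le_mul (hGb.trans hn) h1
      _ = 2 * 2 ^ (L + (l - L)) := by rw [pow_add]; ring
      _ = 2 * 2 ^ l := by rw [Nat.add_sub_cancel' (by omega)]
      _ ≤ _ := by omega

theorem layout (hn : n ≤ 2 ^ L) (hL : 1 ≤ L) (hb : 1 ≤ b) : Layout n b L ((b + L - 1) / L) := by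
  refine ⟨Nat.div_pos (by omega) hL, fun g hg => ?_, ?_, hn⟩
  · have := (Nat.le_div_iff_mul_le hL).1 (Nat.succ_le_of_lt hg)
    rw [Nat.succ_mul] at this; omega
  · have := Nat.lt_div_mul_add (a := b + L - 1) hL
    omega

/-- A block of length `b` takes at most `2 * b` rounds, which preserves `T + 1 ≤ 2 * s`. So the time
stays linear in `n` although it is never reset, and old stamps in the slots stay harmless. -/
theorem block_runs (hS : Setup w n m L) (hs : 1 ≤ s) (hsn : s < n) (hb : b = blockLen n m s)
    {env : Fin 18 → ℕ} {M : Loc → ℕ} (hv : LoopVars env n m L s T) (hT : T + 1 ≤ 2 * s)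
    (hM : ∀ y < 2 * m, M (.aux y) < T * (n + 1)) :
    Runs program w n
      (.seq nextBlockCom <| .seq (.call 8 0 (sweepArgs 0)) <| .seq settleLoop <|
        .set 4 (x 4 + x 6)) ⟨env, M⟩ (draws s b) fun xs st t =>
      (∃ T', LoopVars st.env n m L (s + b) T' ∧ T' + 1 ≤ 2 * (s + b) ∧
        ∀ y < 2 * m, st.mem (.aux y) < T' * (n + 1)) ∧
      (∀ y, st.mem (.arr y) = M (.arr (drawPerm s xs y))) ∧
      t.Le (mainCost m (L + 1) (10000 * (b + L + weight (itemsOf m s b xs)))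
        (5000 * (L * (Nat.log 2 (weight (itemsOf m s b xs)) + 1)))) := by
  have hb1 : 1 ≤ b := by have := hS.m_pos; unfold blockLen at hb; omega
  have hmn := hS.m_le
  have hLp := hS.L_pos
  have hG : Geom w n m s b L T := ⟨hs, hb1, by unfold blockLen at hb; omega,
    by unfold blockLen at hb; omega, by unfold blockLen at hb; omega, hS.m_le, hS.L_pos, hS.L_le,
    by omega, hS.word⟩
  have hsb := hG.sb_le
  have hl := layout hS.n_le hS.L_pos hb1
  have hlin := hG.lin
  refine Runs.seq_left ((nextBlock_det hS hsn hv (f₀ := L + 1)).mono ?_)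
  rintro ⟨env₁, M₁⟩ t₁ ⟨hv₁, hM₁, ht₁⟩
  simp only at hv₁ hM₁
  subst hM₁
  rw [← hb] at hv₁
  set G := (b + L - 1) / L with hGdef
  have hGL : G * L ≤ b + L := by
    have := Nat.div_mul_le_self (b + L - 1) L
    rw [← hGdef] at this
    omega
  have hGb := hl.G_le hLp
  refine Runs.seq_right ((draw_phase hG hl hv₁).mono ?_)
  rintro xs ⟨env₂, M₂⟩ t₂ hxs ⟨henv₂, h8, hrep, hslots, harr, ht₂⟩
  simp only at henv₂ h8 hrep hslots harr
  set P := itemsOf m s b xs with hP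
  have hlenP : P.length = b := by
    rw [hP, itemsOf, itemsAfter_length, (mem_support_draws hxs).1]
  have hflat : flat (chunk L P) G = P := by
    rw [flat_chunk, List.take_of_length_le (by rw [hlenP]; exact hl.le)]
  have hz1 : ∀ c ∈ P, 1 ≤ c.z := one_le_z_itemsAfter _ _ _
  have hW0 : weight P ≠ 0 := by
    have : 0 < P.length := by omega
    obtain ⟨a, ha⟩ := List.exists_mem_of_length_pos this
    have h1 := hz1 a ha
    have h2 := le_weight ha
    omega
  set f := Nat.log 2 (weight P) + 1 with hf
  have hWlt : weight P < 2 ^ f := Nat.lt_pow_succ_log_self (by norm_num) _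
  -- From `weight P + 1 ≤ 3 ^ b ≤ 4 ^ b`.
  have hf2 : f ≤ 2 * b := by
    have h1 := weight_itemsAfter_le (m := m) (s := s) (b := b) [] s xs
    rw [weight_nil, (mem_support_draws hxs).1] at h1
    have h2 : weight P < 2 ^ (2 * b) := by
      have h3 : 3 ^ b ≤ 4 ^ b := Nat.pow_le_pow_left (by norm_num) b
      rw [pow_mul]
      change _ + weight P + 1 ≤ _ at h1
      norm_num
      omega
    have := Nat.log_lt_of_lt_pow hW0 h2
    omega
  have hpot : pot 0 P = weight P := by simp [pot, weight]
  -- All weights lie between `1 = 2 ^ 0` and `2 ^ f`, so `f` rounds suffice.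
  refine Det.seq ((settle_det hl f 0 T env₂ M₂ (chunk L P) hG (by omega)
    (hv₁.congr fun r hr => henv₂ r (by rintro rfl; simp at hr)) (by rw [hflat, hlenP]; exact h8)
    hrep (by rw [hflat]; exact itemsOf_ok hxs) ?_ (by rw [hflat, hlenP])
    (fun y hy => by rw [hslots y hy]; exact hM y hy) (by rw [hflat]; simpa using hz1) ?_).mono ?_)
  · rw [hflat]
    have := itemsAfter_pairwise (m := m) (s := s) (b := b) [] s xs List.Pairwise.nil (by simp)
    rwa [List.nil_append] at this
  · rw [hflat, zero_add]
    exact fun c hc => (le_weight hc).trans_lt hWlt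
  rintro ⟨env₃, M₃⟩ t₃ ⟨⟨T', hT', hv₃, hM₃⟩, harr₃, ht₃⟩
  simp only at hv₃ hM₃ harr₃
  rw [hflat] at harr₃ ht₃
  rw [hpot] at ht₃
  refine Det.set (s + b) (Expr.eval_add hv₃.h4 hv₃.h6 (by omega)) ⟨⟨T', ?_, by omega, hM₃⟩, ?_, ?_⟩
  · constructor
    · simp only [State.setVar]; rw [Function.update_of_ne (by decide), hv₃.h0]
    · simp only [State.setVar]; rw [Function.update_of_ne (by decide), hv₃.h1]
    · simp only [State.setVar]; rw [Function.update_of_ne (by decide), hv₃.h2]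
    · simp [State.setVar]
    · simp only [State.setVar]; rw [Function.update_of_ne (by decide), hv₃.h5]
  · intro y
    simp only [State.setVar]
    rw [harr₃, harr, hP, itemsOf, knuth_itemsAfter]
  · have h1 := groups_mul_log_le (hG.sb_le.trans hS.n_le |> (Nat.le_add_left b s).trans) hGL hGb hW0
    have h2 : 1400 * G * f = 1400 * (G * Nat.log 2 (weight P)) + 1400 * G := by rw [hf]; ring
    have h3 : 1600 * L * f = 1600 * (L * f) := by ring
    have h4 : L ≤ L * f := Nat.le_mul_of_pos_right _ (by omega)
    refine Trace.Le.seq_main ht₁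
      (Trace.Le.seq_main ht₂ (Trace.Le.seq_main ht₃ (tick_le_main le_rfl le_rfl) le_rfl le_rfl)
        le_rfl le_rfl) ?_ ?_
    · simp only [Expr.size]
      omega
    · simp only [Expr.size]
      omega

/-- The sum of the weights of all items, in at most `k` blocks. -/
def totalWeight (n m : ℕ) : ℕ → ℕ → List ℕ → ℕ
  | 0, _, _ => 0
  | k + 1, s, xs => if s < n then
      weight (itemsOf m s (blockLen n m s) (xs.take (blockLen n m s))) +
        totalWeight n m k (s + blockLen n m s) (xs.drop (blockLen n m s))
    else 0

/-- The number of blocks, up to `k`. -/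
def blockCount (n m : ℕ) : ℕ → ℕ → ℕ
  | 0, _ => 0
  | k + 1, s => if s < n then blockCount n m k (s + blockLen n m s) + 1 else 0

/-- The work adds up the block weights. For the span, the logarithm of each block weight is replaced
by that of the total weight, so that this one quantity controls both bounds. -/
theorem blockLoop_runs (hS : Setup w n m L) (k : ℕ) :
    ∀ (s T : ℕ) (env : Fin 18 → ℕ) (M : Loc → ℕ), n - s ≤ k → 1 ≤ s → LoopVars env n m L s T →
      T + 1 ≤ 2 * s → (∀ y < 2 * m, M (.aux y) < T * (n + 1)) →
      Runs program w n blockLoop ⟨env, M⟩ (draws s (n - s)) fun xs st t =>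
        (∀ y, st.mem (.arr y) = M (.arr (drawPerm s xs y))) ∧
        t.Le (mainCost m (L + 1)
          (10010 * (n - s + L * blockCount n m k s + totalWeight n m k s xs) + 10)
          (5010 * (L * (Nat.log 2 (totalWeight n m k s xs) + 1) * blockCount n m k s) + 10)) := by
  have hw : 0 < w := by
    rcases Nat.eq_zero_or_pos w with rfl | hw
    · have := hS.word; simp at this
    · exact hw
  have hLp := hS.L_pos
  have hexit : ∀ (k s T : ℕ) (env : Fin 18 → ℕ) (M : Loc → ℕ), n ≤ s → LoopVars env n m L s T →
      Runs program w n blockLoop ⟨env, M⟩ (draws s (n - s)) fun xs st t =>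
        (∀ y, st.mem (.arr y) = M (.arr (drawPerm s xs y))) ∧
        t.Le (mainCost m (L + 1)
          (10010 * (n - s + L * blockCount n m k s + totalWeight n m k s xs) + 10)
          (5010 * (L * (Nat.log 2 (totalWeight n m k s xs) + 1) * blockCount n m k s) + 10)) := by
    intro k s T env M hs hv
    have h4 : (x 4).eval w env = s := hv.h4
    have h0 : (x 0).eval w env = n := hv.h0
    rw [Nat.sub_eq_zero_of_le hs]
    refine Det.runs (Q := fun st t => st.mem = M ∧ t = .tick 4) [] (Det.loop_exit
      ((Expr.eval_lt h4 h0 hw).trans (if_neg hs.not_gt)) ⟨rfl, rfl⟩) ?_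
    rintro st t ⟨h1, rfl⟩
    refine ⟨fun y => by simp [h1, drawPerm], tick_le_main ?_ ?_⟩ <;> omega
  induction k with
  | zero =>
    intro s T env M hk hs hv _ _
    exact hexit _ _ _ _ _ (by omega) hv
  | succ k ih =>
    intro s T env M hk hs hv hT hM
    rcases Nat.lt_or_ge s n with hsn | hsn
    swap
    · exact hexit _ _ _ _ _ hsn hv
    have h4 : (x 4).eval w env = s := hv.h4
    have h0 : (x 0).eval w env = n := hv.h0
    set b := blockLen n m s with hb
    have hb1 : 1 ≤ b := by have := hS.m_pos; unfold blockLen at hb; omega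
    have hbn : b ≤ n - s := by unfold blockLen at hb; omega
    have hsplit : n - s = b + (n - (s + b)) := by omega
    rw [hsplit, draws_add]
    refine Runs.loop_step (by rw [Expr.eval_lt h4 h0 hw, if_pos hsn]; exact one_ne_zero)
      (Runs.seq _ ((block_runs hS hs hsn hb hv hT hM).mono ?_))
    rintro xs ⟨env₁, M₁⟩ t₁ hxs ⟨⟨T', hv₁, hT', hM₁⟩, harr₁, ht₁⟩
    simp only at hv₁ hM₁ harr₁
    refine (ih (s + b) T' env₁ M₁ (by omega) (by omega) hv₁ hT' hM₁).mono ?_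
    rintro ys st t₂ - ⟨harr₂, ht₂⟩
    have hlen := (mem_support_draws hxs).1
    have e1 : totalWeight n m (k + 1) s (xs ++ ys) =
        weight (itemsOf m s b xs) + totalWeight n m k (s + b) ys := by
      rw [totalWeight, if_pos hsn, ← hb, List.take_left' hlen, List.drop_left' hlen]
    have e2 : blockCount n m (k + 1) s = blockCount n m k (s + b) + 1 := by
      rw [blockCount, if_pos hsn]
    refine ⟨fun y => ?_, ?_⟩
    · rw [harr₂, harr₁, drawPerm_append, hlen]; rfl
    · rw [e1, e2]
      set W := weight (itemsOf m s b xs)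
      set W' := totalWeight n m k (s + b) ys
      have l1 : Nat.log 2 W ≤ Nat.log 2 (W + W') := Nat.log_mono_right (by omega)
      have l2 : Nat.log 2 W' ≤ Nat.log 2 (W + W') := Nat.log_mono_right (by omega)
      have m1 : L * (Nat.log 2 W + 1) ≤ L * (Nat.log 2 (W + W') + 1) :=
        Nat.mul_le_mul_left _ (by omega)
      have m2 : L * (Nat.log 2 W' + 1) * blockCount n m k (s + b) ≤
          L * (Nat.log 2 (W + W') + 1) * blockCount n m k (s + b) :=
        Nat.mul_le_mul_right _ (Nat.mul_le_mul_left _ (by omega))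
      have m3 : 1 ≤ L * (Nat.log 2 (W + W') + 1) := Nat.mul_pos hLp (by omega)
      refine Trace.Le.seq_main (tick_le_main le_rfl le_rfl)
        (Trace.Le.seq_main ht₁ ht₂ le_rfl le_rfl) ?_ ?_
      · simp only [Expr.size, mul_add, mul_one]
        omega
      · simp only [Expr.size]
        rw [mul_add (L * _), mul_one]
        omega

end

end Shuffle

end ForkJoin

end

noncomputable section

namespace ForkJoin

/-! ### Expectations of discrete distributions -/

/-- The expectation of a nonnegative function. -/
def expect {α : Type} (p : PMF α) (g : α → ENNReal) : ENNReal := ∑' x, p x * g x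

section

open scoped ENNReal

variable {α β : Type}

theorem expect_bind (p : PMF α) (q : α → PMF β) (g : β → ENNReal) :
    expect (p.bind q) g = expect p fun x => expect (q x) g := by
  simp only [expect, PMF.bind_apply, ← ENNReal.tsum_mul_right, ← ENNReal.tsum_mul_left]
  rw [ENNReal.tsum_comm]
  simp only [mul_assoc]

theorem expect_pure (x : α) (g : α → ENNReal) : expect (PMF.pure x) g = g x := by
  rw [expect, tsum_eq_single x]
  · simp
  · intro y hy; simp [hy]

theorem expect_map (p : PMF α) (f : α → β) (g : β → ENNReal) :
    expect (p.map f) g = expect p fun x => g (f x) := by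
  rw [PMF.map, expect_bind]
  simp only [Function.comp_apply, expect_pure]

theorem expect_mono {p : PMF α} {g g' : α → ENNReal} (h : ∀ x ∈ p.support, g x ≤ g' x) :
    expect p g ≤ expect p g' := by
  refine ENNReal.tsum_le_tsum fun x => ?_
  by_cases hx : p x = 0
  · simp [hx]
  · exact mul_le_mul_right (h x ((PMF.mem_support_iff _ _).2 hx)) _

theorem expect_add (p : PMF α) (g g' : α → ENNReal) :
    expect p (fun x => g x + g' x) = expect p g + expect p g' := by
  simp only [expect, mul_add, ENNReal.tsum_add]

theorem expect_mul_left (p : PMF α) (c : ENNReal) (g : α → ENNReal) :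
    expect p (fun x => c * g x) = c * expect p g := by
  simp only [expect, ← ENNReal.tsum_mul_left]
  exact tsum_congr fun x => by ring

theorem expect_const (p : PMF α) (c : ENNReal) : expect p (fun _ => c) = c := by
  simp only [expect, ENNReal.tsum_mul_right, p.tsum_coe, one_mul]

/-- Markov's inequality. -/
theorem one_sub_le_of_expect_le {p : PMF α} {g : α → ENNReal} {a E : ENNReal} (ha : a ≠ 0)
    (ha' : a ≠ ∞) (h : expect p g ≤ E) : 1 - E / a ≤ p.toOuterMeasure {x | g x ≤ a} := by
  classical
  rw [tsub_le_iff_right]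
  have h1 : (1 : ENNReal) = p.toOuterMeasure {x | g x ≤ a} + p.toOuterMeasure {x | g x ≤ a}ᶜ := by
    rw [PMF.toOuterMeasure_apply, PMF.toOuterMeasure_apply, ← ENNReal.tsum_add, ← p.tsum_coe]
    exact tsum_congr fun x => (congr_fun (Set.indicator_self_add_compl _ _) x).symm
  rw [h1]
  gcongr
  rw [ENNReal.le_div_iff_mul_le (Or.inl ha) (Or.inl ha'), PMF.toOuterMeasure_apply,
    ← ENNReal.tsum_mul_right]
  refine le_trans (ENNReal.tsum_le_tsum fun x => ?_) h
  by_cases hx : g x ≤ a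
  · rw [Set.indicator_of_notMem (by simpa using hx), zero_mul]; exact zero_le
  · rw [Set.indicator_of_mem (by simpa using hx)]
    gcongr
    exact (not_le.1 hx).le

end

/-! ### The law of a program -/

theorem Outcome.andThen_mono {V : ℕ} {m m' : Outcome V} {f f' : State V → Trace → Outcome V}
    (h : ∀ r, m (some r) ≤ m' (some r)) (h' : ∀ s t r, f s t (some r) ≤ f' s t (some r))
    (r : State V × Trace) : m.andThen f (some r) ≤ m'.andThen f' (some r) := by
  simp only [Outcome.andThen, PMF.bind_apply]
  refine ENNReal.tsum_le_tsum fun o => ?_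
  rcases o with _ | ⟨s, t⟩
  · simp [Outcome.fail]
  · exact mul_le_mul' (h _) (h' s t r)

/-- Additional fuel only moves mass from `none` to terminated outcomes, so the supremum in
`Program.law` is a limit. -/
theorem exec_mono (P : Program) (w n k : ℕ) :
    ∀ (c : Com P.V P.K) (s : State P.V) (r : State P.V × Trace),
      exec P w n k c s (some r) ≤ exec P w n (k + 1) c s (some r) := by
  induction k with
  | zero => intro c s r; simp [exec, Outcome.fail]
  | succ k ih =>
    intro c s r
    cases c with
    | skip => exact le_rfl
    | set => exact le_rfl
    | rand => exact le_rfl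
    | load => exact le_rfl
    | store => exact le_rfl
    | storeMax => exact le_rfl
    | seq c d =>
      exact Outcome.andThen_mono (ih c s)
        (fun s₁ t₁ => Outcome.andThen_mono (ih d s₁) fun _ _ _ => le_rfl) r
    | ite e c d => exact Outcome.andThen_mono (ih _ _) (fun _ _ _ => le_rfl) r
    | loop e c =>
      rw [exec, exec]
      split_ifs
      · exact le_rfl
      · exact Outcome.andThen_mono (ih _ _) (fun _ _ _ => le_rfl) r
    | call x f as => exact Outcome.andThen_mono (ih _ _) (fun _ _ _ => le_rfl) r
    | par x f as y g bs =>
      exact Outcome.andThen_mono (ih _ _)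
        (fun _ _ => Outcome.andThen_mono (ih _ _) fun _ _ _ => le_rfl) r

/-- The command `c` of the main procedure, run on the input. -/
abbrev Program.MainRuns (P : Program) {n : ℕ} (m : ℕ) (a : Fin n → ℕ) {α : Type} (p : PMF α)
    (Q : α → State P.V → Trace → Prop) : Prop :=
  Runs P (P.wordBits n) n (P.body P.main) (P.init m a) p Q

namespace Program.MainRuns

variable {P : Program} {n m : ℕ} {a : Fin n → ℕ} {α : Type} {p : PMF α}
  {Q : α → State P.V → Trace → Prop}

/-- The probabilities are monotone in the fuel and constant from `K` on, so their supremum is the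
value at `K`. -/
theorem exists_coupling (h : P.MainRuns m a p Q) :
    ∃ μ : PMF (α × State P.V × Trace), μ.map Prod.fst = p ∧ (∀ r, P.law m a r = μ.map Prod.snd r) ∧
      ∀ z ∈ μ.support, Q z.1 z.2.1 z.2.2 := by
  obtain ⟨μ, -, hp, ⟨K, hK⟩, hμ⟩ := h
  refine ⟨μ, hp, fun r => ?_, hμ⟩
  have hmono : Monotone fun k => exec P (P.wordBits n) n k (P.body P.main) (P.init m a) (some r) :=
    monotone_nat_of_le_succ fun k => exec_mono P _ _ k _ _ r
  have hval : ∀ k, K ≤ k → exec P (P.wordBits n) n k (P.body P.main) (P.init m a) (some r) =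
      μ.map Prod.snd r := by
    intro k hk
    rw [show exec P (P.wordBits n) n k (P.body P.main) (P.init m a) = _ from hK k hk]
    change (μ.map (some ∘ Prod.snd)) (some r) = _
    rw [← PMF.map_comp]
    classical
    rw [PMF.map_apply]
    simp only [Option.some.injEq]
    rw [tsum_ite_eq']
  refine le_antisymm (iSup_le fun k => ?_) ?_
  · exact (hmono (le_max_left k K)).trans (hval _ (le_max_right k K)).le
  · rw [← hval K le_rfl]
    exact le_iSup (fun k => exec P (P.wordBits n) n k (P.body P.main) (P.init m a) (some r)) K

theorem prob_eq_toOuterMeasure {μ : PMF (α × State P.V × Trace)}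
    (hμ : ∀ r, P.law m a r = μ.map Prod.snd r) (S : Set (State P.V × Trace)) :
    P.prob m a S = μ.toOuterMeasure (Prod.snd ⁻¹' S) := by
  rw [← PMF.toOuterMeasure_map_apply, PMF.toOuterMeasure_apply, Program.prob, tsum_subtype]
  exact tsum_congr fun r => by simp only [Set.indicator, hμ]

theorem prob_univ (h : P.MainRuns m a p Q) : P.prob m a Set.univ = 1 := by
  obtain ⟨μ, -, hμ, -⟩ := h.exists_coupling
  rw [prob_eq_toOuterMeasure hμ, PMF.toOuterMeasure_apply_eq_one_iff]
  exact fun _ _ => trivial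

/-- A pathwise implication from the ghost variable to the final state and trace transfers
probabilities from `p` to the program. -/
theorem le_prob (h : P.MainRuns m a p Q) {A : Set α} {S : Set (State P.V × Trace)}
    (hA : ∀ x s t, Q x s t → x ∈ A → (s, t) ∈ S) : p.toOuterMeasure A ≤ P.prob m a S := by
  obtain ⟨μ, rfl, hμ, hQ⟩ := h.exists_coupling
  rw [prob_eq_toOuterMeasure hμ, PMF.toOuterMeasure_map_apply]
  exact PMF.toOuterMeasure_mono _ fun z hz => hA _ _ _ (hQ z hz.2) hz.1

theorem prob_eq (h : P.MainRuns m a p Q) {A : Set α} {S : Set (State P.V × Trace)}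
    (hA : ∀ x s t, Q x s t → (x ∈ A ↔ (s, t) ∈ S)) : P.prob m a S = p.toOuterMeasure A := by
  obtain ⟨μ, rfl, hμ, hQ⟩ := h.exists_coupling
  rw [prob_eq_toOuterMeasure hμ, PMF.toOuterMeasure_map_apply]
  exact le_antisymm
    (PMF.toOuterMeasure_mono _ fun z hz => (hA _ _ _ (hQ z hz.2)).2 hz.1)
    (PMF.toOuterMeasure_mono _ fun z hz => (hA _ _ _ (hQ z hz.2)).1 hz.1)

theorem expectedWork_le (h : P.MainRuns m a p Q) {g : α → ENNReal}
    (hg : ∀ x s t, Q x s t → (t.work : ENNReal) ≤ g x) : P.expectedWork m a ≤ expect p g := by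
  have h1 := h.prob_univ
  obtain ⟨μ, rfl, hμ, hQ⟩ := h.exists_coupling
  -- Termination has probability one, so the infinite penalty has the factor zero.
  rw [Program.expectedWork, h1, tsub_self, zero_mul, add_zero]
  simp only [hμ]
  change expect (μ.map Prod.snd) (fun r => (r.2.work : ENNReal)) ≤ _
  rw [expect_map, expect_map]
  exact expect_mono fun z hz => hg _ _ _ (hQ z hz)

theorem exists_of_law_ne_zero (h : P.MainRuns m a p Q) {r : State P.V × Trace}
    (hr : P.law m a r ≠ 0) : ∃ x, Q x r.1 r.2 := by
  obtain ⟨μ, -, hμ, hQ⟩ := h.exists_coupling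
  rw [hμ, ← PMF.mem_support_iff, PMF.support_map] at hr
  obtain ⟨z, hz, rfl⟩ := hr
  exact ⟨z.1, hQ z hz⟩

end Program.MainRuns

/-! ### The main procedure -/

namespace Shuffle

section

variable {w n m L : ℕ}

/-- The first two bounds on `k` say that it has exactly `j` binary digits; written with `2 * k + 1`,
the lower bound also covers `k = 0`. -/
theorem lengthLoop_det {f₀ : ℕ} (hw : 2 < 2 ^ w) (j : ℕ) :
    ∀ (k c : ℕ) (env : Fin 18 → ℕ) (M : Loc → ℕ), k < 2 ^ j → 2 ^ j ≤ 2 * k + 1 → env 3 = k →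
      env 2 = c → k < 2 ^ w → c + j < 2 ^ w →
      Det program w n (.loop (x 3) (.seq (.set 3 (x 3 / .const 2)) (.set 2 (x 2 + .const 1))))
        ⟨env, M⟩ fun st t => (∀ r, r ≠ 2 → r ≠ 3 → st.env r = env r) ∧ st.env 2 = c + j ∧
          st.mem = M ∧ t.Le (mainCost m f₀ (10 * j + 2) (10 * j + 2)) := by
  induction j with
  | zero =>
    intro k c env M h1 h2 h3 h4 _ _
    have hk : k = 0 := by omega
    exact Det.loop_exit (h3.trans hk) ⟨fun _ _ _ => rfl, h4, rfl, tick_le_main (by simp [Expr.size])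
      (by simp [Expr.size])⟩
  | succ j ih =>
    intro k c env M h1 h2 h3 h4 hk hc
    rw [pow_succ] at h1 h2
    have hpos : 0 < 2 ^ j := by positivity
    have hx3 : (x 3).eval w env = k := h3
    have h2' : 2 ^ j ≤ 2 * (k / 2) + 1 := by
      rcases j with _ | j
      · simp
      · rw [pow_succ] at h2 ⊢; omega
    refine Runs.loop_step (by rw [hx3]; omega) (Det.seq (Det.seq
      (Det.set (k / 2) (Expr.eval_div hx3 (Expr.eval_const hw) hk)
      (Det.set (c + 1) (Expr.eval_add (show (x 2).eval w _ = c from ?_) (Expr.eval_const (by omega))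
        (by omega)) ?_))))
    · change Function.update env 3 (k / 2) 2 = c
      rw [Function.update_of_ne (by decide), h4]
    · refine (ih (k / 2) (c + 1) _ M (by omega) h2' ?_ ?_ (by omega) (by omega)).mono ?_
      · simp only [State.setVar]; rw [Function.update_of_ne (by decide), Function.update_self]
      · simp [State.setVar]
      · rintro st t ⟨g1, g2, g3, g4⟩
        refine ⟨fun r hr hr' => ?_, by omega, g3, ?_⟩
        · rw [g1 r hr hr']
          simp only [State.setVar]
          rw [Function.update_of_ne hr, Function.update_of_ne hr']
        · refine Trace.Le.seq_main (tick_le_main le_rfl le_rfl)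
            (Trace.Le.seq_main (Trace.Le.seq_main (tick_le_main le_rfl le_rfl)
              (tick_le_main le_rfl le_rfl) le_rfl le_rfl) g4 le_rfl le_rfl) ?_ ?_ <;>
          · simp only [Expr.size_div, Expr.size]
            omega

/-- The right side is the eighth power of a number `q ≥ n + 1`, `q ≥ 2`. Two of the factors dominate
`(n + 1) * (n + 1)`, the other six contribute at least 64. -/
theorem word_lt (n : ℕ) : 16 * ((n + 1) * (n + 1)) < 2 ^ program.wordBits n := by
  have h : n + 1 ≤ 2 ^ (Nat.log 2 n + 1) := Nat.lt_pow_succ_log_self (by norm_num) n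
  have h2 : 2 ^ program.wordBits n = (2 ^ (Nat.log 2 n + 1)) ^ 8 := by
    rw [← pow_mul, mul_comm]; rfl
  have h3 : 2 ≤ 2 ^ (Nat.log 2 n + 1) := by
    rw [pow_succ]; have : 0 < 2 ^ Nat.log 2 n := by positivity
    omega
  rw [h2]
  set q := 2 ^ (Nat.log 2 n + 1)
  have h4 : 64 ≤ q ^ 6 := by
    calc 64 = 2 ^ 6 := by norm_num
      _ ≤ _ := Nat.pow_le_pow_left h3 6
  have h5 : (n + 1) * (n + 1) ≤ q * q := Nat.mul_le_mul h h
  have h6 : 0 < q * q := by positivity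
  calc 16 * ((n + 1) * (n + 1)) ≤ 16 * (q * q) := by omega
    _ < 64 * (q * q) := by omega
    _ ≤ q ^ 6 * (q * q) := Nat.mul_le_mul_right _ h4
    _ = q ^ 8 := by ring

/-- The computed group length `log n + 2` makes `n ≤ 2 ^ L`, so a fork tree over the groups of a
block has depth at most `L`, with one more frame for the call from the main procedure. -/
theorem main_runs (hn : 1 ≤ n) (hm : 1 ≤ m) (hmn : m ≤ n) (a : Fin n → ℕ) :
    program.MainRuns m a (draws 1 (n - 1)) fun xs st t =>
      (∀ y, st.mem (.arr y) = (program.init m a).mem (.arr (drawPerm 1 xs y))) ∧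
      t.Le (mainCost m (Nat.log 2 n + 3)
        (10100 * (n + (Nat.log 2 n + 2) * (blockCount n m n 1 + 1) + totalWeight n m n 1 xs))
        (5100 * ((Nat.log 2 n + 2) * (Nat.log 2 (totalWeight n m n 1 xs) + 1) *
          (blockCount n m n 1 + 1)))) := by
  have hword := word_lt n
  set w := program.wordBits n with hwdef
  have hlin : 16 * (n + 1) < 2 ^ w := by nlinarith
  set l := Nat.log 2 n with hl
  have hl1 : 2 ^ l ≤ n := Nat.pow_log_le_self 2 (by omega)
  have hl2 : n < 2 ^ (l + 1) := Nat.lt_pow_succ_log_self (by norm_num) n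
  have hl3 : l < n := Nat.lt_two_pow_self.trans_le hl1
  have hS : Setup w n m (l + 2) := ⟨hm, hmn, by omega, by omega, by rw [pow_succ] at hl2 ⊢; omega, hword⟩
  have hLrun : Det program w n lengthCom (program.init m a) fun st t =>
      (∀ r, r ≠ 2 → r ≠ 3 → st.env r = (program.init m a).env r) ∧ st.env 2 = l + 2 ∧
        st.mem = (program.init m a).mem ∧
        t.Le (mainCost m (l + 3) (20 * (l + 2)) (20 * (l + 2))) := by
    refine Det.seq (Det.set 1 (Expr.eval_const (by omega)) (Det.seq (Det.set n ?_ ?_)))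
    · change Function.update (program.init m a).env 2 1 0 = n
      rw [Function.update_of_ne (by decide)]; rfl
    · refine (lengthLoop_det (m := m) (f₀ := l + 3) (by omega) (l + 1) n 1 _ _ hl2
        (by rw [pow_succ]; omega) ?_ ?_ (by omega) (by omega)).mono ?_
      · simp [State.setVar]
      · simp only [State.setVar]; rw [Function.update_of_ne (by decide), Function.update_self]
      · rintro st t ⟨g1, g2, g3, g4⟩
        refine ⟨fun r hr hr' => ?_, by omega, g3, ?_⟩
        · rw [g1 r hr hr']
          simp only [State.setVar]
          rw [Function.update_of_ne hr', Function.update_of_ne hr]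
        · refine Trace.Le.seq_main (tick_le_main le_rfl le_rfl)
            (Trace.Le.seq_main (tick_le_main le_rfl le_rfl) g4 le_rfl le_rfl) ?_ ?_ <;>
          · simp only [Expr.size]
            omega
  refine Runs.seq_left (hLrun.mono ?_)
  rintro ⟨env₁, M₁⟩ t₁ ⟨henv, h2, hM, ht₁⟩
  simp only at henv h2 hM
  have hone : 1 < 2 ^ program.wordBits n := by
    change 1 < 2 ^ w
    omega
  refine Runs.seq_left (Det.set 1 (Expr.eval_const hone) (Runs.seq_left
    (Det.set 1 (Expr.eval_const hone) ?_)))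
  refine (blockLoop_runs hS n 1 1 _ M₁ (by omega) le_rfl ?_ (by omega) ?_).mono ?_
  · constructor
    · simp only [State.setVar]
      rw [Function.update_of_ne (by decide), Function.update_of_ne (by decide),
        henv _ (by decide) (by decide)]; rfl
    · simp only [State.setVar]
      rw [Function.update_of_ne (by decide), Function.update_of_ne (by decide),
        henv _ (by decide) (by decide)]; rfl
    · simp only [State.setVar]
      rw [Function.update_of_ne (by decide), Function.update_of_ne (by decide), h2]
    · simp only [State.setVar]; rw [Function.update_of_ne (by decide), Function.update_self]
    · simp [State.setVar]
  -- The heap is initially zero, below `1 * (n + 1)`.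
  · intro y _
    rw [hM]
    change 0 < _
    omega
  · rintro xs st t - ⟨harr, ht⟩
    refine ⟨fun y => by rw [harr, hM], ?_⟩
    set β := blockCount n m n 1
    set W := totalWeight n m n 1 xs
    have k1 : l + 2 ≤ (l + 2) * (Nat.log 2 W + 1) := Nat.le_mul_of_pos_right _ (by omega)
    refine Trace.Le.seq_main ht₁ (Trace.Le.seq_main (tick_le_main le_rfl le_rfl)
      (Trace.Le.seq_main (tick_le_main le_rfl le_rfl) ht le_rfl le_rfl) le_rfl le_rfl) ?_ ?_
    · simp only [Expr.size]
      rw [mul_add (l + 2) β 1]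
      omega
    · simp only [Expr.size]
      rw [mul_add _ β 1]
      omega

/-- For the empty array no space parameter satisfies `1 ≤ m ≤ n`, and only termination has to be
shown. -/
theorem main_runs_zero (m : ℕ) (a : Fin 0 → ℕ) :
    program.MainRuns m a (PMF.pure ()) fun _ _ _ => True := by
  have hw : program.wordBits 0 = 8 := by simp [Program.wordBits]
  rw [Program.MainRuns, hw]
  change Det program 8 0 mainCom (program.init m a) fun _ _ => True
  refine Det.seq (Det.seq (Det.set 1 (Expr.eval_const (by norm_num)) (Det.seq
    (Det.set 0 rfl (Det.loop_exit rfl ?_)))))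
  refine Det.seq (Det.set 1 (Expr.eval_const (by norm_num)) (Det.seq
    (Det.set 1 (Expr.eval_const (by norm_num)) (Det.loop_exit rfl trivial))))

end

/-! ### Uniformity of the resulting permutation -/

open scoped Nat

theorem unif_apply (k v : ℕ) : unif k v = if v ≤ k then ((k + 1 : ℕ) : ENNReal)⁻¹ else 0 := by
  classical
  rw [unif, PMF.map_apply, tsum_fintype]
  simp only [PMF.uniformOfFintype_apply, Fintype.card_fin]
  split_ifs with h
  · rw [Finset.sum_eq_single (⟨v, by omega⟩ : Fin (k + 1))]
    · simp
    · intro u _ hu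
      rw [if_neg]
      rintro rfl
      exact hu rfl
    · simp
  · refine Finset.sum_eq_zero fun u _ => if_neg ?_
    have := u.2
    omega

/-- The distribution of the permutation that results from `k` draws. -/
def permLaw (k : ℕ) : PMF (Equiv.Perm ℕ) := (draws 1 k).map (drawPerm 1)

theorem map_mulRight_apply (p : PMF (Equiv.Perm ℕ)) (σ τ : Equiv.Perm ℕ) :
    p.map (· * τ) σ = p (σ * τ⁻¹) := by
  classical
  rw [PMF.map_apply]
  simp only [← mul_inv_eq_iff_eq_mul]
  rw [tsum_eq_single (σ * τ⁻¹)]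
  · simp
  · intro ρ hρ
    rw [if_neg fun h => hρ h.symm]

/-- The last swap is the right factor of the product, and its draw is independent of the others. -/
theorem permLaw_succ (k : ℕ) :
    permLaw (k + 1) = (unif (k + 1)).bind fun v => (permLaw k).map (· * Equiv.swap (k + 1) v) := by
  have h1 : permLaw (k + 1) = (draws 1 k).bind fun xs =>
      (unif (k + 1)).bind fun v => PMF.pure (drawPerm 1 xs * Equiv.swap (k + 1) v) := by
    rw [permLaw, draws_add, PMF.map_bind]
    refine bind_congr_support _ _ _ fun xs hxs => ?_
    have hlen := (mem_support_draws hxs).1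
    have h2 : draws (1 + k) 1 = (unif (k + 1)).map fun v => [v] := by
      rw [draws, add_comm 1 k]
      simp only [draws, PMF.pure_map]
      rfl
    rw [h2, PMF.map_comp, PMF.map_comp]
    simp only [PMF.map, Function.comp_def]
    congr 1; funext v
    rw [drawPerm_append, hlen, add_comm 1 k]
    simp [drawPerm]
  rw [h1, PMF.bind_comm]
  congr 1; funext v
  rw [permLaw, PMF.map_comp]
  rfl

/-- Undoing the last swap leaves a permutation that fixes `k + 1` only if the draw is the preimage
of `k + 1`; so the last draw can be recovered from `σ`. -/
theorem mul_swap_fixes_iff {k v : ℕ} (hv : v ≤ k + 1) (σ : Equiv.Perm ℕ) :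
    (∀ y, k < y → (σ * Equiv.swap (k + 1) v) y = y) ↔
      (∀ y, k + 1 < y → σ y = y) ∧ σ v = k + 1 := by
  have hout : ∀ y, k + 1 < y → (σ * Equiv.swap (k + 1) v) y = σ y := fun y hy => by
    rw [Equiv.Perm.mul_apply, Equiv.swap_apply_of_ne_of_ne (by omega) (by omega)]
  have hk : (σ * Equiv.swap (k + 1) v) (k + 1) = σ v := by
    rw [Equiv.Perm.mul_apply, Equiv.swap_apply_left]
  constructor
  · intro h
    exact ⟨fun y hy => by rw [← hout y hy]; exact h y (by omega), by rw [← hk]; exact h _ (by omega)⟩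
  · rintro ⟨h1, h2⟩ y hy
    rcases Nat.lt_or_ge (k + 1) y with h | h
    · rw [hout y h, h1 y h]
    · obtain rfl : y = k + 1 := by omega
      rw [hk, h2]

/-- In the step only the draw `v = σ⁻¹ (k + 1)` contributes, with `1 / (k + 2)` times `1 / (k +
1)!`. -/
theorem permLaw_apply (k : ℕ) (σ : Equiv.Perm ℕ) [Decidable (∀ y, k < y → σ y = y)] :
    permLaw k σ = if ∀ y, k < y → σ y = y then (((k + 1)! : ℕ) : ENNReal)⁻¹ else 0 := by
  classical
  induction k generalizing σ with
  | zero =>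
    have h1 : (∀ y, 0 < y → σ y = y) ↔ σ = 1 := by
      refine ⟨fun h => ?_, fun h => by simp [h]⟩
      have h0 : σ 0 = 0 := by
        by_contra hne
        have h2 := h (σ 0) (Nat.pos_of_ne_zero hne)
        exact hne (σ.injective h2)
      ext y
      rcases Nat.eq_zero_or_pos y with rfl | hy
      · simpa using h0
      · simpa using h y hy
    simp only [permLaw, draws, PMF.pure_map, drawPerm, h1, PMF.pure_apply]
    simp
  | succ k ih =>
    rw [permLaw_succ, PMF.bind_apply]
    have hterm : ∀ v, unif (k + 1) v * (permLaw k).map (· * Equiv.swap (k + 1) v) σ =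
        if (∀ y, k + 1 < y → σ y = y) ∧ σ v = k + 1 then (((k + 1 + 1)! : ℕ) : ENNReal)⁻¹ else 0 := by
      intro v
      rw [map_mulRight_apply, Equiv.swap_inv, unif_apply, ih]
      by_cases h1 : v ≤ k + 1
      · rw [if_pos h1, if_congr (mul_swap_fixes_iff h1 σ) rfl rfl]
        split_ifs
        · rw [Nat.factorial_succ (k + 1), Nat.cast_mul, ENNReal.mul_inv] <;> simp
        · simp
      · rw [if_neg h1, zero_mul, if_neg]
        rintro ⟨h2, h3⟩
        rw [h2 v (by omega)] at h3; omega
    simp only [hterm]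
    rw [tsum_eq_single (σ⁻¹ (k + 1))]
    · simp
    · intro v hv
      rw [if_neg]
      rintro ⟨-, h⟩
      exact hv (by rw [← h]; simp)

/-- The permutation of `ℕ` that extends a permutation of `{0, …, n - 1}`. -/
def extendPerm {n : ℕ} (σ : Equiv.Perm (Fin n)) : Equiv.Perm ℕ :=
  Equiv.Perm.ofSubtype (Fin.equivSubtype.permCongr σ)

theorem extendPerm_apply {n : ℕ} (σ : Equiv.Perm (Fin n)) (i : Fin n) : extendPerm σ i = σ i := by
  rw [extendPerm, Equiv.Perm.ofSubtype_apply_of_mem (p := fun y => y < n) _ i.2]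
  rfl

theorem extendPerm_apply_of_le {n : ℕ} (σ : Equiv.Perm (Fin n)) {y : ℕ} (h : n ≤ y) :
    extendPerm σ y = y := by
  rw [extendPerm, Equiv.Perm.ofSubtype_apply_of_not_mem (p := fun y => y < n) _ (by omega)]

theorem extendPerm_injective {n : ℕ} : Function.Injective (extendPerm (n := n)) := by
  intro σ τ h
  ext i
  rw [← extendPerm_apply, h, extendPerm_apply]

/-- An injective map that fixes everything from `n` on maps the numbers below `n` among themselves.
-/
theorem exists_extendPerm {n : ℕ} {τ : Equiv.Perm ℕ} (h : ∀ y, n ≤ y → τ y = y) :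
    ∃ σ : Equiv.Perm (Fin n), extendPerm σ = τ := by
  have h1 : ∀ y, τ y < n ↔ y < n := by
    intro y
    constructor
    · intro hy
      by_contra hcon
      rw [h y (by omega)] at hy; omega
    · intro hy
      by_contra hcon
      have := τ.injective (h (τ y) (by omega))
      omega
  refine ⟨Fin.equivSubtype.symm.permCongr (τ.subtypePerm h1), ?_⟩
  have h2 : Fin.equivSubtype.permCongr (Fin.equivSubtype.symm.permCongr (τ.subtypePerm h1)) =
      τ.subtypePerm h1 := by
    ext; simp
  rw [extendPerm, h2]
  exact Equiv.Perm.ofSubtype_subtypePerm _ fun y hy => by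
    by_contra hcon
    exact hy (h y (by omega))

/-- The law is carried by the extended permutations, all of the same mass, so probabilities on `Perm
ℕ` become counts on `Perm (Fin n)`. -/
theorem permLaw_toOuterMeasure {n : ℕ} (hn : 1 ≤ n) (A : Set (Equiv.Perm ℕ)) :
    (permLaw (n - 1)).toOuterMeasure A =
      (Nat.card {σ : Equiv.Perm (Fin n) // extendPerm σ ∈ A} : ENNReal) / (n ! : ENNReal) := by
  classical
  have hn' : n - 1 + 1 = n := by omega
  rw [PMF.toOuterMeasure_apply, ← (extendPerm_injective (n := n)).tsum_eq, tsum_fintype]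
  · have h1 : ∀ σ : Equiv.Perm (Fin n), A.indicator (permLaw (n - 1)) (extendPerm σ) =
        if extendPerm σ ∈ A then (n ! : ENNReal)⁻¹ else 0 := by
      intro σ
      rw [Set.indicator_apply, permLaw_apply, hn',
        if_pos fun y hy => extendPerm_apply_of_le σ (by omega)]
    simp only [h1]
    rw [← Finset.sum_filter, Finset.sum_const, nsmul_eq_mul, Nat.card_eq_fintype_card,
      Fintype.card_subtype, div_eq_mul_inv]
  · intro τ hτ
    rw [Function.mem_support] at hτ
    have h2 : permLaw (n - 1) τ ≠ 0 := fun h => hτ (Set.indicator_apply_eq_zero.2 fun _ => h)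
    rw [permLaw_apply] at h2
    have h3 : ∀ y, n - 1 < y → τ y = y := by
      by_contra hcon
      exact h2 (if_neg hcon)
    exact exists_extendPerm fun y hy => h3 y (by omega)

theorem prob_perm {n m : ℕ} (hn : 1 ≤ n) (hm : 1 ≤ m) (hmn : m ≤ n) (a b : Fin n → ℕ) :
    program.prob m a {r | ∀ i : Fin n, r.1.mem (.arr i) = b i} =
      (Nat.card {σ : Equiv.Perm (Fin n) // a ∘ σ = b} : ENNReal) / (n ! : ENNReal) := by
  let A : Set (Equiv.Perm ℕ) := {τ | ∀ i : Fin n, (program.init m a).mem (.arr (τ i)) = b i}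
  have hext : ∀ σ : Equiv.Perm (Fin n), extendPerm σ ∈ A ↔ a ∘ σ = b := by
    intro σ
    simp only [A, Set.mem_ofPred_eq, extendPerm_apply, funext_iff]
    refine forall_congr' fun i => ?_
    simp [Program.init]
  rw [(main_runs hn hm hmn a).prob_eq (A := drawPerm 1 ⁻¹' A), ← PMF.toOuterMeasure_map_apply]
  · change (permLaw (n - 1)).toOuterMeasure A = _
    rw [permLaw_toOuterMeasure hn]
    simp only [hext]
  · rintro xs st t ⟨h, -⟩
    simp only [A, Set.mem_preimage, Set.mem_ofPred_eq, h]

/-! ### Expected weight of the items -/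

section

variable {n m s b : ℕ}

/-- Within a residue class modulo `b`, a number is determined by its quotient. -/
theorem card_filter_mod_le (s b r : ℕ) :
    ((Finset.range s).filter fun v => v % b = r).card ≤ s / b + 1 := by
  rw [← Finset.card_range (s / b + 1)]
  refine Finset.card_le_card_of_injOn (· / b) (fun v hv => ?_) fun v hv u hu h => ?_
  · simp only [Finset.coe_filter, Finset.mem_range, Set.mem_ofPred_eq] at hv
    simp only [Finset.coe_range, Set.mem_Iio]
    exact Nat.lt_succ_of_le (Nat.div_le_div_right hv.1.le)
  · simp only [Finset.coe_filter, Finset.mem_range, Set.mem_ofPred_eq] at hv hu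
    rw [← Nat.div_add_mod v b, ← Nat.div_add_mod u b, hv.2, hu.2]
    simp only at h
    rw [h]

/-- A target before the block can only hit the slot of `a.j`, if that position is before the block
too and in the same class modulo `b`. A target in the block must equal `a.i` or `a.j`. -/
theorem card_conf_le (hb : 1 ≤ b) (hbm : b ≤ m) {a : Item} {i : ℕ} (hai : s ≤ a.i)
    (haj : a.j ≤ a.i) (hlt : a.i < i) (hi : i < s + b) :
    ((Finset.range (i + 1)).filter fun v => Conf m s b a ⟨i, v, 0⟩).card ≤ s / b + 2 := by
  have hmod : ∀ v, v % b < b := fun v => Nat.mod_lt _ hb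
  rcases Nat.lt_or_ge a.j s with hj | hj
  · have hsub : ((Finset.range (i + 1)).filter fun v => Conf m s b a ⟨i, v, 0⟩) ⊆
        insert a.i ((Finset.range s).filter fun v => v % b = a.j % b) := by
      intro v hv
      simp only [Finset.mem_filter, Finset.mem_range, Conf, slot, if_pos hj, if_neg hai.not_gt,
        Finset.mem_insert] at hv ⊢
      have := hmod v
      split_ifs at hv <;> omega
    refine (Finset.card_le_card hsub).trans ((Finset.card_insert_le _ _).trans ?_)
    have := card_filter_mod_le s b (a.j % b)
    omega
  · have hsub : ((Finset.range (i + 1)).filter fun v => Conf m s b a ⟨i, v, 0⟩) ⊆ {a.i, a.j} := by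
      intro v hv
      simp only [Finset.mem_filter, Finset.mem_range, Conf, slot, if_neg hj.not_gt,
        if_neg hai.not_gt, Finset.mem_insert, Finset.mem_singleton] at hv ⊢
      split_ifs at hv <;> omega
    exact (Finset.card_le_card hsub).trans (Finset.card_le_two.trans (Nat.le_add_left 2 _))

open scoped ENNReal

theorem expect_unif (i : ℕ) (g : ℕ → ENNReal) :
    expect (unif i) g = ∑ v ∈ Finset.range (i + 1), ((i + 1 : ℕ) : ENNReal)⁻¹ * g v := by
  rw [expect, tsum_eq_sum (s := Finset.range (i + 1))]
  · refine Finset.sum_congr rfl fun v hv => ?_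
    rw [unif_apply, if_pos (by simpa [Nat.lt_succ_iff] using hv)]
  · intro v hv
    rw [unif_apply, if_neg (by simpa using hv), zero_mul]

/-- Because of `b ≤ s`, the `s / b + 2` bad values are at most `3 * s / b`, and there are more than
`s` equally likely values. This is where blocks must not exceed their starting position. -/
theorem expect_conf_le (hb : 1 ≤ b) (hbs : b ≤ s) (hbm : b ≤ m) {a : Item} {i : ℕ} (hai : s ≤ a.i)
    (haj : a.j ≤ a.i) (hlt : a.i < i) (hi : i < s + b) (z : ENNReal) :
    expect (unif i) (fun v => if Conf m s b a ⟨i, v, 0⟩ then z else 0) ≤ 3 / b * z := by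
  rw [expect_unif, ← Finset.mul_sum, ← Finset.sum_filter, Finset.sum_const, nsmul_eq_mul,
    ← mul_assoc]
  gcongr
  have hb0 : (b : ENNReal) ≠ 0 := by simp; omega
  rw [ENNReal.le_div_iff_mul_le (Or.inl hb0) (Or.inl (ENNReal.natCast_ne_top b)), mul_assoc, mul_comm,
    ← div_eq_mul_inv]
  refine ENNReal.div_le_of_le_mul ?_
  have h1 := card_conf_le hb hbm hai haj hlt hi
  have h2 : (s / b + 2) * b ≤ 3 * (i + 1) := by
    have := Nat.div_mul_le_self s b
    rw [add_mul]; omega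
  exact_mod_cast (Nat.mul_le_mul_right b h1).trans h2

theorem expect_weight_filter_le (hb : 1 ≤ b) (hbs : b ≤ s) (hbm : b ≤ m) {i : ℕ} (hi : i < s + b)
    (acc : List Item) (hacc : ∀ a ∈ acc, s ≤ a.i ∧ a.j ≤ a.i ∧ a.i < i) :
    expect (unif i) (fun v =>
      ((weight (acc.filter fun a => Conf m s b a ⟨i, v, 0⟩) : ℕ) : ENNReal)) ≤
        3 / b * (weight acc : ENNReal) := by
  induction acc with
  | nil => simp [expect]
  | cons a acc ih =>
    have h1 : ∀ v, ((weight ((a :: acc).filter fun a => Conf m s b a ⟨i, v, 0⟩) : ℕ) : ENNReal) =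
        (if Conf m s b a ⟨i, v, 0⟩ then (a.z : ENNReal) else 0) +
          ((weight (acc.filter fun a => Conf m s b a ⟨i, v, 0⟩) : ℕ) : ENNReal) := by
      intro v
      rw [List.filter_cons]
      by_cases h : Conf m s b a ⟨i, v, 0⟩ <;> simp [h]
    simp only [h1]
    rw [expect_add, weight_cons, Nat.cast_add, mul_add]
    obtain ⟨g1, g2, g3⟩ := hacc a List.mem_cons_self
    exact add_le_add (expect_conf_le hb hbs hbm g1 g2 g3 hi _)
      (ih fun c hc => hacc c (List.mem_cons_of_mem _ hc))

/-- The next item has expected weight at most `1 + (6 / b) * weight acc`, twice the `3 / b` of a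
conflict; the bound iterates this over the remaining draws. -/
theorem expect_weight_itemsAfter_le (hb : 1 ≤ b) (hbs : b ≤ s) (hbm : b ≤ m) (k : ℕ) :
    ∀ (acc : List Item) (i : ℕ), s ≤ i → i + k ≤ s + b →
      (∀ a ∈ acc, s ≤ a.i ∧ a.j ≤ a.i ∧ a.i < i) →
      expect (draws i k) (fun xs =>
        (weight acc : ENNReal) + (weight (itemsAfter m s b acc i xs) : ENNReal)) ≤
          (1 + 6 / b) ^ k * (weight acc + k) := by
  induction k with
  | zero => intro acc i _ _ _; simp [draws, expect_pure, itemsAfter]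
  | succ k ih =>
    intro acc i hi hik hacc
    have hρ : (1 : ENNReal) ≤ 1 + 6 / b := le_self_add
    rw [draws, expect_bind]
    simp only [expect_map]
    set w : ℕ → ENNReal := fun v =>
      ((weight (acc.filter fun a => Conf m s b a ⟨i, v, 0⟩) : ℕ) : ENNReal) with hw
    calc _ ≤ expect (unif i) fun v => (1 + 6 / b) ^ k * ((weight acc + k + 1) + 2 * w v) := by
          refine expect_mono fun v hv => ?_
          have hvi : v ≤ i := by
            by_contra hcon
            rw [PMF.mem_support_iff, unif_apply, if_neg hcon] at hv
            exact hv rfl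
          set c : Item := ⟨i, v, 1 + 2 *
            ((acc.filter fun a => Conf m s b a ⟨i, v, 0⟩).map Item.z).sum⟩ with hc
          refine le_trans (le_of_eq ?_) ((ih (acc ++ [c]) (i + 1) (by omega) (by omega) ?_).trans
            (le_of_eq ?_))
          · congr 1; funext xs
            rw [itemsAfter, ← hc, weight_cons, weight_append, weight_cons, weight_nil]
            push_cast; ring
          · intro a ha
            rcases List.mem_append.1 ha with ha | ha
            · have := hacc a ha; omega
            · rw [List.mem_singleton] at ha
              subst ha
              exact ⟨hi, hvi, Nat.lt_succ_self _⟩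
          · rw [weight_append, weight_cons, weight_nil]
            have : (c.z : ENNReal) = 1 + 2 * w v := by
              rw [hc, hw]; simp [weight]
            push_cast
            rw [this]; ring
      _ = (1 + 6 / b) ^ k * ((weight acc + k + 1) + 2 * expect (unif i) w) := by
          rw [expect_mul_left, expect_add, expect_const, expect_mul_left]
      _ ≤ (1 + 6 / b) ^ k * ((weight acc + k + 1) + 2 * (3 / b * weight acc)) := by
          gcongr
          exact expect_weight_filter_le hb hbs hbm (by omega) acc hacc
      _ = (1 + 6 / b) ^ k * ((1 + 6 / b) * weight acc + 1 * (k + 1)) := by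
          congr 1
          have : (2 : ENNReal) * (3 / b) = 6 / b := by
            rw [← mul_div_assoc]; norm_num
          rw [← mul_assoc, this]; ring
      _ ≤ (1 + 6 / b) ^ k * ((1 + 6 / b) * weight acc + (1 + 6 / b) * (k + 1)) := by
          gcongr
      _ = _ := by push_cast; ring

/-- The power is at most `e ^ 6`, and `e < 3`. -/
theorem one_add_div_pow_le (hb : 1 ≤ b) : (1 + 6 / b : ENNReal) ^ b ≤ 729 := by
  have hb' : (0 : ℝ) < b := by exact_mod_cast hb
  have h1 : (1 + 6 / b : ENNReal) = ENNReal.ofReal (1 + 6 / b) := by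
    rw [ENNReal.ofReal_add (by norm_num) (by positivity), ENNReal.ofReal_div_of_pos hb']
    simp
  rw [h1, ← ENNReal.ofReal_pow (by positivity), show (729 : ENNReal) = ENNReal.ofReal 729 by simp]
  refine ENNReal.ofReal_le_ofReal ?_
  calc (1 + 6 / b : ℝ) ^ b ≤ Real.exp (6 / b) ^ b := by
        gcongr
        linarith [Real.add_one_le_exp (6 / (b : ℝ))]
    _ = Real.exp 1 ^ 6 := by
        rw [← Real.exp_nat_mul, ← Real.exp_nat_mul]
        congr 1
        field_simp
        norm_num
    _ ≤ 3 ^ 6 := by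
        gcongr
        linarith [Real.exp_one_lt_d9]
    _ = 729 := by norm_num

theorem expect_weight_itemsOf_le (hb : 1 ≤ b) (hbs : b ≤ s) (hbm : b ≤ m) :
    expect (draws s b) (fun xs => (weight (itemsOf m s b xs) : ENNReal)) ≤ 729 * b := by
  have h := expect_weight_itemsAfter_le hb hbs hbm b [] s le_rfl le_rfl (by simp)
  simp only [weight_nil, Nat.cast_zero, zero_add] at h
  exact h.trans (mul_le_mul_left (one_add_div_pow_le hb) _)

/-- Conditionally on the draws of one block, the rest of the array has the same form, so linearity
of expectation adds the block bounds. -/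
theorem expect_totalWeight_le (hm : 1 ≤ m) (k : ℕ) : ∀ s, 1 ≤ s →
    expect (draws s (n - s)) (fun xs => (totalWeight n m k s xs : ENNReal)) ≤ 729 * (n - s : ℕ) := by
  induction k with
  | zero => intro s _; simp [totalWeight, expect]
  | succ k ih =>
    intro s hs
    rcases Nat.lt_or_ge s n with hsn | hsn
    swap
    · simp [totalWeight, hsn.not_gt, expect]
    set b := blockLen n m s with hb
    have hb1 : 1 ≤ b := by unfold blockLen at hb; omega
    have hbn : b ≤ n - s := by unfold blockLen at hb; omega
    have hsplit : n - s = b + (n - (s + b)) := by omega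
    rw [hsplit, draws_add, expect_bind]
    simp only [expect_map]
    calc _ ≤ expect (draws s b) fun xs => (weight (itemsOf m s b xs) : ENNReal) +
            729 * (n - (s + b) : ℕ) := by
          refine expect_mono fun xs hxs => ?_
          have hlen := (mem_support_draws hxs).1
          have e1 : ∀ ys, ((totalWeight n m (k + 1) s (xs ++ ys) : ℕ) : ENNReal) =
              (weight (itemsOf m s b xs) : ENNReal) + (totalWeight n m k (s + b) ys : ENNReal) := by
            intro ys
            rw [totalWeight, if_pos hsn, ← hb, List.take_left' hlen, List.drop_left' hlen,
              Nat.cast_add]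
          simp only [e1]
          rw [expect_add, expect_const]
          gcongr
          exact ih _ (by omega)
      _ ≤ 729 * b + 729 * (n - (s + b) : ℕ) := by
          rw [expect_add, expect_const]
          gcongr
          exact expect_weight_itemsOf_le hb1 (by unfold blockLen at hb; omega)
            (by unfold blockLen at hb; omega)
      _ = _ := by rw [Nat.cast_add, mul_add]

end

/-! ### Heap use and number of blocks -/

theorem heapWords_le {m f wk sp : ℕ} {t : Trace} (h : t.Le (mainCost m f wk sp)) :
    t.heapWords ≤ 4 * m := by
  refine Finset.sup_le fun r hr => ?_
  rcases r with y | y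
  · exact Nat.zero_le _
  · have hy : Loc.aux y ∈ heapCells m := by
      rw [Finset.mem_union, Finset.mem_union] at hr
      rcases hr with (hr | hr) | hr
      · exact h.reads hr
      · exact h.writes hr
      · exact h.maxes hr
    exact hy y rfl

/-- A block that is not the last one either doubles the start, which is paid by `Nat.log 2 s`, or
has length `m`, which is paid by `(n - s) / m`. The final `1` pays for the last block. -/
theorem blockCount_le {n m : ℕ} (hm : 1 ≤ m) (k : ℕ) : ∀ s, 1 ≤ s → s < n →
    blockCount n m k s + Nat.log 2 s ≤ Nat.log 2 n + (n - s) / m + 1 := by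
  induction k with
  | zero =>
    intro s _ hsn
    have : Nat.log 2 s ≤ Nat.log 2 n := Nat.log_mono_right hsn.le
    have : 0 ≤ (n - s) / m := Nat.zero_le _
    simp only [blockCount]; omega
  | succ k ih =>
    intro s hs hsn
    have hlog : Nat.log 2 s ≤ Nat.log 2 n := Nat.log_mono_right hsn.le
    rw [blockCount, if_pos hsn]
    set b := blockLen n m s with hb
    rcases Nat.lt_or_ge (s + b) n with h | h
    · have h1 := ih (s + b) (by omega) h
      have h2 : b = s ∨ b = m := by unfold blockLen at hb; omega
      rcases h2 with h2 | h2
      · have h3 : Nat.log 2 (s + b) = Nat.log 2 s + 1 := by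
          rw [h2, ← two_mul, mul_comm, Nat.log_mul_base (by norm_num) (by omega)]
        have h4 : (n - (s + b)) / m ≤ (n - s) / m := Nat.div_le_div_right (by omega)
        omega
      · have h3 : Nat.log 2 s ≤ Nat.log 2 (s + b) := Nat.log_mono_right (by omega)
        have h4 : (n - s) / m = (n - (s + b)) / m + 1 := by
          rw [show n - s = n - (s + b) + m by omega, Nat.add_div_right _ (by omega)]
        omega
    · have h1 : blockCount n m k (s + b) = 0 := by
        cases k with
        | zero => rfl
        | succ k => rw [blockCount, if_neg (by omega)]
      have : 0 ≤ (n - s) / m := Nat.zero_le _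
      omega

theorem natLog_mul_log_two_le (x : ℕ) : (Nat.log 2 x : ℝ) * Real.log 2 ≤ Real.log x := by
  rcases Nat.eq_zero_or_pos x with rfl | hx
  · simp
  · rw [← Real.log_pow]
    refine Real.log_le_log (by positivity) ?_
    exact_mod_cast Nat.pow_log_le_self 2 hx.ne'

/-! ### Estimates in terms of `n` and `ε` -/

section

variable {n : ℕ} {ε : ℝ}

theorem log_two_le (hn : 2 ≤ n) : Real.log 2 ≤ Real.log n :=
  Real.log_le_log (by norm_num) (by exact_mod_cast hn)

theorem natLog_add_two_le (hn : 2 ≤ n) : ((Nat.log 2 n + 2 : ℕ) : ℝ) ≤ 5 * Real.log n := by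
  have h1 := natLog_mul_log_two_le n
  have h2 := log_two_le hn
  have h3 := Real.log_two_gt_d9
  have h4 : (0 : ℝ) ≤ Nat.log 2 n := Nat.cast_nonneg _
  push_cast
  nlinarith

theorem spaceParam_pos (hn : 1 ≤ n) : 1 ≤ spaceParam n ε := by
  have : (0 : ℝ) < n := by exact_mod_cast hn
  exact Nat.ceil_pos.2 (by positivity)

theorem spaceParam_le_self (hε : 0 < ε) (hn : 1 ≤ n) : spaceParam n ε ≤ n := by
  refine Nat.ceil_le.2 ?_
  calc (n : ℝ) ^ (1 - ε) ≤ (n : ℝ) ^ (1 : ℝ) :=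
        Real.rpow_le_rpow_of_exponent_le (by exact_mod_cast hn) (by linarith)
    _ = n := Real.rpow_one _

theorem spaceParam_le (hε : ε < 1) (hn : 1 ≤ n) : (spaceParam n ε : ℝ) ≤ 2 * (n : ℝ) ^ (1 - ε) := by
  have h1 : (spaceParam n ε : ℝ) < (n : ℝ) ^ (1 - ε) + 1 := Nat.ceil_lt_add_one (by positivity)
  have h2 : 1 ≤ (n : ℝ) ^ (1 - ε) := Real.one_le_rpow (by exact_mod_cast hn) (by linarith)
  linarith

/-- The choice of `m` gives `n / m ≤ n ^ ε`, and the logarithmic number of doubling blocks is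
absorbed by `log n ≤ n ^ ε / ε`. -/
theorem blockCount_add_one_le (hε : 0 < ε) (hn : 2 ≤ n) :
    ((blockCount n (spaceParam n ε) n 1 + 1 : ℕ) : ℝ) ≤ (5 / ε + 1) * (n : ℝ) ^ ε := by
  have hn0 : (0 : ℝ) < n := by exact_mod_cast (by omega : 0 < n)
  set m := spaceParam n ε with hm
  have hm1 : 1 ≤ m := spaceParam_pos (by omega)
  have h1 := blockCount_le hm1 n 1 le_rfl (by omega : 1 < n)
  have h2 : (n - 1) / m ≤ n / m := Nat.div_le_div_right (by omega)
  have h3 : blockCount n m n 1 + 1 ≤ (Nat.log 2 n + 2) + n / m := by omega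
  have h4 : ((n / m : ℕ) : ℝ) ≤ (n : ℝ) ^ ε := by
    refine Nat.cast_div_le.trans ?_
    rw [div_le_iff₀ (by exact_mod_cast hm1)]
    calc (n : ℝ) = (n : ℝ) ^ ε * (n : ℝ) ^ (1 - ε) := by
          rw [← Real.rpow_add hn0]; simp
      _ ≤ _ := by gcongr; exact Nat.le_ceil _
  have h5 := natLog_add_two_le hn
  have h6 : Real.log n ≤ (n : ℝ) ^ ε / ε := Real.log_le_rpow_div hn0.le hε
  calc ((blockCount n m n 1 + 1 : ℕ) : ℝ) ≤ ((Nat.log 2 n + 2 : ℕ) : ℝ) + ((n / m : ℕ) : ℝ) := by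
        exact_mod_cast h3
    _ ≤ 5 * ((n : ℝ) ^ ε / ε) + (n : ℝ) ^ ε := by linarith
    _ = _ := by ring

/-- Each block wastes `O(log n)` work on an incomplete group and on the loop. Since `ε < 1`, the
factor `log n` is at most a multiple of `n ^ (1 - ε)`, so the waste is linear in total. -/
theorem mul_blockCount_le (hε : 0 < ε) (hε' : ε < 1) (hn : 2 ≤ n) :
    (((Nat.log 2 n + 2) * (blockCount n (spaceParam n ε) n 1 + 1) : ℕ) : ℝ) ≤
      5 / (1 - ε) * (5 / ε + 1) * n := by
  have hn0 : (0 : ℝ) < n := by exact_mod_cast (by omega : 0 < n)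
  have hpos : 0 < 1 - ε := by linarith
  rw [Nat.cast_mul]
  have h6 : Real.log n ≤ (n : ℝ) ^ (1 - ε) / (1 - ε) := Real.log_le_rpow_div hn0.le hpos
  calc _ ≤ (5 * ((n : ℝ) ^ (1 - ε) / (1 - ε))) * ((5 / ε + 1) * (n : ℝ) ^ ε) := by
        refine mul_le_mul ?_ (blockCount_add_one_le hε hn) (Nat.cast_nonneg _) (by positivity)
        linarith [natLog_add_two_le hn]
    _ = 5 / (1 - ε) * (5 / ε + 1) * ((n : ℝ) ^ (1 - ε) * (n : ℝ) ^ ε) := by ring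
    _ = _ := by rw [← Real.rpow_add hn0]; simp

/-- With `729 < 2 ^ 10`, the natural logarithm of `W` is at most `10 * log 2 + log n + c * log n`,
and each of these terms is a multiple of `c * log n`. -/
theorem natLog_add_one_le {W : ℕ} {c : ℝ} (hc : 1 ≤ c) (hn : 2 ≤ n)
    (hW : (W : ℝ) ≤ 729 * n * (n : ℝ) ^ c) :
    ((Nat.log 2 W + 1 : ℕ) : ℝ) ≤ 20 * c * Real.log n := by
  have hn0 : (0 : ℝ) < n := by exact_mod_cast (by omega : 0 < n)
  have h1 := natLog_mul_log_two_le W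
  have h2 := log_two_le hn
  have h3 := Real.log_two_gt_d9
  have h4 : Real.log W ≤ 10 * Real.log 2 + Real.log n + c * Real.log n := by
    have hexp : Real.log ((2 : ℝ) ^ 10 * n * (n : ℝ) ^ c) =
        10 * Real.log 2 + Real.log n + c * Real.log n := by
      rw [Real.log_mul (by positivity) (by positivity), Real.log_mul (by positivity) (by positivity),
        Real.log_pow, Real.log_rpow hn0]
      norm_num
    rw [← hexp]
    -- For `W = 0` the convention `Real.log 0 = 0` applies.
    rcases Nat.eq_zero_or_pos W with rfl | hpos
    · rw [hexp]
      have : 0 ≤ c * Real.log n := mul_nonneg (by linarith) (by linarith)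
      simp only [Nat.cast_zero, Real.log_zero]
      linarith
    · refine Real.log_le_log (by exact_mod_cast hpos) (hW.trans ?_)
      gcongr
      norm_num
  have h5 : Real.log n ≤ c * Real.log n := le_mul_of_one_le_left (by linarith) hc
  have h6 : (Nat.log 2 W : ℝ) * Real.log 2 ≤ 12 * (c * Real.log n) := by linarith
  have h7 : (0 : ℝ) ≤ Nat.log 2 W := Nat.cast_nonneg _
  push_cast
  nlinarith

/-! ### Assembly of the five claims -/

theorem randomlyPermutes (hε : 0 < ε) : program.RandomlyPermutes ε := by
  intro n a _
  rcases Nat.eq_zero_or_pos n with rfl | hn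
  · have h1 := (main_runs_zero (spaceParam 0 ε) a).prob_univ
    refine ⟨h1, fun b => ?_⟩
    have h2 : {r : State program.V × Trace | ∀ i : Fin 0, r.1.mem (.arr i) = b i} = Set.univ :=
      Set.eq_univ_of_forall fun r i => i.elim0
    have h3 : Nat.card {σ : Equiv.Perm (Fin 0) // a ∘ σ = b} = 1 := by
      rw [Nat.card_eq_one_iff_unique]
      exact ⟨inferInstance, ⟨1, Subsingleton.elim _ _⟩⟩
    rw [h2, h1, h3]
    simp
  · exact ⟨(main_runs hn (spaceParam_pos hn) (spaceParam_le_self hε hn) a).prob_univ,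
      prob_perm hn (spaceParam_pos hn) (spaceParam_le_self hε hn) a⟩

theorem stackBigO (hε : 0 < ε) : program.StackBigO ε fun n => Real.log n := by
  -- A frame has `18 + 1` words, the number of frames is at most `5 * log n + 2`, and `2 ≤ 3 * log
  -- n`; so the constant is `19 * 8`.
  refine ⟨152, by norm_num, fun n hn a _ r hr => ?_⟩
  obtain ⟨xs, -, ht⟩ := (main_runs (by omega) (spaceParam_pos (by omega))
    (spaceParam_le_self hε (by omega)) a).exists_of_law_ne_zero hr
  have h1 : program.stackWords r.2 ≤ (Nat.log 2 n + 2 + 2) * 19 :=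
    Nat.mul_le_mul_right 19 (by have := ht.frames; simp only [mainCost] at this; omega)
  have h2 := natLog_add_two_le hn
  have h3 := log_two_le hn
  have h4 := Real.log_two_gt_d9
  have h5 : (program.stackWords r.2 : ℝ) ≤ (((Nat.log 2 n + 2 : ℕ) : ℝ) + 2) * 19 := by
    exact_mod_cast h1
  linarith

theorem heapBigO (hε : 0 < ε) (hε' : ε < 1) : program.HeapBigO ε fun n => (n : ℝ) ^ (1 - ε) := by
  -- The heap has `4 * m` cells in use, and rounding up costs at most a factor `2`.
  refine ⟨8, by norm_num, fun n hn a _ r hr => ?_⟩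
  obtain ⟨xs, -, ht⟩ := (main_runs (by omega) (spaceParam_pos (by omega))
    (spaceParam_le_self hε (by omega)) a).exists_of_law_ne_zero hr
  have h1 : (r.2.heapWords : ℝ) ≤ 4 * (spaceParam n ε : ℝ) := by exact_mod_cast heapWords_le ht
  have h2 := spaceParam_le hε' (by omega : 1 ≤ n)
  linarith

theorem expect_totalWeight_le_ofReal {m : ℕ} (hm : 1 ≤ m) :
    expect (draws 1 (n - 1)) (fun xs => (totalWeight n m n 1 xs : ENNReal)) ≤
      ENNReal.ofReal (729 * n) := by
  refine (expect_totalWeight_le hm n 1 le_rfl).trans ?_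
  rw [ENNReal.ofReal_mul (by norm_num), ENNReal.ofReal_natCast]
  simp only [ENNReal.ofReal_ofNat]
  gcongr
  omega

theorem expectedWorkBigO (hε : 0 < ε) (hε' : ε < 1) :
    program.ExpectedWorkBigO ε fun n => (n : ℝ) := by
  have hpos : 0 < 1 - ε := by linarith
  set D : ℝ := 5 / (1 - ε) * (5 / ε + 1) with hD
  have hD0 : 0 < D := by positivity
  -- The summands are `1` for the items, `D` for the overhead of the blocks and `729` for the
  -- expected weight.
  refine ⟨10100 * (730 + D), by positivity, fun n hn a _ => ?_⟩
  have hm1 : 1 ≤ spaceParam n ε := spaceParam_pos (by omega)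
  refine ((main_runs (by omega) hm1 (spaceParam_le_self hε (by omega)) a).expectedWork_le
    fun xs st t h => Nat.cast_le.2 h.2.work).trans ?_
  set m := spaceParam n ε
  set B := (Nat.log 2 n + 2) * (blockCount n m n 1 + 1) with hB
  have hBD : (B : ℝ) ≤ D * n := mul_blockCount_le hε hε' hn
  have hcast : ∀ xs, ((10100 * (n + B + totalWeight n m n 1 xs) : ℕ) : ENNReal) =
      10100 * ((n + B : ℕ) + (totalWeight n m n 1 xs : ENNReal)) := fun xs => by push_cast; ring
  simp only [mainCost, hcast]
  rw [expect_mul_left, expect_add, expect_const]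
  calc _ ≤ 10100 * (ENNReal.ofReal ((1 + D) * n) + ENNReal.ofReal (729 * n)) := by
        gcongr
        · rw [← ENNReal.ofReal_natCast]
          refine ENNReal.ofReal_le_ofReal ?_
          push_cast
          linarith
        · exact expect_totalWeight_le_ofReal hm1
    _ = ENNReal.ofReal (10100 * (730 + D) * n) := by
        rw [← ENNReal.ofReal_add (by positivity) (by positivity),
          show (10100 : ENNReal) = ENNReal.ofReal 10100 by simp, ← ENNReal.ofReal_mul (by norm_num)]
        congr 1; ring

theorem spanBigOWhp (hε : 0 < ε) :
    program.SpanBigOWhp ε fun n => (n : ℝ) ^ ε * Real.log n ^ 2 := by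
  set K : ℝ := 5 / ε + 1 with hK
  have hK0 : 0 < K := by positivity
  -- The constant is `5100 * 5 * 20 * K`, with factors from the span of the main procedure, the
  -- group length, the number of rounds and the number of blocks.
  refine ⟨510000 * K, by positivity, fun c hc n hn a _ => ?_⟩
  have hn0 : (0 : ℝ) < n := by exact_mod_cast (by omega : 0 < n)
  have hm1 : 1 ≤ spaceParam n ε := spaceParam_pos (by omega)
  have hE := expect_totalWeight_le_ofReal (n := n) hm1
  have ha0 : 0 < 729 * n * (n : ℝ) ^ c := by positivity
  -- The threshold is `n ^ c` times the bound on the expectation, so it is exceeded with probability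
  -- at most `n ^ (-c)`; it enters the span only through its logarithm.
  have hmarkov := one_sub_le_of_expect_le (a := ENNReal.ofReal (729 * n * (n : ℝ) ^ c))
    (ENNReal.ofReal_pos.2 ha0).ne' ENNReal.ofReal_ne_top hE
  rw [← ENNReal.ofReal_div_of_pos ha0, show 729 * n / (729 * n * (n : ℝ) ^ c) = (n : ℝ) ^ (-c) by
    rw [Real.rpow_neg hn0.le]; field_simp] at hmarkov
  refine hmarkov.trans ((main_runs (by omega) hm1 (spaceParam_le_self hε (by omega)) a).le_prob ?_)
  rintro xs st t ⟨-, ht⟩ hxs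
  simp only [Set.mem_ofPred_eq] at hxs ⊢
  have hW : (totalWeight n (spaceParam n ε) n 1 xs : ℝ) ≤ 729 * n * (n : ℝ) ^ c := by
    rwa [← ENNReal.ofReal_natCast, ENNReal.ofReal_le_ofReal_iff ha0.le] at hxs
  have h1 := natLog_add_one_le hc hn hW
  have h2 := natLog_add_two_le hn
  have h3 := blockCount_add_one_le hε hn
  have hl : 0 ≤ Real.log n := Real.log_natCast_nonneg n
  have h4 : (t.span : ℝ) ≤ 5100 * (((Nat.log 2 n + 2 : ℕ) : ℝ) *
      ((Nat.log 2 (totalWeight n (spaceParam n ε) n 1 xs) + 1 : ℕ) : ℝ) *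
        ((blockCount n (spaceParam n ε) n 1 + 1 : ℕ) : ℝ)) := by
    exact_mod_cast ht.span
  calc (t.span : ℝ) ≤ _ := h4
    _ ≤ 5100 * ((5 * Real.log n) * (20 * c * Real.log n) * (K * (n : ℝ) ^ ε)) := by
        gcongr
    _ = _ := by ring

end

end Shuffle

end ForkJoin

end

theorem mainTheorem3 :
    ∃ P : ForkJoin.Program, P.IsRelaxedPIP ∧
      ∀ ε : ℝ, 0 < ε → ε < 1 →
        P.RandomlyPermutes ε ∧
        P.ExpectedWorkBigO ε (fun n => (n : ℝ)) ∧
        P.SpanBigOWhp ε (fun n => (n : ℝ) ^ ε * Real.log n ^ 2) ∧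
        P.HeapBigO ε (fun n => (n : ℝ) ^ (1 - ε)) := by
  open ForkJoin.Shuffle in
  exact ⟨program,
    fun _ hε hε' => ⟨stackBigO hε, heapBigO hε hε', 2, spanBigOWhp hε⟩,
    fun _ hε hε' => ⟨randomlyPermutes hε, expectedWorkBigO hε hε', spanBigOWhp hε,
      heapBigO hε hε'⟩⟩
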